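/- **Conventions.** All algebras are $C^*$-algebras. $\mathcal K=\mathcal K(\mathcal H)$ is the algebra of compact operators on an infinite-dimensional separable Hilbert space $\mathcal H$, and $A\otimes\mathcal K$ is the $C^*$-norm completion of the algebraic tensor product (computed spatially in a faithful representation). *Finite-fold coverings.* A unital noncommutative finite-fold covering $(B,\widetilde B,G)$ consists of unital $C^*$-algebras $B\subset\widetilde B$ and a finite group $G$ acting effectively on $\widetilde B$ by $*$-automorphisms with $\widetilde B^G=B$, such that $\widetilde B$ with $\langle a,b\rangle=\sum_{g\in G}g(a^*b)$ is a finitely generated projective Hilbert $B$-module. A triple $(A,\widetilde A,G)$, where $A\subset\widetilde A$ and $G$ acts on $\widetilde A$ by $*$-automorphisms, is a noncommutative finite-fold covering if there are a unital one $(B,\widetilde B,G)$ and compatible, $G$-equivariant inclusions of $A$ and $\widetilde A$ as essential ideals of $B$ and $\widetilde B$ respectively, with $\widetilde A=\{a\in\widetilde B: \langle\widetilde B,a\rangle\subset A\}$. A finite covering sequence $\mathfrak S=\{A=A_0\to A_1\to\cdots\}$ is a sequence of injective $*$-homomorphisms with groups $G(A_m|A_k)$ of $*$-automorphisms of $A_m$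 such that, for $k<m$, $(A_k,A_m,G(A_m|A_k))$ is a noncommutative finite-fold covering and, for $k<l<m$, $G(A_m|A_k)A_l=A_l$ and inclusion and restriction to $A_l$ give an exact sequence $1\to G(A_m|A_l)\to G(A_m|A_k)\to G(A_l|A_k)\to1$; $G(A_n|A_n)$ is trivial. Put $\widehat A=\varinjlim A_n$, $\widehat G=\varprojlim G(A_n|A)$, $G_n=\ker(\widehat G\to G(A_n|A))$. *Representations.* A faithful nondegenerate representation $\pi:\widehat A\to B(\widehat{\mathcal H})$ is equivariant if there is a unitary representation $U$ of $\widehat G$ on $\widehat{\mathcal H}$ with $\pi(ga)=U_g\pi(a)U_g^*$; then $\widehat G$ acts on $B(\widehat{\mathcal H})$ by $gx=U_gxU_g^*$. A positive $\bar a\in B(\widehat{\mathcal H})$ is special if for all $n\ge0$, $z\in A$, $\varepsilon>0$ the series $\sum_{g\in G_n}g\bar a$, $b_n=\sum_{g\in G_n} g(z\bar az^*)$, $c_n=\sum_{g\in G_n} g(z\bar az^*)^2$ and $\sum_{g\in G_n} gf_\varepsilon(z\bar az^*)$, where $f_\varepsilon(t)=\max(t-\varepsilon,0)$, converge strongly to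 elements of $A_n$, and if for all $z\in A$, $\varepsilon>0$ there is $N$ with $\|b_n^2-c_n\|<\varepsilon$ for $n\ge N$. Weakly special elements are the $x\bar ay$ with $x,y\in\widehat A$ and $\bar a$ special. The disconnected inverse noncommutative limit $\overline A_\pi$ is the norm closure of the algebra generated by the weakly special elements. A connected component $\widetilde A_\pi$ is a maximal irreducible $C^*$-subalgebra of $\overline A_\pi$, where irreducible means: not a direct sum of two nonzero $C^*$-algebras. Its invariant group $G_\pi$ is the largest subgroup of $\widehat G$ whose elements map $\widetilde A_\pi$ onto itself. The representation $\pi$ is good if it is equivariant and, for some connected component $\widetilde A_\pi$: (a) multiplication defines an injective $*$-homomorphism $\widehat A\to M(\widetilde A_\pi)$; (b) for every set $J$ of representatives of $\widehat G/G_\pi$ the algebraic direct sum $\bigoplus_{g\in J}g\widetilde A_\pi$ (a direct sum of algebras, so that different summands annihilate each other) is a dense subalgebra of $\overline A_\pi$; (c) $G_\pi\to G(A_n|A)$ is surjective for all $n$. Such an $\widetilde A_\pi$ is called an inverse noncommutative limit of $\mathfrak S$ with respect to $\pi$, with covering group $G_\pi$, and $(A,\widetilde A_\pi,G_\pi)$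 is called an infinite noncommutative covering of $\mathfrak S$ with respect to $\pi$. **Theorem.** Let $\mathfrak S$ be a finite covering sequence and let $\pi:\widehat A\to B(\widehat{\mathcal H})$ be a good representation. Then the stabilized sequence $\mathfrak S_{\mathcal K}=\{A_0\otimes\mathcal K\to A_1\otimes\mathcal K\to\cdots\}$, with the maps tensored by $\mathrm{Id}_{\mathcal K}$ and with the groups $\{g\otimes\mathrm{Id}_{\mathcal K}: g\in G(A_m|A_k)\}$, is a finite covering sequence, $\varinjlim (A_n\otimes\mathcal K)=\widehat A\otimes\mathcal K$, and $g\mapsto g\otimes \mathrm{Id}_{\mathcal K}$ identifies $\widehat G$ with the projective limit of the groups of $\mathfrak S_{\mathcal K}$. There is a representation $\pi\otimes\mathrm{Id}_{\mathcal K}:\widehat A\otimes\mathcal K\to B(\widehat{\mathcal H}\otimes\mathcal H)$, $a\otimes k\mapsto\pi(a)\otimes k$, and it is good (for $\mathfrak S_{\mathcal K}$). Moreover, for every inverse noncommutative limit $\widetilde A_\pi$ of $\mathfrak S$ with respect to $\pi$, with covering group $G_\pi$ (and unitary representation $U$ of $\widehat G$): 1. with respect to $\pi\otimes\mathrm{Id}_{\mathcal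 K}$ and the unitary representation $U\otimes1$, the disconnected inverse noncommutative limit of $\mathfrak S_{\mathcal K}$ is $\overline A_\pi\otimes\mathcal K$; 2. $\widetilde A_\pi\otimes\mathcal K$ is an inverse noncommutative limit of $\mathfrak S_{\mathcal K}$ with respect to $\pi\otimes\mathrm{Id}_{\mathcal K}$, and its covering group is $G_\pi$; that is, $(A\otimes\mathcal K,\widetilde A_\pi\otimes\mathcal K,G_\pi)$ is an infinite noncommutative covering of $\mathfrak S_{\mathcal K}$ with respect to $\pi\otimes\mathrm{Id}_{\mathcal K}$; 3. every inverse noncommutative limit of $\mathfrak S_{\mathcal K}$ with respect to $\pi\otimes\mathrm{Id}_{\mathcal K}$ is isomorphic to $\widetilde A_\pi\otimes\mathcal K$, and its covering group is isomorphic to $G_\pi$. -/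

import Mathlib

open scoped TensorProduct

namespace NCCov

universe u v w

/-! ### Finite-fold noncommutative coverings -/

section Finite

/-- A closed two-sided ideal `I` of a C*-algebra `B` (given as a subset) which is essential:
only `0` annihilates `I`. -/
structure IsEssentialIdeal {B : Type u} [NonUnitalCStarAlgebra B] (I : Set B) : Prop where
  isClosed : IsClosed I
  zero_mem : (0 : B) ∈ I
  add_mem : ∀ x ∈ I, ∀ y ∈ I, x + y ∈ I
  mul_mem_left : ∀ b, ∀ x ∈ I, b * x ∈ I
  mul_mem_right : ∀ b, ∀ x ∈ I, x * b ∈ I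
  essential_left : ∀ b, (∀ x ∈ I, b * x = 0) → b = 0
  essential_right : ∀ b, (∀ x ∈ I, x * b = 0) → b = 0

/-- `⟨a, b⟩ = ∑_{g ∈ G} g (a* b)` for a finite group `G` acting on `B`. -/
noncomputable def galInner {B : Type u} [NonUnitalCStarAlgebra B] {G : Type v} [Group G]
    (α : G →* (B ≃⋆ₐ[ℂ] B)) (a b : B) : B :=
  ∑ᶠ g : G, α g (star a * b)

/-- A unital noncommutative finite-fold covering `(B, B̃, G)`: `j : B → B̃` is an injective
`*`-homomorphism of unital C*-algebras, the finite group `G` acts effectively on `B̃` by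
`*`-automorphisms with fixed point algebra `B`, and `B̃`, with the `B`-valued product
`∑_{g ∈ G} g (a* b)`, is a finitely generated projective Hilbert `B`-module, i.e. it is (isomorphic
to) an orthogonally complemented submodule of the Hilbert module `Bⁿ` for some `n`: there are right
`B`-linear maps `V : B̃ → Bⁿ` and `W : Bⁿ → B̃`, adjoint to each other, with `W ∘ V = id`. -/
structure IsUnitalFiniteCovering {B Bt : Type u} [CStarAlgebra B] [CStarAlgebra Bt]
    (j : B →⋆ₐ[ℂ] Bt) {G : Type v} [Group G] (α : G →* (Bt ≃⋆ₐ[ℂ] Bt)) : Prop where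
  injective : Function.Injective j
  finite : Finite G
  effective : Function.Injective α
  fixed : ∀ b : Bt, (∀ g, α g b = b) ↔ b ∈ Set.range j
  finite_projective : ∃ (n : ℕ) (V : Bt →ₗ[ℂ] (Fin n → B)) (W : (Fin n → B) →ₗ[ℂ] Bt),
    (∀ x b i, V (x * j b) i = V x i * b) ∧
    (∀ y b, W (fun i => y i * b) = W y * j b) ∧
    (∀ x y, j (∑ i, star (V x i) * y i) = galInner α x (W y)) ∧
    (∀ x, W (V x) = x)

/-- A noncommutative finite-fold covering `(A, Ã, G)`, where `j : A → Ã` is the inclusion and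
`G` is given as a group of `*`-automorphisms of `Ã`: there is a unital noncommutative finite-fold
covering `(B, B̃, G)` such that `A ⊆ B` and `Ã ⊆ B̃` are essential ideals (compatibly with
the inclusions and with the actions of `G`) and `Ã = {a ∈ B̃ | ⟨B̃, a⟩ ⊆ A}`. -/
def IsFiniteCovering {A At : Type u} [NonUnitalCStarAlgebra A] [NonUnitalCStarAlgebra At]
    (j : A →⋆ₙₐ[ℂ] At) (G : Subgroup (At ≃⋆ₐ[ℂ] At)) : Prop :=
  ∃ (B Bt : Type u) (_ : CStarAlgebra B) (_ : CStarAlgebra Bt)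
    (i : A →⋆ₙₐ[ℂ] B) (it : At →⋆ₙₐ[ℂ] Bt) (jB : B →⋆ₐ[ℂ] Bt) (α : G →* (Bt ≃⋆ₐ[ℂ] Bt)),
    Function.Injective i ∧ Function.Injective it ∧
    IsEssentialIdeal (Set.range i) ∧ IsEssentialIdeal (Set.range it) ∧
    (∀ a, jB (i a) = it (j a)) ∧
    (∀ g : G, ∀ a, α g (it a) = it ((g : At ≃⋆ₐ[ℂ] At) a)) ∧
    IsUnitalFiniteCovering jB α ∧
    ∀ x : Bt, x ∈ Set.range it ↔ ∀ b : Bt, galInner α b x ∈ Set.range (fun a => jB (i a))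

end Finite

/-! ### Finite covering sequences -/

/-- The data of a sequence `A₀ → A₁ → A₂ → ⋯` of C*-algebras (all compositions
`A_k → A_m`, `k ≤ m`, are recorded), with groups `gal k m` (`= G(A_m | A_k)`) of
`*`-automorphisms of `A_m`. -/
structure CovSeq where
  A : ℕ → Type u
  [cstar : ∀ n, NonUnitalCStarAlgebra (A n)]
  map : ∀ {k m : ℕ}, k ≤ m → (A k →⋆ₙₐ[ℂ] A m)
  map_self : ∀ (k : ℕ) (a : A k), map (le_refl k) a = a
  map_map : ∀ {k l m : ℕ} (h₁ : k ≤ l) (h₂ : l ≤ m) (a : A k),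
    map h₂ (map h₁ a) = map (h₁.trans h₂) a
  gal : ∀ _k m : ℕ, Subgroup (A m ≃⋆ₐ[ℂ] A m)

attribute [instance] CovSeq.cstar

namespace CovSeq

/-- An (algebraical) finite covering sequence. The last four fields express the exactness of
`1 → G(A_m | A_l) → G(A_m | A_k) → G(A_l | A_k) → 1` for `k < l < m`, where the first map is the
inclusion and the second one is the restriction to `A_l ⊆ A_m`. -/
structure IsFiniteCoveringSeq (S : CovSeq.{u}) : Prop where
  gal_self : ∀ n, S.gal n n = ⊥
  covering : ∀ k m (h : k < m), IsFiniteCovering (S.map h.le) (S.gal k m)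
  stable : ∀ k l m (_ : k < l) (h : l < m), ∀ g ∈ S.gal k m,
    g '' Set.range (S.map h.le) = Set.range (S.map h.le)
  le : ∀ k l m, k < l → l < m → S.gal l m ≤ S.gal k m
  restrict : ∀ k l m (_ : k < l) (h : l < m), ∀ g ∈ S.gal k m,
    ∃ g' ∈ S.gal k l, ∀ a, g (S.map h.le a) = S.map h.le (g' a)
  extend : ∀ k l m (_ : k < l) (h : l < m), ∀ g' ∈ S.gal k l,
    ∃ g ∈ S.gal k m, ∀ a, g (S.map h.le a) = S.map h.le (g' a)
  ker : ∀ k l m (_ : k < l) (h : l < m), ∀ g ∈ S.gal k m,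
    (∀ a, g (S.map h.le a) = S.map h.le a) → g ∈ S.gal l m
  fixes : ∀ k l m (_ : k < l) (h : l < m), ∀ g ∈ S.gal l m,
    ∀ a, g (S.map h.le a) = S.map h.le a

/-- The projective limit `Ĝ = lim G(A_n | A)`, realised as the group of compatible sequences. -/
def limGal (S : CovSeq.{u}) : Subgroup (∀ n, S.gal 0 n) where
  carrier := {g | ∀ (k m : ℕ) (h : k ≤ m) (a : S.A k),
    (g m : S.A m ≃⋆ₐ[ℂ] S.A m) (S.map h a) = S.map h ((g k : S.A k ≃⋆ₐ[ℂ] S.A k) a)}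
  one_mem' := fun _ _ _ _ => rfl
  mul_mem' := by
    intro g g' hg hg' k m h a
    simp only [Pi.mul_apply, Subgroup.coe_mul, StarAlgEquiv.mul_apply]
    rw [hg' k m h, hg k m h]
  inv_mem' := by
    intro g hg k m h a
    have := hg k m h ((g k : S.A k ≃⋆ₐ[ℂ] S.A k)⁻¹ a)
    simp only [StarAlgEquiv.aut_inv, StarAlgEquiv.apply_symm_apply] at this
    simp only [Pi.inv_apply, Subgroup.coe_inv, StarAlgEquiv.aut_inv]
    rw [← this, StarAlgEquiv.symm_apply_apply]

/-- The group `Ĝ = lim G(A_n | A)`, as a type. -/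
def LimGal (S : CovSeq.{u}) : Type u := ↥S.limGal

noncomputable instance (S : CovSeq.{u}) : Group S.LimGal := inferInstanceAs (Group ↥S.limGal)

/-- The natural homomorphism `h_n : Ĝ → G(A_n | A)`. -/
noncomputable def proj (S : CovSeq.{u}) (n : ℕ) : S.LimGal →* S.gal 0 n where
  toFun g := g.1 n
  map_one' := rfl
  map_mul' _ _ := rfl

/-- `(L, ι)` is a C*-inductive limit of the sequence of injective `*`-homomorphisms `A_n → A_{n+1}`:
the `ι n : A_n → L` are compatible and injective, and their images have dense union. -/
structure IsInductiveLimit (S : CovSeq.{u}) {L : Type v} [NonUnitalCStarAlgebra L]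
    (ι : ∀ n, S.A n →⋆ₙₐ[ℂ] L) : Prop where
  compat : ∀ {k m : ℕ} (h : k ≤ m) (a : S.A k), ι m (S.map h a) = ι k a
  injective : ∀ n, Function.Injective (ι n)
  dense : Dense (⋃ n, Set.range (ι n))

end CovSeq

/-! ### Equivariant and good representations -/

section Rep

variable {𝓗 : Type w} [NormedAddCommGroup 𝓗] [InnerProductSpace ℂ 𝓗] [CompleteSpace 𝓗]

/-- The norm of a C*-algebra of operators is invariant under the involution (needed for the
involution on its multiplier algebra). -/
instance (C : NonUnitalStarSubalgebra ℂ (𝓗 →L[ℂ] 𝓗)) : NormedStarGroup C where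
  norm_star_le x := (norm_star (x : 𝓗 →L[ℂ] 𝓗)).le

/-- The action `x ↦ U_g x U_g*` on `B(𝓗)` of a group acting on `𝓗` by unitary operators. -/
noncomputable def conjAct {G : Type v} [Group G] (U : G →* unitary (𝓗 →L[ℂ] 𝓗)) (g : G)
    (x : 𝓗 →L[ℂ] 𝓗) : 𝓗 →L[ℂ] 𝓗 :=
  (U g : 𝓗 →L[ℂ] 𝓗) * x * star (U g : 𝓗 →L[ℂ] 𝓗)

/-- A C*-algebra of operators is irreducible if it is not the direct sum of two nonzero
C*-algebras. -/
def IsIrred (C : NonUnitalStarSubalgebra ℂ (𝓗 →L[ℂ] 𝓗)) : Prop :=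
  ∀ I J : NonUnitalStarSubalgebra ℂ (𝓗 →L[ℂ] 𝓗),
    IsClosed (I : Set (𝓗 →L[ℂ] 𝓗)) → IsClosed (J : Set (𝓗 →L[ℂ] 𝓗)) → I ≤ C → J ≤ C →
    (∀ x ∈ I, ∀ y ∈ J, x * y = 0) → (∀ c ∈ C, ∃ x ∈ I, ∃ y ∈ J, c = x + y) → I = ⊥ ∨ J = ⊥

namespace CovSeq

variable (S : CovSeq.{u}) {L : Type v} [NonUnitalCStarAlgebra L] (ι : ∀ n, S.A n →⋆ₙₐ[ℂ] L)
  (π : L →⋆ₙₐ[ℂ] (𝓗 →L[ℂ] 𝓗)) (U : S.LimGal →* unitary (𝓗 →L[ℂ] 𝓗))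

/-- `π` is a faithful nondegenerate representation of `Â = L`, equivariant with respect to the
unitary action `U` of `Ĝ`. The action of `g ∈ Ĝ` on `Â` is the unique continuous one given by
`g (ι_n a) = ι_n (g_n a)`, so it is enough to require `π(g x) = U_g π(x) U_g*` on the dense set
of the elements `x = ι_n a`. -/
structure IsEquivariantRep : Prop where
  injective : Function.Injective π
  nondegenerate : Dense (Submodule.span ℂ {ξ : 𝓗 | ∃ a η, ξ = π a η} : Set 𝓗)
  equivariant : ∀ (g : S.LimGal) (n : ℕ) (a : S.A n),
    π (ι n ((S.proj n g : S.A n ≃⋆ₐ[ℂ] S.A n) a)) = conjAct U g (π (ι n a))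

/-- The series `∑_{g ∈ ker (Ĝ → G(A_n | A))} g x` is strongly convergent with sum `s`. -/
def HasStrongSum (n : ℕ) (x s : 𝓗 →L[ℂ] 𝓗) : Prop :=
  ∀ ξ : 𝓗, HasSum (fun g : (S.proj n).ker => conjAct U (g : S.LimGal) x ξ) (s ξ)

/-- The series `∑_{g ∈ ker (Ĝ → G(A_n | A))} g x` is strongly convergent and its sum lies in
`A_n ⊆ B(𝓗)`. -/
def SumsInto (n : ℕ) (x : 𝓗 →L[ℂ] 𝓗) : Prop :=
  ∃ a : S.A n, S.HasStrongSum U n x (π (ι n a))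

/-- Special elements of `B(𝓗)`; here `f_ε(t) = max (t - ε) 0`. -/
structure IsSpecial (x : 𝓗 →L[ℂ] 𝓗) : Prop where
  positive : x.IsPositive
  sum : ∀ n, S.SumsInto ι π U n x
  sum_conj : ∀ (n : ℕ) (z : S.A 0),
    S.SumsInto ι π U n (π (ι 0 z) * x * star (π (ι 0 z)))
  sum_sq : ∀ (n : ℕ) (z : S.A 0),
    S.SumsInto ι π U n ((π (ι 0 z) * x * star (π (ι 0 z))) ^ 2)
  sum_cut : ∀ (n : ℕ) (z : S.A 0) (ε : ℝ), 0 < ε →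
    S.SumsInto ι π U n (cfc (fun t : ℝ => max (t - ε) 0) (π (ι 0 z) * x * star (π (ι 0 z))))
  norm_lt : ∀ (z : S.A 0) (ε : ℝ), 0 < ε → ∃ N : ℕ, ∀ n ≥ N, ∀ b c : 𝓗 →L[ℂ] 𝓗,
    S.HasStrongSum U n (π (ι 0 z) * x * star (π (ι 0 z))) b →
    S.HasStrongSum U n ((π (ι 0 z) * x * star (π (ι 0 z))) ^ 2) c → ‖b ^ 2 - c‖ < ε

/-- Weakly special elements `x a y`, with `x, y ∈ Â` and `a` special. -/
def weaklySpecial : Set (𝓗 →L[ℂ] 𝓗) :=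
  {t | ∃ (x y : L) (a : 𝓗 →L[ℂ] 𝓗), S.IsSpecial ι π U a ∧ t = π x * a * π y}

/-- The disconnected inverse noncommutative limit `Ā_π`: the norm closure of the algebra generated
by the weakly special elements (a set that is stable under `*`). -/
noncomputable def disconnLim : NonUnitalStarSubalgebra ℂ (𝓗 →L[ℂ] 𝓗) :=
  (NonUnitalStarAlgebra.adjoin ℂ (S.weaklySpecial ι π U)).topologicalClosure

/-- Connected components: the maximal irreducible C*-subalgebras of `Ā_π`. -/
def IsComponent (C : NonUnitalStarSubalgebra ℂ (𝓗 →L[ℂ] 𝓗)) : Prop :=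
  Maximal (fun D : NonUnitalStarSubalgebra ℂ (𝓗 →L[ℂ] 𝓗) =>
    IsClosed (D : Set (𝓗 →L[ℂ] 𝓗)) ∧ D ≤ S.disconnLim ι π U ∧ IsIrred D) C

/-- The `C`-invariant group: the largest subgroup of `Ĝ` all of whose elements map `C` onto `C`. -/
noncomputable def invGroup (C : NonUnitalStarSubalgebra ℂ (𝓗 →L[ℂ] 𝓗)) : Subgroup S.LimGal :=
  sSup {G | ∀ g ∈ G, conjAct U g '' (C : Set (𝓗 →L[ℂ] 𝓗)) = C}

open MultiplierAlgebra in
/-- The equivariant representation `π` is good, with connected component `C = Ã_π` and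
`C`-invariant group `G_π`. In other words, `C` is the inverse noncommutative limit of the sequence
with respect to `π`, and `(A, C, G_π)` is the infinite noncommutative covering. -/
structure IsGoodWith (C : NonUnitalStarSubalgebra ℂ (𝓗 →L[ℂ] 𝓗)) : Prop where
  rep : S.IsEquivariantRep ι π U
  component : S.IsComponent ι π U C
  multiplier : ∃ Φ : L →⋆ₙₐ[ℂ] 𝓜(ℂ, C), Function.Injective Φ ∧
    ∀ (a : L) (c : C), ((Φ a).fst c : 𝓗 →L[ℂ] 𝓗) = π a * c ∧
      ((Φ a).snd c : 𝓗 →L[ℂ] 𝓗) = c * π a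
  /-- For every set `J` of representatives of `Ĝ / G_π`, the sum of the algebras `g C`, `g ∈ J`,
  is direct (as a sum of algebras: the summands annihilate each other) and dense in `Ā_π`. -/
  directSum : ∀ J : Set S.LimGal, Subgroup.IsComplement J (S.invGroup U C : Set S.LimGal) →
    (∀ g ∈ J, ∀ h ∈ J, g ≠ h → ∀ x ∈ C, ∀ y ∈ C, conjAct U g x * conjAct U h y = 0) ∧
    closure (Submodule.span ℂ {t | ∃ g ∈ J, ∃ x ∈ C, t = conjAct U g x} : Set (𝓗 →L[ℂ] 𝓗))
      = S.disconnLim ι π U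
  surjective : ∀ n, (S.invGroup U C).map (S.proj n) = ⊤

/-- `π` is a good representation of `Â = lim A_n`. -/
def IsGood : Prop :=
  ∃ (U : S.LimGal →* unitary (𝓗 →L[ℂ] 𝓗)) (C : NonUnitalStarSubalgebra ℂ (𝓗 →L[ℂ] 𝓗)),
    S.IsGoodWith ι π U C

end CovSeq

end Rep

/-! ### Stabilization -/

section Stab

variable (E : Type v) [NormedAddCommGroup E] [InnerProductSpace ℂ E]
  (H : Type w) [NormedAddCommGroup H] [InnerProductSpace ℂ H]

/-- The Hilbert space tensor product `E ⊗ H`. -/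
def HTensor : Type (max v w) := UniformSpace.Completion (E ⊗[ℂ] H)

noncomputable instance : NormedAddCommGroup (HTensor E H) :=
  inferInstanceAs (NormedAddCommGroup (UniformSpace.Completion (E ⊗[ℂ] H)))

noncomputable instance : InnerProductSpace ℂ (HTensor E H) :=
  inferInstanceAs (InnerProductSpace ℂ (UniformSpace.Completion (E ⊗[ℂ] H)))

instance : CompleteSpace (HTensor E H) :=
  inferInstanceAs (CompleteSpace (UniformSpace.Completion (E ⊗[ℂ] H)))

/-- The canonical isometric embedding of the algebraic tensor product. -/
noncomputable def HTensor.of : (E ⊗[ℂ] H) →ₗᵢ[ℂ] HTensor E H :=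
  UniformSpace.Completion.toComplₗᵢ

variable {E H}

theorem HTensor.denseRange_of : DenseRange (HTensor.of E H) :=
  UniformSpace.Completion.denseRange_coe

/-- The operator `x ⊗ k` on `E ⊗ H`. -/
noncomputable def opTensor (x : E →L[ℂ] E) (k : H →L[ℂ] H) : HTensor E H →L[ℂ] HTensor E H :=
  (TensorProduct.mapL x k).completion

theorem opTensor_of (x : E →L[ℂ] E) (k : H →L[ℂ] H) (z : E ⊗[ℂ] H) :
    opTensor x k (HTensor.of E H z) = HTensor.of E H (TensorProduct.mapL x k z) :=
  ContinuousLinearMap.completion_apply_coe (TensorProduct.mapL x k) z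

theorem opTensor_ext {S T : HTensor E H →L[ℂ] HTensor E H}
    (h : ∀ ξ η, S (HTensor.of E H (ξ ⊗ₜ[ℂ] η)) = T (HTensor.of E H (ξ ⊗ₜ[ℂ] η))) : S = T := by
  refine ContinuousLinearMap.coeFn_injective
    (HTensor.denseRange_of.equalizer S.continuous T.continuous (funext fun z => ?_))
  simp only [Function.comp_apply]
  induction z using TensorProduct.induction_on with
  | zero => simp
  | add z₁ z₂ h₁ h₂ => simp only [map_add, h₁, h₂]
  | tmul ξ η => exact h ξ η

theorem opTensor_one : opTensor (1 : E →L[ℂ] E) (1 : H →L[ℂ] H) = 1 :=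
  opTensor_ext fun ξ η => by rw [opTensor_of, TensorProduct.mapL_tmul]; rfl

theorem opTensor_mul (x y : E →L[ℂ] E) (k l : H →L[ℂ] H) :
    opTensor (x * y) (k * l) = opTensor x k * opTensor y l :=
  opTensor_ext fun ξ η => by
    change _ = opTensor x k (opTensor y l (HTensor.of E H (ξ ⊗ₜ[ℂ] η)))
    rw [opTensor_of, opTensor_of, opTensor_of,
      TensorProduct.mapL_tmul, TensorProduct.mapL_tmul, TensorProduct.mapL_tmul]
    rfl

variable [CompleteSpace E]

theorem opTensor_star [CompleteSpace H] (x : E →L[ℂ] E) (k : H →L[ℂ] H) :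
    star (opTensor x k) = opTensor (star x) (star k) := by
  have key : ∀ a b : E ⊗[ℂ] H,
      inner ℂ (TensorProduct.mapL (star x) (star k) a) b =
        inner ℂ a (TensorProduct.mapL x k b) := by
    intro a b
    induction a using TensorProduct.induction_on with
    | zero => simp
    | add a₁ a₂ h₁ h₂ => simp only [map_add, inner_add_left, h₁, h₂]
    | tmul a₁ a₂ =>
      induction b using TensorProduct.induction_on with
      | zero => simp
      | add b₁ b₂ h₁ h₂ => simp only [map_add, inner_add_right, h₁, h₂]
      | tmul b₁ b₂ =>
        rw [TensorProduct.mapL_tmul, TensorProduct.mapL_tmul, TensorProduct.inner_tmul,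
          TensorProduct.inner_tmul, ContinuousLinearMap.star_eq_adjoint,
          ContinuousLinearMap.star_eq_adjoint, ContinuousLinearMap.adjoint_inner_left,
          ContinuousLinearMap.adjoint_inner_left]
  rw [ContinuousLinearMap.star_eq_adjoint]
  symm
  rw [ContinuousLinearMap.eq_adjoint_iff]
  intro a b
  refine HTensor.denseRange_of.induction_on₂ (p := fun a b : HTensor E H =>
    inner ℂ (opTensor (star x) (star k) a) b = inner ℂ a (opTensor x k b)) ?_ ?_ a b
  · exact isClosed_eq
      (((ContinuousLinearMap.continuous _).comp continuous_fst).inner continuous_snd)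
      (continuous_fst.inner ((ContinuousLinearMap.continuous _).comp continuous_snd))
  · intro a b
    rw [opTensor_of, opTensor_of, LinearIsometry.inner_map_map, LinearIsometry.inner_map_map]
    exact key a b

variable (H) in
/-- The unitary `u ⊗ 1`. -/
noncomputable def ampUnitary [CompleteSpace H] :
    unitary (E →L[ℂ] E) →* unitary (HTensor E H →L[ℂ] HTensor E H) where
  toFun u := ⟨opTensor (u : E →L[ℂ] E) 1, by
    rw [Unitary.mem_iff, opTensor_star, ← opTensor_mul, ← opTensor_mul]
    simp [opTensor_one]⟩
  map_one' := Subtype.ext (by simp [opTensor_one])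
  map_mul' u v := Subtype.ext (by simp [← opTensor_mul])

variable (H) in
/-- `M ⊗ 𝒦(H)` for an algebra `M` of operators on `E`, where `𝒦(H)` is the algebra of
compact operators: the C*-algebra of operators on `E ⊗ H` generated by the operators `x ⊗ k` with
`x ∈ M` and `k` compact, i.e. the norm completion of the algebraic tensor product of `M` and
`𝒦(H)`. -/
noncomputable def stabAlg (M : NonUnitalStarSubalgebra ℂ (E →L[ℂ] E)) :
    NonUnitalStarSubalgebra ℂ (HTensor E H →L[ℂ] HTensor E H) :=
  (NonUnitalStarAlgebra.adjoin ℂ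
    {t | ∃ x ∈ M, ∃ k : H →L[ℂ] H, IsCompactOperator k ∧ t = opTensor x k}).topologicalClosure

instance stabAlg_isClosed (M : NonUnitalStarSubalgebra ℂ (E →L[ℂ] E)) :
    IsClosed (stabAlg H M : Set (HTensor E H →L[ℂ] HTensor E H)) :=
  NonUnitalStarSubalgebra.isClosed_topologicalClosure _

theorem stabAlg_mono {M N : NonUnitalStarSubalgebra ℂ (E →L[ℂ] E)} (h : M ≤ N) :
    stabAlg H M ≤ stabAlg H N := by
  refine NonUnitalStarSubalgebra.topologicalClosure_mono (NonUnitalStarAlgebra.adjoin_mono ?_)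
  rintro _ ⟨x, hx, k, hk, rfl⟩
  exact ⟨x, h hx, k, hk, rfl⟩

section

variable {A : Type u} [NonUnitalCStarAlgebra A] {A' : Type*} [NonUnitalCStarAlgebra A']

variable (H) in
/-- `A ⊗ 𝒦(H)` for a C*-algebra `A`, as the spatial tensor product computed in a (faithful)
representation `ρ` of `A`. -/
def Stab (ρ : A →⋆ₙₐ[ℂ] (E →L[ℂ] E)) : Type (max v w) :=
  ↥(stabAlg H (NonUnitalStarAlgHom.range ρ))

noncomputable instance (ρ : A →⋆ₙₐ[ℂ] (E →L[ℂ] E)) : NonUnitalCStarAlgebra (Stab H ρ) :=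
  inferInstanceAs (NonUnitalCStarAlgebra ↥(stabAlg H (NonUnitalStarAlgHom.range ρ)))

/-- The inclusion of `A ⊗ 𝒦(H)` into the algebra of operators on `E ⊗ H`. -/
noncomputable def Stab.toOp (ρ : A →⋆ₙₐ[ℂ] (E →L[ℂ] E)) :
    Stab H ρ →⋆ₙₐ[ℂ] (HTensor E H →L[ℂ] HTensor E H) where
  toFun x := x.1
  map_smul' _ _ := rfl
  map_zero' := rfl
  map_add' _ _ := rfl
  map_mul' _ _ := rfl
  map_star' _ := rfl

/-- The elementary tensor `a ⊗ k` of `A ⊗ 𝒦(H)`. -/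
noncomputable def Stab.tmul (ρ : A →⋆ₙₐ[ℂ] (E →L[ℂ] E))
    (a : A) (k : {k : H →L[ℂ] H // IsCompactOperator k}) : Stab H ρ :=
  ⟨opTensor (ρ a) k, NonUnitalStarSubalgebra.le_topologicalClosure _
    (NonUnitalStarAlgebra.subset_adjoin ℂ _ ⟨ρ a, ⟨a, rfl⟩, k, k.2, rfl⟩)⟩

theorem Stab.toOp_tmul (ρ : A →⋆ₙₐ[ℂ] (E →L[ℂ] E))
    (a : A) (k : {k : H →L[ℂ] H // IsCompactOperator k}) :
    Stab.toOp ρ (Stab.tmul ρ a k) = opTensor (ρ a) k := rfl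

theorem Stab.toOp_injective (ρ : A →⋆ₙₐ[ℂ] (E →L[ℂ] E)) :
    Function.Injective (Stab.toOp (H := H) ρ) :=
  Subtype.val_injective

theorem stabAlg_range_le (ρ : A →⋆ₙₐ[ℂ] (E →L[ℂ] E)) (ρ' : A' →⋆ₙₐ[ℂ] (E →L[ℂ] E))
    (f : A → A') (h : ∀ a, ρ' (f a) = ρ a)
    {x : HTensor E H →L[ℂ] HTensor E H} (hx : x ∈ stabAlg H (NonUnitalStarAlgHom.range ρ)) :
    x ∈ stabAlg H (NonUnitalStarAlgHom.range ρ') := by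
  have hle : NonUnitalStarAlgHom.range ρ ≤ NonUnitalStarAlgHom.range ρ' := by
    rintro _ ⟨a, rfl⟩
    exact ⟨f a, h a⟩
  exact SetLike.le_def.mp (stabAlg_mono hle) hx

variable (H) in
/-- The underlying function of the inclusion `A ⊗ 𝒦(H) → A' ⊗ 𝒦(H)`. -/
def Stab.inclFun (ρ : A →⋆ₙₐ[ℂ] (E →L[ℂ] E)) (ρ' : A' →⋆ₙₐ[ℂ] (E →L[ℂ] E))
    (f : A → A') (h : ∀ a, ρ' (f a) = ρ a)
    (x : Stab H ρ) : Stab H ρ' :=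
  ⟨x.1, stabAlg_range_le ρ ρ' f h x.2⟩

theorem Stab.toOp_inclFun (ρ : A →⋆ₙₐ[ℂ] (E →L[ℂ] E)) (ρ' : A' →⋆ₙₐ[ℂ] (E →L[ℂ] E))
    (f : A → A') (h : ∀ a, ρ' (f a) = ρ a)
    (x : Stab H ρ) : Stab.toOp ρ' (Stab.inclFun H ρ ρ' f h x) = Stab.toOp ρ x := by
  change (Stab.inclFun H ρ ρ' f h x).1 = x.1
  unfold Stab.inclFun
  rfl

variable (H) in
/-- The inclusion `A ⊗ 𝒦(H) → A' ⊗ 𝒦(H)`, `a ⊗ k ↦ f a ⊗ k`, for an inclusion `f : A → A'`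
under which the representation `ρ` of `A` is the restriction of the representation `ρ'`
of `A'`. -/
noncomputable def Stab.incl (ρ : A →⋆ₙₐ[ℂ] (E →L[ℂ] E)) (ρ' : A' →⋆ₙₐ[ℂ] (E →L[ℂ] E))
    (f : A → A') (h : ∀ a, ρ' (f a) = ρ a) :
    Stab H ρ →⋆ₙₐ[ℂ] Stab H ρ' where
  toFun := Stab.inclFun H ρ ρ' f h
  map_smul' c x := Stab.toOp_injective ρ' (by
    rw [Stab.toOp_inclFun, map_smul (Stab.toOp ρ), MonoidHom.id_apply, map_smul (Stab.toOp ρ'),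
      Stab.toOp_inclFun])
  map_zero' := Stab.toOp_injective ρ' (by
    rw [Stab.toOp_inclFun, map_zero (Stab.toOp ρ), map_zero (Stab.toOp ρ')])
  map_add' x y := Stab.toOp_injective ρ' (by
    rw [Stab.toOp_inclFun, map_add (Stab.toOp ρ), map_add (Stab.toOp ρ'), Stab.toOp_inclFun,
      Stab.toOp_inclFun])
  map_mul' x y := Stab.toOp_injective ρ' (by
    rw [Stab.toOp_inclFun, map_mul (Stab.toOp ρ), map_mul (Stab.toOp ρ'), Stab.toOp_inclFun,
      Stab.toOp_inclFun])
  map_star' x := Stab.toOp_injective ρ' (by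
    rw [Stab.toOp_inclFun, map_star (Stab.toOp ρ), map_star (Stab.toOp ρ'), Stab.toOp_inclFun])

theorem Stab.toOp_incl (ρ : A →⋆ₙₐ[ℂ] (E →L[ℂ] E)) (ρ' : A' →⋆ₙₐ[ℂ] (E →L[ℂ] E))
    (f : A → A') (h : ∀ a, ρ' (f a) = ρ a) (x : Stab H ρ) :
    Stab.toOp ρ' (Stab.incl H ρ ρ' f h x) = Stab.toOp ρ x :=
  Stab.toOp_inclFun ρ ρ' f h x

theorem Stab.incl_tmul (ρ : A →⋆ₙₐ[ℂ] (E →L[ℂ] E)) (ρ' : A' →⋆ₙₐ[ℂ] (E →L[ℂ] E))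
    (f : A → A') (h : ∀ a, ρ' (f a) = ρ a) (a : A)
    (k : {k : H →L[ℂ] H // IsCompactOperator k}) :
    Stab.incl H ρ ρ' f h (Stab.tmul ρ a k) = Stab.tmul ρ' (f a) k :=
  Stab.toOp_injective ρ' (by
    rw [Stab.toOp_incl, Stab.toOp_tmul, Stab.toOp_tmul, h a])

variable (H) in
/-- The group `{g ⊗ id | g ∈ G}` of `*`-automorphisms of `A ⊗ 𝒦(H)`, for a group `G` of
`*`-automorphisms of `A`. -/
noncomputable def Stab.gal (ρ : A →⋆ₙₐ[ℂ] (E →L[ℂ] E)) (G : Subgroup (A ≃⋆ₐ[ℂ] A)) :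
    Subgroup (Stab H ρ ≃⋆ₐ[ℂ] Stab H ρ) where
  carrier := {γ | ∃ g ∈ G, ∀ a k, γ (Stab.tmul ρ a k) = Stab.tmul ρ (g a) k}
  one_mem' := ⟨1, one_mem _, fun _ _ => rfl⟩
  mul_mem' := by
    rintro γ γ' ⟨g, hg, h⟩ ⟨g', hg', h'⟩
    refine ⟨g * g', mul_mem hg hg', fun a k => ?_⟩
    rw [StarAlgEquiv.mul_apply, h', h, StarAlgEquiv.mul_apply]
  inv_mem' := by
    rintro γ ⟨g, hg, h⟩
    refine ⟨g⁻¹, inv_mem hg, fun a k => ?_⟩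
    have := h (g⁻¹ a) k
    rw [StarAlgEquiv.aut_inv, StarAlgEquiv.apply_symm_apply] at this
    rw [← this, StarAlgEquiv.aut_inv, StarAlgEquiv.aut_inv, StarAlgEquiv.symm_apply_apply]

end

namespace CovSeq

variable (S : CovSeq.{u}) {L : Type*} [NonUnitalCStarAlgebra L] (ι : ∀ n, S.A n →⋆ₙₐ[ℂ] L)
  (hι : S.IsInductiveLimit ι) (σ : L →⋆ₙₐ[ℂ] (E →L[ℂ] E))

theorem comp_compat (S : CovSeq.{u}) {L : Type*} [NonUnitalCStarAlgebra L]
    {ι : ∀ n, S.A n →⋆ₙₐ[ℂ] L} (hι : S.IsInductiveLimit ι) (σ : L →⋆ₙₐ[ℂ] (E →L[ℂ] E))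
    {k m : ℕ} (h : k ≤ m) (a : S.A k) : (σ.comp (ι m)) (S.map h a) = (σ.comp (ι k)) a := by
  rw [NonUnitalStarAlgHom.comp_apply, NonUnitalStarAlgHom.comp_apply, hι.compat h a]

variable (H) in
/-- The stabilized sequence `A₀ ⊗ 𝒦 → A₁ ⊗ 𝒦 → ⋯` with connecting maps `π_n ⊗ id` and
groups `{g ⊗ id | g ∈ G(A_m | A_k)}`. The tensor products are computed in the restrictions
to the `A_n` of a faithful representation `σ` of the inductive limit `Â`. -/
noncomputable def stab : CovSeq.{max v w} where
  A n := Stab H (σ.comp (ι n))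
  map {k m} h := Stab.incl H (σ.comp (ι k)) (σ.comp (ι m)) (S.map h)
    (S.comp_compat hι σ h)
  map_self _ _ := Stab.toOp_injective _ (Stab.toOp_incl _ _ _ _ _)
  map_map _ _ _ := Stab.toOp_injective _ ((Stab.toOp_incl _ _ _ _ _).trans
    ((Stab.toOp_incl _ _ _ _ _).trans (Stab.toOp_incl _ _ _ _ _).symm))
  gal k m := Stab.gal H (σ.comp (ι m)) (S.gal k m)

/-- The elementary tensor `a ⊗ k` of the `n`-th algebra `A_n ⊗ 𝒦` of the stabilized sequence. -/
noncomputable def stabTmul (n : ℕ) (a : S.A n) (k : {k : H →L[ℂ] H // IsCompactOperator k}) :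
    (S.stab H ι hι σ).A n :=
  Stab.tmul (σ.comp (ι n)) a k

variable (H) in
/-- The canonical maps `A_n ⊗ 𝒦 → Â ⊗ 𝒦`. -/
noncomputable def stabι (n : ℕ) : (S.stab H ι hι σ).A n →⋆ₙₐ[ℂ] Stab H σ :=
  Stab.incl H (σ.comp (ι n)) σ (ι n) fun _ =>
    (NonUnitalStarAlgHom.comp_apply _ _ _).symm

end CovSeq

end Stab

end NCCov

/-!
Throughout, `M ⊗ 𝒦` is handled through two facts. It is the closed linear span of the elementary
tensors `x ⊗ |ξ⟩⟨η|` (`stabAlg_induction`), and an operator `T` on `F ⊗ H` is determined by its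
slices `(1 ⊗ ⟨ξ|) T (1 ⊗ |η⟩)`, which lie in `M` if `M` is closed and `T ∈ M ⊗ 𝒦` (`ext_slice`,
`slice_mem_of_mem_stabAlg`). Comparing slices shows that a representation `φ` of `A` induces a
representation `φ ⊗ id` of `A ⊗ 𝒦`, whatever faithful representation of `A` is used to form
`A ⊗ 𝒦` (`Stab.lift`).

*Finite coverings.* A triple `(A, Ã, G)` is a finite-fold covering exactly if `G` is finite with
fixed point algebra `A` and there are multipliers `wᵢ` of `Ã` with `a = ∑ᵢ wᵢ ∑_g g(wᵢ* a)` for all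
`a ∈ Ã` (`IsFiniteCovering.hasMultiplierFrame`, `HasMultiplierFrame.isFiniteCovering`): a
finitely generated projective module has such a frame, and conversely the multiplier algebra of `Ã`
and its fixed point algebra form the unital covering that is asked for. The multipliers `wᵢ ⊗ 1`
are a frame for `A ⊗ 𝒦 → Ã ⊗ 𝒦` (`HasMultiplierFrame.stab`).

*Special elements.* Diagonal slices of special elements are special (`IsSpecialFor.slice`), since
conjugation by `z ⊗ |e⟩⟨e|` cuts `z X z*` down to a corner. Conversely `a ⊗ |e⟩⟨e|` is special if
`a` is (`IsSpecialFor.opTensor`). Here `z (a ⊗ |e⟩⟨e|) z* = v a v*` with `v = z (1 ⊗ |e⟩)`, and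
`w = (v* v)^{1/2}` lies in `A`. For the functions `f` in question, `f(v a v*) = v t v*` and
`f(w a w) = w t w` with one operator `0 ≤ t ≤ C a` (`exists_strongSum_cfc`), so the series for
`a ⊗ |e⟩⟨e|` reduce to those for `a` with `w` in the place of `z`. By polarization, the disconnected
limit of the stabilized sequence is the stabilization of the disconnected limit
(`genAlg_stabAlg`, `CovSeq.disconnLim_stab`).

*Components.* A C*-algebra of operators whose translates are pairwise equal or orthogonal and span a
dense subspace of the disconnected limit (`IsSumOfTranslates`) is a maximal irreducible subalgebra
as soon as it is irreducible, because each translate is a direct summand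
(`IsSumOfTranslates.maximal`). Both properties pass to the stabilization; for irreducibility, a
direct summand of `C ⊗ 𝒦` is an ideal, and it comes from the direct summand of `C` in its corner
(`IsIrred.stabAlg`, `IsSumOfTranslates.stabAlg`).

*Uniqueness.* A special element is the strong limit of its sums over the kernels `G_n`, which lie in
`Â`; so the action of `Ĝ` on the disconnected limit depends on the representation of `Â` only, not
on the unitary representation of `Ĝ` (`CovSeq.conjAct_congr`). Two irreducible algebras whose
translates decompose the disconnected limit are translates of each other
(`IsSumOfTranslates.exists_eq_translate`), hence isomorphic, with conjugate invariant groups.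
-/

namespace NCCov

open scoped TensorProduct InnerProduct CStarAlgebra MultiplierAlgebra
open InnerProductSpace (rankOne)
open Filter Topology

attribute [local irreducible] HTensor
set_option linter.unusedSectionVars false

/-! ### Elementary tensors and slices -/

section TensorBasics

variable {E : Type*} [NormedAddCommGroup E] [InnerProductSpace ℂ E]
  {H : Type*} [NormedAddCommGroup H] [InnerProductSpace ℂ H]

variable (E) in
/-- The creation operator `E → E ⊗ H`, `ξ ↦ ξ ⊗ η`. -/
noncomputable def tensorRight (η : H) : E →L[ℂ] HTensor E H :=
  (HTensor.of E H).toContinuousLinearMap ∘L (TensorProduct.mkL ℂ E H).flip η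

theorem tensorRight_apply (η : H) (ξ : E) : tensorRight E η ξ = HTensor.of E H (ξ ⊗ₜ[ℂ] η) := rfl

theorem tensorRight_add (η η' : H) :
    tensorRight E (η + η') = tensorRight E η + tensorRight E η' := by
  simp [tensorRight]

theorem tensorRight_smul (c : ℂ) (η : H) : tensorRight E (c • η) = c • tensorRight E η := by
  simp [tensorRight]

theorem opTensor_comp_tensorRight (x : E →L[ℂ] E) (k : H →L[ℂ] H) (η : H) :
    opTensor x k ∘L tensorRight E η = tensorRight E (k η) ∘L x := by
  ext ξ
  simp only [ContinuousLinearMap.comp_apply, tensorRight_apply]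
  rw [opTensor_of, TensorProduct.mapL_tmul]

theorem HTensor.ext_tensorRight {G : Type*} [NormedAddCommGroup G] [NormedSpace ℂ G]
    {S T : HTensor E H →L[ℂ] G} (h : ∀ η, S ∘L tensorRight E η = T ∘L tensorRight E η) : S = T := by
  refine ContinuousLinearMap.coeFn_injective
    (HTensor.denseRange_of.equalizer S.continuous T.continuous (funext fun z => ?_))
  simp only [Function.comp_apply]
  induction z using TensorProduct.induction_on with
  | zero => simp
  | add z₁ z₂ h₁ h₂ => simp only [map_add, h₁, h₂]
  | tmul ξ η => exact DFunLike.congr_fun (h η) ξ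

theorem opTensor_add_left (x y : E →L[ℂ] E) (k : H →L[ℂ] H) :
    opTensor (x + y) k = opTensor x k + opTensor y k :=
  HTensor.ext_tensorRight fun η => by
    simp only [ContinuousLinearMap.add_comp, opTensor_comp_tensorRight,
      ContinuousLinearMap.comp_add]

theorem opTensor_add_right (x : E →L[ℂ] E) (k l : H →L[ℂ] H) :
    opTensor x (k + l) = opTensor x k + opTensor x l :=
  HTensor.ext_tensorRight fun η => by
    simp only [ContinuousLinearMap.add_comp, opTensor_comp_tensorRight,
      add_apply, tensorRight_add]

theorem opTensor_smul_left (c : ℂ) (x : E →L[ℂ] E) (k : H →L[ℂ] H) :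
    opTensor (c • x) k = c • opTensor x k :=
  HTensor.ext_tensorRight fun η => by
    simp only [ContinuousLinearMap.smul_comp, opTensor_comp_tensorRight,
      ContinuousLinearMap.comp_smul]

theorem opTensor_smul_right (c : ℂ) (x : E →L[ℂ] E) (k : H →L[ℂ] H) :
    opTensor x (c • k) = c • opTensor x k :=
  HTensor.ext_tensorRight fun η => by
    simp only [ContinuousLinearMap.smul_comp, opTensor_comp_tensorRight,
      smul_apply, tensorRight_smul]

theorem opTensor_norm_le (x : E →L[ℂ] E) (k : H →L[ℂ] H) : ‖opTensor x k‖ ≤ ‖x‖ * ‖k‖ := by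
  refine ContinuousLinearMap.opNorm_le_bound _ (by positivity) fun ζ => ?_
  refine HTensor.denseRange_of.induction_on (p := fun ζ : HTensor E H =>
    ‖opTensor x k ζ‖ ≤ ‖x‖ * ‖k‖ * ‖ζ‖) ζ ?_ fun z => ?_
  · exact isClosed_le (opTensor x k).continuous.norm (continuous_const.mul continuous_norm)
  · rw [opTensor_of, LinearIsometry.norm_map, LinearIsometry.norm_map]
    exact (ContinuousLinearMap.le_opNorm _ _).trans
      (mul_le_mul_of_nonneg_right (TensorProduct.norm_mapL_le x k) (norm_nonneg _))

theorem continuous_opTensor_left (k : H →L[ℂ] H) :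
    Continuous fun x : E →L[ℂ] E => opTensor x k :=
  AddMonoidHomClass.continuous_of_bound
    (AddMonoidHom.mk' (fun x : E →L[ℂ] E => opTensor x k) fun x y => opTensor_add_left x y k) ‖k‖
    fun x => (opTensor_norm_le x k).trans_eq (mul_comm _ _)

theorem continuous_opTensor_right (x : E →L[ℂ] E) :
    Continuous fun k : H →L[ℂ] H => opTensor x k :=
  AddMonoidHomClass.continuous_of_bound
    (AddMonoidHom.mk' (fun k : H →L[ℂ] H => opTensor x k) fun k l => opTensor_add_right x k l) ‖x‖
    fun k => opTensor_norm_le x k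

theorem opTensor_zero_right (x : E →L[ℂ] E) : opTensor x (0 : H →L[ℂ] H) = 0 := by
  simpa using opTensor_smul_right 0 x (0 : H →L[ℂ] H)

theorem opTensor_zero_left (k : H →L[ℂ] H) : opTensor (0 : E →L[ℂ] E) k = 0 := by
  simpa using opTensor_smul_left 0 (0 : E →L[ℂ] E) k

variable [CompleteSpace E] [CompleteSpace H]

theorem adjoint_tensorRight_comp_tensorRight (ξ η : H) :
    (tensorRight E ξ)† ∘L tensorRight E η = inner ℂ ξ η • ContinuousLinearMap.id ℂ E := by
  ext u
  refine ext_inner_left ℂ fun v => ?_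
  simp only [ContinuousLinearMap.comp_apply, ContinuousLinearMap.adjoint_inner_right,
    tensorRight_apply, LinearIsometry.inner_map_map, TensorProduct.inner_tmul,
    smul_apply, ContinuousLinearMap.id_apply, inner_smul_right]
  ring

theorem opTensor_adjoint (x : E →L[ℂ] E) (k : H →L[ℂ] H) :
    (opTensor x k)† = opTensor (x†) (k†) := opTensor_star x k

theorem adjoint_tensorRight_comp_opTensor (x : E →L[ℂ] E) (k : H →L[ℂ] H) (η : H) :
    (tensorRight E η)† ∘L opTensor x k = x ∘L (tensorRight E ((k†) η))† := by
  apply ContinuousLinearMap.adjoint.injective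
  rw [ContinuousLinearMap.adjoint_comp, ContinuousLinearMap.adjoint_comp, opTensor_adjoint,
    ContinuousLinearMap.adjoint_adjoint, ContinuousLinearMap.adjoint_adjoint,
    opTensor_comp_tensorRight]

theorem opTensor_rankOne (x : E →L[ℂ] E) (ξ η : H) :
    opTensor x (rankOne ℂ ξ η) = tensorRight E ξ ∘L x ∘L (tensorRight E η)† :=
  HTensor.ext_tensorRight fun ζ => by
    rw [opTensor_comp_tensorRight, InnerProductSpace.rankOne_apply, tensorRight_smul,
      ContinuousLinearMap.comp_assoc, ContinuousLinearMap.comp_assoc,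
      adjoint_tensorRight_comp_tensorRight]
    simp

theorem star_opTensor_rankOne (x : E →L[ℂ] E) (ξ η : H) :
    star (opTensor x (rankOne ℂ ξ η)) = opTensor (star x) (rankOne ℂ η ξ) := by
  rw [opTensor_star, ContinuousLinearMap.star_eq_adjoint (rankOne ℂ ξ η),
    InnerProductSpace.adjoint_rankOne]

/-- The slice map `T ↦ (1 ⊗ ⟨ξ|) T (1 ⊗ |η⟩)` from operators on `E ⊗ H` to operators on `E`. -/
noncomputable def slice (ξ η : H) :
    (HTensor E H →L[ℂ] HTensor E H) →L[ℂ] (E →L[ℂ] E) :=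
  (ContinuousLinearMap.compL ℂ E (HTensor E H) E ((tensorRight E ξ)†)) ∘L
    ((ContinuousLinearMap.compL ℂ E (HTensor E H) (HTensor E H)).flip (tensorRight E η))

theorem slice_apply (ξ η : H) (T : HTensor E H →L[ℂ] HTensor E H) :
    slice ξ η T = (tensorRight E ξ)† ∘L T ∘L tensorRight E η := rfl

theorem slice_opTensor (ξ η : H) (x : E →L[ℂ] E) (k : H →L[ℂ] H) :
    slice ξ η (opTensor x k) = inner ℂ ξ (k η) • x := by
  rw [slice_apply, opTensor_comp_tensorRight, ← ContinuousLinearMap.comp_assoc,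
    adjoint_tensorRight_comp_tensorRight]
  ext; simp

theorem slice_mul_opTensor (ξ η : H) (x : E →L[ℂ] E) (k : H →L[ℂ] H)
    (T : HTensor E H →L[ℂ] HTensor E H) :
    slice ξ η (T * opTensor x k) = slice ξ (k η) T * x := by
  rw [slice_apply, ContinuousLinearMap.mul_def, ContinuousLinearMap.comp_assoc,
    opTensor_comp_tensorRight]
  rfl

theorem ext_slice {S T : HTensor E H →L[ℂ] HTensor E H}
    (h : ∀ ξ η, slice ξ η S = slice ξ η T) : S = T := by
  refine HTensor.ext_tensorRight fun η => ?_
  apply ContinuousLinearMap.adjoint.injective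
  refine HTensor.ext_tensorRight fun ξ => ?_
  apply ContinuousLinearMap.adjoint.injective
  simpa only [ContinuousLinearMap.adjoint_comp, ContinuousLinearMap.adjoint_adjoint, slice_apply]
    using h ξ η

/-- Cutting an operator down by rank one operators: the result is an elementary tensor. -/
theorem rankOne_mul_mul_rankOne (x y : E →L[ℂ] E) (ξ η ξ' η' : H)
    (T : HTensor E H →L[ℂ] HTensor E H) :
    opTensor x (rankOne ℂ ξ η) * T * opTensor y (rankOne ℂ ξ' η') =
      opTensor (x * slice η ξ' T * y) (rankOne ℂ ξ η') := by
  rw [opTensor_rankOne, opTensor_rankOne, opTensor_rankOne]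
  ext ζ
  rfl

theorem isCompactOperator_rankOne (ξ η : H) : IsCompactOperator (rankOne ℂ ξ η) := by
  rw [InnerProductSpace.rankOne_def']
  have h : IsCompactOperator (innerSL ℂ η) :=
    isCompactOperator_of_locallyCompactSpace_dom (innerSL ℂ η)
  exact h.clm_comp (ContinuousLinearMap.toSpanSingleton ℂ ξ)

/-- A compact operator on a Hilbert space is a norm limit of operators of finite rank. -/
theorem mem_closure_span_rankOne {k : H →L[ℂ] H} (hk : IsCompactOperator k) :
    k ∈ closure
      (Submodule.span ℂ {l : H →L[ℂ] H | ∃ ξ η, l = rankOne ℂ ξ η} : Set (H →L[ℂ] H)) := by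
  rw [Metric.mem_closure_iff]
  intro ε hε
  have htb : TotallyBounded (k '' Metric.closedBall 0 1) :=
    (hk.isCompact_closure_image_closedBall 1).totallyBounded.subset subset_closure
  obtain ⟨t, htf, ht⟩ := Metric.totallyBounded_iff.1 htb (ε / 2) (by positivity)
  let V : Submodule ℂ H := Submodule.span ℂ t
  have : FiniteDimensional ℂ V := FiniteDimensional.span_of_finite ℂ htf
  refine ⟨V.starProjection ∘L k, ?_, ?_⟩
  · rw [(stdOrthonormalBasis ℂ V).starProjection_eq_sum_rankOne, ContinuousLinearMap.finsetSum_comp]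
    exact Submodule.sum_mem _ fun i _ =>
      Submodule.subset_span ⟨_, _, InnerProductSpace.rankOne_comp _ _ _⟩
  · rw [dist_eq_norm]
    refine lt_of_le_of_lt (ContinuousLinearMap.opNorm_le_of_unit_norm
      (by positivity : 0 ≤ ε / 2) fun x hx => ?_) (half_lt_self hε)
    obtain ⟨y, hy, hxy⟩ := Set.mem_iUnion₂.1 (ht ⟨x, by simp [hx], rfl⟩)
    rw [sub_apply, ContinuousLinearMap.comp_apply,
      Submodule.starProjection_minimal]
    refine (ciInf_le ⟨0, by rintro _ ⟨a, rfl⟩; positivity⟩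
      (⟨y, Submodule.subset_span hy⟩ : V)).trans ?_
    rw [← dist_eq_norm]
    exact (Metric.mem_ball.1 hxy).le

theorem opTensor_mem_stabAlg {M : NonUnitalStarSubalgebra ℂ (E →L[ℂ] E)} {x : E →L[ℂ] E}
    (hx : x ∈ M) {k : H →L[ℂ] H} (hk : IsCompactOperator k) : opTensor x k ∈ stabAlg H M :=
  NonUnitalStarSubalgebra.le_topologicalClosure _
    (NonUnitalStarAlgebra.subset_adjoin ℂ _ ⟨x, hx, k, hk, rfl⟩)

theorem opTensor_rankOne_mem_stabAlg {M : NonUnitalStarSubalgebra ℂ (E →L[ℂ] E)} {x : E →L[ℂ] E}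
    (hx : x ∈ M) (ξ η : H) : opTensor x (rankOne ℂ ξ η) ∈ stabAlg H M :=
  opTensor_mem_stabAlg hx (isCompactOperator_rankOne ξ η)

/-- A set that is stable under products and the involution up to linear combinations spans a
`*`-algebra. -/
theorem exists_subalgebra_eq_span {B : Type*} [NonUnitalRing B] [StarRing B] [Module ℂ B]
    [StarModule ℂ B] [IsScalarTower ℂ B B] [SMulCommClass ℂ B B] (s : Set B)
    (hmul : ∀ x ∈ s, ∀ y ∈ s, x * y ∈ Submodule.span ℂ s)
    (hstar : ∀ x ∈ s, star x ∈ Submodule.span ℂ s) :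
    ∃ W : NonUnitalStarSubalgebra ℂ B, (W : Set B) = Submodule.span ℂ s := by
  refine ⟨{ Submodule.span ℂ s with mul_mem' := ?_, star_mem' := ?_ }, rfl⟩
  · intro x y hx hy
    refine Submodule.span_induction₂ (p := fun x y _ _ => x * y ∈ Submodule.span ℂ s)
      (fun x y hx hy => hmul x hx y hy) ?_ ?_ ?_ ?_ ?_ ?_ hx hy
    · intro _ _; simp
    · intro _ _; simp
    · intro _ _ _ _ _ _ h h'; rw [add_mul]; exact Submodule.add_mem _ h h'
    · intro _ _ _ _ _ _ h h'; rw [mul_add]; exact Submodule.add_mem _ h h'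
    · intro _ _ _ _ _ h; rw [smul_mul_assoc]; exact Submodule.smul_mem _ _ h
    · intro _ _ _ _ _ h; rw [mul_smul_comm]; exact Submodule.smul_mem _ _ h
  · intro x hx
    refine Submodule.span_induction (p := fun x _ => star x ∈ Submodule.span ℂ s) hstar ?_ ?_ ?_ hx
    · simp
    · intro _ _ _ _ h h'; rw [star_add]; exact Submodule.add_mem _ h h'
    · intro _ _ _ h; rw [star_smul]; exact Submodule.smul_mem _ _ h

/-- `M ⊗ 𝒦` is the closed linear span of the elementary tensors `x ⊗ |ξ⟩⟨η|`. -/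
theorem stabAlg_induction {M : NonUnitalStarSubalgebra ℂ (E →L[ℂ] E)}
    {p : (HTensor E H →L[ℂ] HTensor E H) → Prop} (hc : IsClosed {T | p T}) (h0 : p 0)
    (hadd : ∀ S T, p S → p T → p (S + T))
    (htmul : ∀ x ∈ M, ∀ ξ η, p (opTensor x (rankOne ℂ ξ η)))
    {T : HTensor E H →L[ℂ] HTensor E H} (hT : T ∈ stabAlg H M) : p T := by
  -- sums of elementary tensors form a `*`-algebra
  let V : Submodule ℂ (HTensor E H →L[ℂ] HTensor E H) :=
    Submodule.span ℂ {t | ∃ x ∈ M, ∃ ξ η : H, t = opTensor x (rankOne ℂ ξ η)}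
  have hVp : ∀ t ∈ V, p t := by
    intro t ht
    suffices h : ∀ c : ℂ, p (c • t) by simpa using h 1
    refine Submodule.span_induction (p := fun t _ => ∀ c : ℂ, p (c • t))
      ?_ (by simpa using h0) ?_ ?_
      ht
    · rintro _ ⟨x, hx, ξ, η, rfl⟩ c
      rw [← opTensor_smul_left]
      exact htmul _ (SMulMemClass.smul_mem c hx) _ _
    · intro s t _ _ hs ht c
      rw [smul_add]
      exact hadd _ _ (hs c) (ht c)
    · intro d t _ ht c
      rw [smul_smul]
      exact ht _
  obtain ⟨W, hWV⟩ := exists_subalgebra_eq_span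
    {t | ∃ x ∈ M, ∃ ξ η : H, t = opTensor x (rankOne ℂ ξ η)} (by
      rintro _ ⟨x, hx, ξ, η, rfl⟩ _ ⟨y, hy, ξ', η', rfl⟩
      refine Submodule.subset_span
        ⟨_, SMulMemClass.smul_mem (inner ℂ η ξ') (M.mul_mem hx hy), ξ, η', ?_⟩
      rw [← opTensor_mul, ContinuousLinearMap.mul_def (rankOne ℂ ξ η),
        InnerProductSpace.rankOne_comp_rankOne, opTensor_smul_left, opTensor_smul_right]) (by
      rintro _ ⟨x, hx, ξ, η, rfl⟩
      rw [star_opTensor_rankOne]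
      exact Submodule.subset_span ⟨_, star_mem hx, _, _, rfl⟩)
  have hW : stabAlg H M ≤ W.topologicalClosure := by
    refine NonUnitalStarSubalgebra.topologicalClosure_minimal _ (NonUnitalStarAlgebra.adjoin_le ?_)
      W.isClosed_topologicalClosure
    rintro _ ⟨x, hx, k, hk, rfl⟩
    have hcl : IsClosed {l : H →L[ℂ] H | opTensor x l ∈ W.topologicalClosure} :=
      W.isClosed_topologicalClosure.preimage (continuous_opTensor_right x)
    refine closure_minimal (fun l hl => ?_) hcl (mem_closure_span_rankOne hk)
    refine W.le_topologicalClosure ?_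
    rw [← SetLike.mem_coe, hWV, SetLike.mem_coe]
    refine Submodule.span_induction (p := fun l _ => opTensor x l ∈ V) ?_ ?_ ?_ ?_ hl
    · rintro _ ⟨ξ, η, rfl⟩
      exact Submodule.subset_span ⟨x, hx, ξ, η, rfl⟩
    · rw [opTensor_zero_right]; exact V.zero_mem
    · intro l l' _ _ hl hl'
      rw [opTensor_add_right]
      exact V.add_mem hl hl'
    · intro c l _ hl
      rw [opTensor_smul_right]
      exact V.smul_mem c hl
  exact closure_minimal (fun t ht => hVp t (hWV.subset ht)) hc (hW hT)

theorem slice_mem_of_mem_stabAlg {M : NonUnitalStarSubalgebra ℂ (E →L[ℂ] E)}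
    (hM : IsClosed (M : Set (E →L[ℂ] E))) {T : HTensor E H →L[ℂ] HTensor E H}
    (hT : T ∈ stabAlg H M) (ξ η : H) : slice ξ η T ∈ M := by
  refine stabAlg_induction (p := fun T => slice ξ η T ∈ M) (hM.preimage (slice ξ η).continuous)
    (by simp) (fun S T hS hT => by rw [map_add]; exact M.add_mem hS hT) (fun x hx ξ' η' => ?_) hT
  rw [slice_opTensor]
  exact SMulMemClass.smul_mem _ hx

end TensorBasics

/-! ### Functoriality of the stabilization -/

section Graph

/-- A `*`-homomorphism defined by its values on generators: if the closed `*`-algebra generated by a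
set `s` of pairs contains no pair `(0, y)` with `y ≠ 0`, then it is the graph of a
`*`-homomorphism on the closed `*`-algebra generated by the first components. The reason is that
the first projection is an injective, hence isometric, `*`-homomorphism, so its range is closed. -/
theorem exists_starAlgHom_of_graph {X Y : Type*} [NonUnitalCStarAlgebra X]
    [NonUnitalCStarAlgebra Y] (s : Set (X × Y))
    (h : ∀ y, ((0 : X), y) ∈ (NonUnitalStarAlgebra.adjoin ℂ s).topologicalClosure → y = 0) :
    ∃ f : (NonUnitalStarAlgebra.adjoin ℂ (Prod.fst '' s)).topologicalClosure →⋆ₙₐ[ℂ] Y,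
      ∀ x : (NonUnitalStarAlgebra.adjoin ℂ (Prod.fst '' s)).topologicalClosure,
        ((x : X), f x) ∈ (NonUnitalStarAlgebra.adjoin ℂ s).topologicalClosure := by
  set Γ := (NonUnitalStarAlgebra.adjoin ℂ s).topologicalClosure with hΓ
  have : IsClosed (Γ : Set (X × Y)) := NonUnitalStarSubalgebra.isClosed_topologicalClosure _
  let q : Γ →⋆ₙₐ[ℂ] X :=
    (NonUnitalStarAlgHom.fst ℂ X Y).comp (NonUnitalStarSubalgebraClass.subtype Γ)
  have hq : Function.Injective q := by
    rw [injective_iff_map_eq_zero]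
    rintro ⟨⟨x, y⟩, hxy⟩ h0
    obtain rfl : x = 0 := h0
    exact Subtype.ext (Prod.ext rfl (h y hxy))
  have hcl : IsClosed (NonUnitalStarAlgHom.range q : Set X) := by
    have := (NonUnitalStarAlgHom.isometry q hq).isClosedEmbedding.isClosed_range
    rwa [NonUnitalStarAlgHom.coe_range]
  have hle : (NonUnitalStarAlgebra.adjoin ℂ (Prod.fst '' s)).topologicalClosure ≤
      NonUnitalStarAlgHom.range q := by
    refine NonUnitalStarSubalgebra.topologicalClosure_minimal _
      (NonUnitalStarAlgebra.adjoin_le ?_) hcl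
    rintro _ ⟨p, hp, rfl⟩
    exact ⟨⟨p, NonUnitalStarSubalgebra.le_topologicalClosure _
      (NonUnitalStarAlgebra.subset_adjoin ℂ s hp)⟩, rfl⟩
  choose g hg using fun x : (NonUnitalStarAlgebra.adjoin ℂ (Prod.fst '' s)).topologicalClosure =>
    hle x.2
  replace hg : ∀ x, q (g x) = x := hg
  have hg' : ∀ x, (g x).1.1 = x := hg
  refine ⟨{ toFun := fun x => (g x).1.2, map_smul' := ?_, map_zero' := ?_, map_add' := ?_,
            map_mul' := ?_, map_star' := ?_ }, fun x => ?_⟩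
  · intro c x
    have : g (c • x) = c • g x := hq (by rw [map_smul, hg, hg]; rfl)
    rw [this]; rfl
  · have : g 0 = 0 := hq (by rw [map_zero, hg]; rfl)
    rw [this]; rfl
  · intro x y
    have : g (x + y) = g x + g y := hq (by rw [map_add, hg, hg, hg]; rfl)
    rw [this]; rfl
  · intro x y
    have : g (x * y) = g x * g y := hq (by rw [map_mul, hg, hg, hg]; rfl)
    rw [this]; rfl
  · intro x
    have : g (star x) = star (g x) := hq (by rw [map_star, hg, hg]; rfl)
    rw [this]; rfl
  · have := (g x).2
    rw [← hg' x]
    exact this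

end Graph

section StabMaps

variable {E : Type*} [NormedAddCommGroup E] [InnerProductSpace ℂ E] [CompleteSpace E]
  {F : Type*} [NormedAddCommGroup F] [InnerProductSpace ℂ F] [CompleteSpace F]
  {H : Type*} [NormedAddCommGroup H] [InnerProductSpace ℂ H] [CompleteSpace H]
  {A : Type*} [NonUnitalCStarAlgebra A] {A' : Type*} [NonUnitalCStarAlgebra A']

/-- The elementary tensor `a ⊗ |ξ⟩⟨η|`. -/
noncomputable def Stab.unit (ρ : A →⋆ₙₐ[ℂ] (E →L[ℂ] E)) (a : A) (ξ η : H) : Stab H ρ :=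
  Stab.tmul ρ a ⟨rankOne ℂ ξ η, isCompactOperator_rankOne ξ η⟩

theorem Stab.toOp_unit (ρ : A →⋆ₙₐ[ℂ] (E →L[ℂ] E)) (a : A) (ξ η : H) :
    Stab.toOp ρ (Stab.unit ρ a ξ η) = opTensor (ρ a) (rankOne ℂ ξ η) := rfl

theorem Stab.toOp_mem (ρ : A →⋆ₙₐ[ℂ] (E →L[ℂ] E)) (x : Stab H ρ) :
    Stab.toOp ρ x ∈ stabAlg H (NonUnitalStarAlgHom.range ρ) := x.2

theorem Stab.isometry_toOp (ρ : A →⋆ₙₐ[ℂ] (E →L[ℂ] E)) : Isometry (Stab.toOp (H := H) ρ) :=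
  NonUnitalStarAlgHom.isometry _ (Stab.toOp_injective ρ)

/-- `A ⊗ 𝒦` is the closed linear span of the elementary tensors `a ⊗ |ξ⟩⟨η|`. -/
theorem Stab.induction {ρ : A →⋆ₙₐ[ℂ] (E →L[ℂ] E)} {p : Stab H ρ → Prop}
    (hc : IsClosed {x | p x}) (h0 : p 0) (hadd : ∀ x y, p x → p y → p (x + y))
    (hunit : ∀ a ξ η, p (Stab.unit ρ a ξ η)) (x : Stab H ρ) : p x := by
  have hcl : IsClosed (Stab.toOp ρ '' {x | p x}) :=
    (Stab.isometry_toOp ρ).isClosedEmbedding.isClosedMap _ hc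
  have key : Stab.toOp ρ x ∈ Stab.toOp ρ '' {x | p x} := by
    refine stabAlg_induction (p := fun T => T ∈ Stab.toOp ρ '' {x | p x}) hcl
      ⟨0, h0, map_zero (Stab.toOp ρ)⟩ ?_ ?_ (Stab.toOp_mem ρ x)
    · rintro _ _ ⟨x, hx, rfl⟩ ⟨y, hy, rfl⟩
      exact ⟨x + y, hadd x y hx hy, map_add (Stab.toOp ρ) x y⟩
    · rintro _ ⟨a, rfl⟩ ξ η
      exact ⟨_, hunit a ξ η, Stab.toOp_unit ρ a ξ η⟩
  obtain ⟨y, hy, hyx⟩ := key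
  exact Stab.toOp_injective ρ hyx ▸ hy

theorem Stab.hom_ext {B : Type*} [NonUnitalCStarAlgebra B] {ρ : A →⋆ₙₐ[ℂ] (E →L[ℂ] E)}
    {f g : Stab H ρ →⋆ₙₐ[ℂ] B} (h : ∀ a ξ η, f (Stab.unit ρ a ξ η) = g (Stab.unit ρ a ξ η)) :
    f = g := by
  ext x
  refine Stab.induction (p := fun x => f x = g x)
    (isClosed_eq (map_continuous f) (map_continuous g))
    ?_ ?_ h x
  · rw [map_zero, map_zero]
  · intro x y hx hy
    rw [map_add, map_add, hx, hy]

theorem isClosed_range_of_injective {B : Type*} [NonUnitalCStarAlgebra B] (f : A →⋆ₙₐ[ℂ] B)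
    (hf : Function.Injective f) : IsClosed (NonUnitalStarAlgHom.range f : Set B) := by
  rw [NonUnitalStarAlgHom.coe_range]
  exact (NonUnitalStarAlgHom.isometry f hf).isClosedEmbedding.isClosed_range

/-- Functoriality of `A ⊗ 𝒦`, and independence of the faithful representation in which it is
computed: a representation `φ` of `A` induces one of `A ⊗ 𝒦`. The slices of the image of `x` are
the images under `φ` of the slices of `x`. -/
theorem Stab.exists_lift (ρ : A →⋆ₙₐ[ℂ] (E →L[ℂ] E)) (hρ : Function.Injective ρ)
    (φ : A →⋆ₙₐ[ℂ] (F →L[ℂ] F)) :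
    ∃ f : Stab H ρ →⋆ₙₐ[ℂ] (HTensor F H →L[ℂ] HTensor F H),
      (∀ a k, f (Stab.tmul ρ a k) = opTensor (φ a) k) ∧
      ∀ x ξ η, ∃ a, slice ξ η (Stab.toOp ρ x) = ρ a ∧ slice ξ η (f x) = φ a := by
  let s : Set ((HTensor E H →L[ℂ] HTensor E H) × (HTensor F H →L[ℂ] HTensor F H)) :=
    {t | ∃ (a : A) (ξ η : H), t = (opTensor (ρ a) (rankOne ℂ ξ η), opTensor (φ a) (rankOne ℂ ξ η))}
  let ψ : A →⋆ₙₐ[ℂ] (E →L[ℂ] E) × (F →L[ℂ] F) := ρ.prod φ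
  have hψ : IsClosed (Set.range ψ) :=
    (NonUnitalStarAlgHom.isometry ψ fun a b hab =>
      hρ (congrArg Prod.fst hab)).isClosedEmbedding.isClosed_range
  -- on the closed `*`-algebra generated by `s` the two slices belong to the same element of `A`
  have hs : ∀ t ∈ (NonUnitalStarAlgebra.adjoin ℂ s).topologicalClosure, ∀ ξ η,
      (slice ξ η t.1, slice ξ η t.2) ∈ Set.range ψ := by
    intro t ht ξ η
    let Q : (HTensor E H →L[ℂ] HTensor E H) × (HTensor F H →L[ℂ] HTensor F H) →ₗ[ℂ]
        (E →L[ℂ] E) × (F →L[ℂ] F) :=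
      (slice (E := E) ξ η).toLinearMap.prodMap (slice (E := F) ξ η).toLinearMap
    have hV : Submodule.span ℂ s ≤
        (LinearMap.range (ψ : A →ₗ[ℂ] (E →L[ℂ] E) × (F →L[ℂ] F))).comap Q := by
      rw [Submodule.span_le]
      rintro _ ⟨a, ξ', η', rfl⟩
      refine ⟨inner ℂ ξ (rankOne ℂ ξ' η' η) • a, Prod.ext ?_ ?_⟩
      · change ρ _ = slice ξ η (opTensor (ρ a) _)
        rw [slice_opTensor, map_smul]
      · change φ _ = slice ξ η (opTensor (φ a) _)
        rw [slice_opTensor, map_smul]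
    have hcl : IsClosed {t : (HTensor E H →L[ℂ] HTensor E H) × (HTensor F H →L[ℂ] HTensor F H) |
        (slice ξ η t.1, slice ξ η t.2) ∈ Set.range ψ} :=
      hψ.preimage (((slice ξ η).continuous.comp continuous_fst).prodMk
        ((slice ξ η).continuous.comp continuous_snd))
    refine closure_minimal (fun t ht => hV ?_) hcl ht
    obtain ⟨W, hW⟩ := exists_subalgebra_eq_span s (by
        rintro _ ⟨a, ξ, η, rfl⟩ _ ⟨b, ξ', η', rfl⟩
        refine Submodule.subset_span ⟨inner ℂ η ξ' • (a * b), ξ, η', ?_⟩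
        rw [Prod.mk_mul_mk, ← opTensor_mul, ← opTensor_mul,
          ContinuousLinearMap.mul_def (rankOne ℂ ξ η), InnerProductSpace.rankOne_comp_rankOne,
          map_smul, map_smul, map_mul, map_mul, opTensor_smul_left, opTensor_smul_right,
          opTensor_smul_left, opTensor_smul_right]) (by
        rintro _ ⟨a, ξ, η, rfl⟩
        refine Submodule.subset_span ⟨star a, η, ξ, Prod.ext ?_ ?_⟩
        · change star (opTensor _ _) = opTensor _ _
          rw [star_opTensor_rankOne, map_star]
        · change star (opTensor _ _) = opTensor _ _
          rw [star_opTensor_rankOne, map_star])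
    exact hW.subset (NonUnitalStarAlgebra.adjoin_le (S := W)
      (Submodule.subset_span.trans hW.symm.subset) ht)
  obtain ⟨f, hf⟩ := exists_starAlgHom_of_graph s fun y hy => by
    refine ext_slice fun ξ η => ?_
    obtain ⟨a, ha⟩ := hs _ hy ξ η
    have h1 : ρ a = 0 := (congrArg Prod.fst ha).trans (map_zero (slice (E := E) ξ η))
    have h2 : φ a = slice ξ η y := congrArg Prod.snd ha
    rw [← h2, (map_eq_zero_iff ρ hρ).1 h1, map_zero, map_zero]
  have hmem : ∀ x : Stab H ρ, Stab.toOp ρ x ∈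
      (NonUnitalStarAlgebra.adjoin ℂ (Prod.fst '' s)).topologicalClosure := by
    intro x
    refine stabAlg_induction
      (p := fun T => T ∈ (NonUnitalStarAlgebra.adjoin ℂ (Prod.fst '' s)).topologicalClosure)
      (NonUnitalStarSubalgebra.isClosed_topologicalClosure _) (zero_mem _)
      (fun _ _ => add_mem) ?_ (Stab.toOp_mem ρ x)
    rintro _ ⟨a, rfl⟩ ξ η
    exact NonUnitalStarSubalgebra.le_topologicalClosure _
      (NonUnitalStarAlgebra.subset_adjoin ℂ _ ⟨_, ⟨a, ξ, η, rfl⟩, rfl⟩)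
  let j : Stab H ρ →⋆ₙₐ[ℂ] (NonUnitalStarAlgebra.adjoin ℂ (Prod.fst '' s)).topologicalClosure :=
    NonUnitalStarAlgHom.codRestrict (Stab.toOp ρ) _ hmem
  have hsl : ∀ x ξ η, ∃ a, slice ξ η (Stab.toOp ρ x) = ρ a ∧ slice ξ η (f (j x)) = φ a := by
    intro x ξ η
    obtain ⟨a, ha⟩ := hs _ (hf (j x)) ξ η
    exact ⟨a, (congrArg Prod.fst ha).symm, (congrArg Prod.snd ha).symm⟩
  refine ⟨f.comp j, fun a k => ext_slice fun ξ η => ?_, hsl⟩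
  obtain ⟨b, hb, hb'⟩ := hsl (Stab.tmul ρ a k) ξ η
  rw [Stab.toOp_tmul, slice_opTensor, ← map_smul] at hb
  rw [slice_opTensor, ← map_smul, hρ hb]
  exact hb'

/-- The representation `a ⊗ k ↦ φ a ⊗ k` of `A ⊗ 𝒦` induced by a representation `φ` of `A`. -/
noncomputable def Stab.lift (ρ : A →⋆ₙₐ[ℂ] (E →L[ℂ] E)) (hρ : Function.Injective ρ)
    (φ : A →⋆ₙₐ[ℂ] (F →L[ℂ] F)) : Stab H ρ →⋆ₙₐ[ℂ] (HTensor F H →L[ℂ] HTensor F H) :=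
  (Stab.exists_lift ρ hρ φ).choose

theorem Stab.lift_tmul (ρ : A →⋆ₙₐ[ℂ] (E →L[ℂ] E)) (hρ : Function.Injective ρ)
    (φ : A →⋆ₙₐ[ℂ] (F →L[ℂ] F)) (a : A) (k : {k : H →L[ℂ] H // IsCompactOperator k}) :
    Stab.lift ρ hρ φ (Stab.tmul ρ a k) = opTensor (φ a) k :=
  (Stab.exists_lift ρ hρ φ).choose_spec.1 a k

theorem Stab.lift_unit (ρ : A →⋆ₙₐ[ℂ] (E →L[ℂ] E)) (hρ : Function.Injective ρ)
    (φ : A →⋆ₙₐ[ℂ] (F →L[ℂ] F)) (a : A) (ξ η : H) :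
    Stab.lift ρ hρ φ (Stab.unit ρ a ξ η) = opTensor (φ a) (rankOne ℂ ξ η) :=
  Stab.lift_tmul ρ hρ φ a _

theorem Stab.slice_lift (ρ : A →⋆ₙₐ[ℂ] (E →L[ℂ] E)) (hρ : Function.Injective ρ)
    (φ : A →⋆ₙₐ[ℂ] (F →L[ℂ] F)) (x : Stab H ρ) (ξ η : H) :
    ∃ a, slice ξ η (Stab.toOp ρ x) = ρ a ∧ slice ξ η (Stab.lift ρ hρ φ x) = φ a :=
  (Stab.exists_lift ρ hρ φ).choose_spec.2 x ξ η

theorem Stab.lift_injective (ρ : A →⋆ₙₐ[ℂ] (E →L[ℂ] E)) (hρ : Function.Injective ρ)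
    (φ : A →⋆ₙₐ[ℂ] (F →L[ℂ] F)) (hφ : Function.Injective φ) :
    Function.Injective (Stab.lift (H := H) ρ hρ φ) := by
  rw [injective_iff_map_eq_zero]
  intro x hx
  refine Stab.toOp_injective ρ (ext_slice fun ξ η => ?_)
  obtain ⟨a, ha, ha'⟩ := Stab.slice_lift ρ hρ φ x ξ η
  rw [hx, map_zero] at ha'
  rw [ha, (map_eq_zero_iff φ hφ).1 ha'.symm, map_zero, map_zero (Stab.toOp ρ), map_zero]

theorem Stab.lift_mem (ρ : A →⋆ₙₐ[ℂ] (E →L[ℂ] E)) (hρ : Function.Injective ρ)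
    (φ : A →⋆ₙₐ[ℂ] (F →L[ℂ] F)) (x : Stab H ρ) :
    Stab.lift ρ hρ φ x ∈ stabAlg H (NonUnitalStarAlgHom.range φ) := by
  refine Stab.induction (p := fun x => Stab.lift ρ hρ φ x ∈ stabAlg H (NonUnitalStarAlgHom.range φ))
    ((stabAlg_isClosed _).preimage (map_continuous (Stab.lift ρ hρ φ))) ?_ ?_ ?_ x
  · rw [map_zero]; exact zero_mem _
  · intro x y hx hy
    rw [map_add]; exact add_mem hx hy
  · intro a ξ η
    rw [Stab.lift_unit]
    exact opTensor_rankOne_mem_stabAlg (M := NonUnitalStarAlgHom.range φ) ⟨a, rfl⟩ ξ η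

theorem Stab.range_lift (ρ : A →⋆ₙₐ[ℂ] (E →L[ℂ] E)) (hρ : Function.Injective ρ)
    (φ : A →⋆ₙₐ[ℂ] (F →L[ℂ] F)) (hφ : Function.Injective φ) :
    Set.range (Stab.lift (H := H) ρ hρ φ) = stabAlg H (NonUnitalStarAlgHom.range φ) := by
  refine Set.Subset.antisymm ?_ fun T hT => ?_
  · rintro _ ⟨x, rfl⟩
    exact Stab.lift_mem ρ hρ φ x
  · refine stabAlg_induction (p := fun T => T ∈ Set.range (Stab.lift (H := H) ρ hρ φ)) ?_
      ⟨0, map_zero _⟩ ?_ ?_ hT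
    · exact (NonUnitalStarAlgHom.isometry _
        (Stab.lift_injective ρ hρ φ hφ)).isClosedEmbedding.isClosed_range
    · rintro _ _ ⟨x, rfl⟩ ⟨y, rfl⟩
      exact ⟨x + y, map_add _ x y⟩
    · rintro _ ⟨a, rfl⟩ ξ η
      exact ⟨_, Stab.lift_unit ρ hρ φ a ξ η⟩

/-- The `*`-homomorphism `φ ⊗ id : A ⊗ 𝒦 → A' ⊗ 𝒦`. -/
noncomputable def Stab.map (ρ : A →⋆ₙₐ[ℂ] (E →L[ℂ] E)) (hρ : Function.Injective ρ)
    (ρ' : A' →⋆ₙₐ[ℂ] (F →L[ℂ] F)) (φ : A →⋆ₙₐ[ℂ] A') : Stab H ρ →⋆ₙₐ[ℂ] Stab H ρ' :=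
  NonUnitalStarAlgHom.codRestrict (Stab.lift ρ hρ (ρ'.comp φ))
    (stabAlg H (NonUnitalStarAlgHom.range ρ')) fun x =>
      stabAlg_mono (by rintro _ ⟨a, rfl⟩; exact ⟨φ a, rfl⟩) (Stab.lift_mem ρ hρ (ρ'.comp φ) x)

theorem Stab.map_tmul (ρ : A →⋆ₙₐ[ℂ] (E →L[ℂ] E)) (hρ : Function.Injective ρ)
    (ρ' : A' →⋆ₙₐ[ℂ] (F →L[ℂ] F)) (φ : A →⋆ₙₐ[ℂ] A') (a : A)
    (k : {k : H →L[ℂ] H // IsCompactOperator k}) :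
    Stab.map ρ hρ ρ' φ (Stab.tmul ρ a k) = Stab.tmul ρ' (φ a) k :=
  Stab.toOp_injective ρ' (Stab.lift_tmul ρ hρ (ρ'.comp φ) a k)

variable (H) in
/-- The action of the automorphisms of `A` on `A ⊗ 𝒦`, `g ↦ g ⊗ id`. -/
noncomputable def Stab.aut (ρ : A →⋆ₙₐ[ℂ] (E →L[ℂ] E)) (hρ : Function.Injective ρ) :
    (A ≃⋆ₐ[ℂ] A) →* (Stab H ρ ≃⋆ₐ[ℂ] Stab H ρ) :=
  have hcomp : ∀ g h : A ≃⋆ₐ[ℂ] A, (Stab.map (H := H) ρ hρ ρ (g : A →⋆ₙₐ[ℂ] A)).comp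
      (Stab.map ρ hρ ρ (h : A →⋆ₙₐ[ℂ] A)) = Stab.map ρ hρ ρ ((g * h : A ≃⋆ₐ[ℂ] A) : A →⋆ₙₐ[ℂ] A) :=
    fun g h => Stab.hom_ext fun a ξ η => by
      simp only [NonUnitalStarAlgHom.comp_apply, Stab.unit, Stab.map_tmul]
      rfl
  have hone : Stab.map (H := H) ρ hρ ρ ((1 : A ≃⋆ₐ[ℂ] A) : A →⋆ₙₐ[ℂ] A) =
      NonUnitalStarAlgHom.id ℂ _ :=
    Stab.hom_ext fun a ξ η => by
      simp only [Stab.unit, Stab.map_tmul]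
      rfl
  { toFun := fun g =>
      { toFun := Stab.map ρ hρ ρ (g : A →⋆ₙₐ[ℂ] A)
        invFun := Stab.map ρ hρ ρ ((g⁻¹ : A ≃⋆ₐ[ℂ] A) : A →⋆ₙₐ[ℂ] A)
        left_inv := fun x => by
          rw [← NonUnitalStarAlgHom.comp_apply, hcomp, inv_mul_cancel, hone]
          rfl
        right_inv := fun x => by
          rw [← NonUnitalStarAlgHom.comp_apply, hcomp, mul_inv_cancel, hone]
          rfl
        map_mul' := map_mul _
        map_add' := map_add _
        map_star' := map_star _
        map_smul' := map_smul _ }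
    map_one' := StarAlgEquiv.ext fun x => DFunLike.congr_fun hone x
    map_mul' := fun g h => StarAlgEquiv.ext fun x => (DFunLike.congr_fun (hcomp g h) x).symm }

theorem Stab.aut_tmul (ρ : A →⋆ₙₐ[ℂ] (E →L[ℂ] E)) (hρ : Function.Injective ρ) (g : A ≃⋆ₐ[ℂ] A)
    (a : A) (k : {k : H →L[ℂ] H // IsCompactOperator k}) :
    Stab.aut H ρ hρ g (Stab.tmul ρ a k) = Stab.tmul ρ (g a) k :=
  Stab.map_tmul ρ hρ ρ (g : A →⋆ₙₐ[ℂ] A) a k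

theorem Stab.aut_unit (ρ : A →⋆ₙₐ[ℂ] (E →L[ℂ] E)) (hρ : Function.Injective ρ) (g : A ≃⋆ₐ[ℂ] A)
    (a : A) (ξ η : H) :
    Stab.aut H ρ hρ g (Stab.unit ρ a ξ η) = Stab.unit ρ (g a) ξ η :=
  Stab.aut_tmul ρ hρ g a _

theorem Stab.equiv_ext {ρ : A →⋆ₙₐ[ℂ] (E →L[ℂ] E)} {f g : Stab H ρ ≃⋆ₐ[ℂ] Stab H ρ}
    (h : ∀ a ξ η, f (Stab.unit ρ a ξ η) = g (Stab.unit ρ a ξ η)) : f = g :=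
  StarAlgEquiv.ext fun x => DFunLike.congr_fun
    (Stab.hom_ext (f := (f : Stab H ρ →⋆ₙₐ[ℂ] Stab H ρ)) (g := (g : Stab H ρ →⋆ₙₐ[ℂ] Stab H ρ)) h) x

theorem Stab.mem_gal {ρ : A →⋆ₙₐ[ℂ] (E →L[ℂ] E)} (hρ : Function.Injective ρ)
    {G : Subgroup (A ≃⋆ₐ[ℂ] A)} {γ : Stab H ρ ≃⋆ₐ[ℂ] Stab H ρ} :
    γ ∈ Stab.gal H ρ G ↔ ∃ g ∈ G, Stab.aut H ρ hρ g = γ := by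
  constructor
  · rintro ⟨g, hg, h⟩
    refine ⟨g, hg, Stab.equiv_ext fun a ξ η => ?_⟩
    rw [Stab.aut_unit]
    exact (h a _).symm
  · rintro ⟨g, hg, rfl⟩
    exact ⟨g, hg, Stab.aut_tmul ρ hρ g⟩

theorem opTensor_rankOne_injective {e : H} (he : e ≠ 0) :
    Function.Injective fun x : E →L[ℂ] E => opTensor x (rankOne ℂ e e) := by
  intro x y hxy
  have h := congrArg (slice e e) hxy
  simp only [slice_opTensor, InnerProductSpace.rankOne_apply] at h
  refine smul_right_injective _ ?_ h
  simp [he]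

theorem Stab.unit_injective {ρ : A →⋆ₙₐ[ℂ] (E →L[ℂ] E)} (hρ : Function.Injective ρ) {e : H}
    (he : e ≠ 0) : Function.Injective fun a => Stab.unit ρ a e e := fun _ _ h =>
  hρ (opTensor_rankOne_injective he (congrArg (Stab.toOp ρ) h))

theorem Stab.aut_injective [Nontrivial H] (ρ : A →⋆ₙₐ[ℂ] (E →L[ℂ] E)) (hρ : Function.Injective ρ) :
    Function.Injective (Stab.aut H ρ hρ) := by
  intro g h hgh
  obtain ⟨e, he⟩ := exists_ne (0 : H)
  ext a
  refine Stab.unit_injective hρ he ?_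
  simp only [← Stab.aut_unit ρ hρ, hgh]

end StabMaps

/-! ### Finite coverings and frames of multipliers -/

section Multipliers

variable {A : Type*} [NonUnitalCStarAlgebra A] {At : Type*} [NonUnitalCStarAlgebra At]

theorem eq_of_forall_mul_left_eq {a b : A} (h : ∀ x, x * a = x * b) : a = b := by
  rw [← sub_eq_zero, ← CStarRing.star_mul_self_eq_zero_iff, mul_sub, h, sub_self]

theorem eq_of_forall_mul_right_eq {a b : A} (h : ∀ x, a * x = b * x) : a = b := by
  rw [← sub_eq_zero, ← CStarRing.mul_star_self_eq_zero_iff, sub_mul, h, sub_self]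

theorem multiplier_fst_mul (m : 𝓜(ℂ, A)) (a b : A) : m.fst (a * b) = m.fst a * b :=
  eq_of_forall_mul_left_eq fun x => by
    rw [← m.central, ← mul_assoc, ← mul_assoc, ← m.central]

theorem multiplier_snd_mul (m : 𝓜(ℂ, A)) (a b : A) : m.snd (a * b) = a * m.snd b :=
  eq_of_forall_mul_right_eq fun x => by
    rw [m.central, mul_assoc, mul_assoc, m.central]

theorem multiplier_ext {m m' : 𝓜(ℂ, A)} (h : ∀ a, m.fst a = m'.fst a) : m = m' := by
  refine DoubleCentralizer.ext ℂ A m m' (Prod.ext (ContinuousLinearMap.ext h)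
    (ContinuousLinearMap.ext fun a => eq_of_forall_mul_right_eq fun x => ?_))
  exact (m.central a x).trans ((congrArg (a * ·) (h x)).trans (m'.central a x).symm)

theorem mul_coeHom (m : 𝓜(ℂ, A)) (a : A) :
    m * DoubleCentralizer.coeHom (𝕜 := ℂ) a = DoubleCentralizer.coeHom (𝕜 := ℂ) (m.fst a) :=
  multiplier_ext fun b => multiplier_fst_mul m a b

theorem coeHom_mul (m : 𝓜(ℂ, A)) (a : A) :
    DoubleCentralizer.coeHom (𝕜 := ℂ) a * m = DoubleCentralizer.coeHom (𝕜 := ℂ) (m.snd a) :=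
  multiplier_ext fun b => (m.central a b).symm

theorem coeHom_injective : Function.Injective (DoubleCentralizer.coeHom (𝕜 := ℂ) (A := A)) :=
  fun _ _ h => eq_of_forall_mul_right_eq fun x =>
    DFunLike.congr_fun (congrArg (fun m : 𝓜(ℂ, A) => m.fst) h) x

theorem eq_of_mul_coeHom_eq {m m' : 𝓜(ℂ, A)}
    (h : ∀ a, m * DoubleCentralizer.coeHom (𝕜 := ℂ) a = m' * DoubleCentralizer.coeHom (𝕜 := ℂ) a) :
    m = m' :=
  multiplier_ext fun a => coeHom_injective (by rw [← mul_coeHom, ← mul_coeHom, h])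

/-- An element `b` of a C*-algebra that multiplies the isomorphic copy of `A` inside it from both
sides into itself defines a multiplier of `A`. -/
theorem exists_multiplier {B : Type*} [NonUnitalCStarAlgebra B] (i : A →⋆ₙₐ[ℂ] B)
    (hi : Function.Injective i) (b : B) (hl : ∀ a, b * i a ∈ Set.range i)
    (hr : ∀ a, i a * b ∈ Set.range i) :
    ∃ m : 𝓜(ℂ, A), (∀ a, i (m.fst a) = b * i a) ∧ ∀ a, i (m.snd a) = i a * b := by
  choose l hl using hl
  choose r hr using hr
  let L : A →ₗ[ℂ] A :=
    { toFun := l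
      map_add' := fun x y => hi (by rw [hl, map_add, map_add, hl, hl, mul_add])
      map_smul' := fun c x => hi (by
        rw [hl, map_smul, RingHom.id_apply, map_smul, hl, mul_smul_comm]) }
  let R : A →ₗ[ℂ] A :=
    { toFun := r
      map_add' := fun x y => hi (by rw [hr, map_add, map_add, hr, hr, add_mul])
      map_smul' := fun c x => hi (by
        rw [hr, map_smul, RingHom.id_apply, map_smul, hr, smul_mul_assoc]) }
  refine ⟨⟨(L.mkContinuous ‖b‖ fun x => ?_, R.mkContinuous ‖b‖ fun x => ?_), fun x y => hi ?_⟩,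
    hl, hr⟩
  · rw [← NonUnitalStarAlgHom.norm_map i hi, ← NonUnitalStarAlgHom.norm_map i hi x]
    change ‖i (l x)‖ ≤ _
    rw [hl]
    exact norm_mul_le _ _
  · rw [← NonUnitalStarAlgHom.norm_map i hi, ← NonUnitalStarAlgHom.norm_map i hi x]
    change ‖i (r x)‖ ≤ _
    rw [hr, mul_comm]
    exact norm_mul_le _ _
  · change i (r x * y) = i (x * l y)
    rw [map_mul, map_mul, hr, hl, mul_assoc]

/-- The action of the automorphisms of `A` on the multiplier algebra of `A`. -/
noncomputable def multiplierAut : (A ≃⋆ₐ[ℂ] A) →* (𝓜(ℂ, A) ≃⋆ₐ[ℂ] 𝓜(ℂ, A)) :=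
  let L : (A ≃⋆ₐ[ℂ] A) → (A →L[ℂ] A) := fun g =>
    { toFun := g
      map_add' := map_add g
      map_smul' := map_smul g
      cont := (StarAlgEquiv.isometry g).continuous }
  let F : (A ≃⋆ₐ[ℂ] A) → 𝓜(ℂ, A) → 𝓜(ℂ, A) := fun g m =>
    ⟨(L g ∘L m.fst ∘L L g⁻¹, L g ∘L m.snd ∘L L g⁻¹), fun x y => by
      change g (m.snd (g.symm x)) * y = x * g (m.fst (g.symm y))
      refine EquivLike.injective g.symm ?_
      rw [map_mul, map_mul, StarAlgEquiv.symm_apply_apply, StarAlgEquiv.symm_apply_apply,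
        m.central]⟩
  have hF : ∀ g m a, (F g m).fst a = g (m.fst (g.symm a)) := fun _ _ _ => rfl
  have hF' : ∀ g m a, (F g m).snd a = g (m.snd (g.symm a)) := fun _ _ _ => rfl
  have hFF : ∀ g h m, F g (F h m) = F (g * h) m := fun g h m => multiplier_ext fun a => rfl
  have hF1 : ∀ m, F 1 m = m := fun m => multiplier_ext fun a => rfl
  { toFun := fun g =>
      { toFun := F g
        invFun := F g⁻¹
        left_inv := fun m => by rw [hFF, inv_mul_cancel, hF1]
        right_inv := fun m => by rw [hFF, mul_inv_cancel, hF1]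
        map_mul' := fun m m' => multiplier_ext fun a => by
          change g (m.fst (m'.fst (g.symm a))) =
            g (m.fst (g.symm (g (m'.fst (g.symm a)))))
          rw [StarAlgEquiv.symm_apply_apply]
        map_add' := fun m m' => multiplier_ext fun a => map_add g _ _
        map_star' := fun m => multiplier_ext fun a => by
          change g (star (m.snd (star (g.symm a)))) = star (g (m.snd (g.symm (star a))))
          rw [map_star g, map_star g.symm]
        map_smul' := fun c m => multiplier_ext fun a => map_smul g _ _ }
    map_one' := StarAlgEquiv.ext hF1
    map_mul' := fun g h => StarAlgEquiv.ext fun m => (hFF g h m).symm }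

theorem multiplierAut_coeHom (g : A ≃⋆ₐ[ℂ] A) (a : A) :
    multiplierAut g (DoubleCentralizer.coeHom (𝕜 := ℂ) a) =
      DoubleCentralizer.coeHom (𝕜 := ℂ) (g a) :=
  multiplier_ext fun b => by
    change g (a * g.symm b) = g a * b
    rw [map_mul, StarAlgEquiv.apply_symm_apply]

end Multipliers

section Frames

variable {A : Type*} [NonUnitalCStarAlgebra A] {At : Type*} [NonUnitalCStarAlgebra At]

/-- An intrinsic form of the notion of a finite-fold covering `(A, Ã, G)`: the group `G` is finite
with fixed point algebra `A`, and there are multipliers `w₁, …, wₙ` of `Ã` which form a frame of `Ã`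
as a Hilbert `A`-module, i.e. `a = ∑ᵢ wᵢ ⟨wᵢ, a⟩` for all `a ∈ Ã`. -/
structure HasMultiplierFrame (j : A →⋆ₙₐ[ℂ] At) (G : Subgroup (At ≃⋆ₐ[ℂ] At)) : Prop where
  injective : Function.Injective j
  finite : Finite G
  fixed : ∀ a : At, (∀ g ∈ G, g a = a) ↔ a ∈ Set.range j
  frame : ∃ (n : ℕ) (w : Fin n → 𝓜(ℂ, At)), ∀ a : At,
    ∑ i, (w i).fst (∑ᶠ g : G, (g : At ≃⋆ₐ[ℂ] At) ((star (w i)).fst a)) = a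

theorem galInner_eq_sum {B : Type*} [NonUnitalCStarAlgebra B] {G : Type*} [Group G] [Fintype G]
    (α : G →* (B ≃⋆ₐ[ℂ] B)) (a b : B) : galInner α a b = ∑ g, α g (star a * b) :=
  finsum_eq_sum_of_fintype _

theorem galInner_star {B : Type*} [NonUnitalCStarAlgebra B] {G : Type*} [Group G] [Finite G]
    (α : G →* (B ≃⋆ₐ[ℂ] B)) (a b : B) : star (galInner α a b) = galInner α b a := by
  have := Fintype.ofFinite G
  simp [galInner_eq_sum, ← map_star]

theorem galInner_fixed {B : Type*} [NonUnitalCStarAlgebra B] {G : Type*} [Group G] [Finite G]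
    (α : G →* (B ≃⋆ₐ[ℂ] B)) (a b : B) (h : G) : α h (galInner α a b) = galInner α a b := by
  have := Fintype.ofFinite G
  rw [galInner_eq_sum, map_sum]
  refine Fintype.sum_equiv (Equiv.mulLeft h) _ _ fun g => ?_
  rw [Equiv.coe_mulLeft, map_mul α, StarAlgEquiv.mul_apply]

theorem galInner_mul_of_fixed {B : Type*} [NonUnitalCStarAlgebra B] {G : Type*} [Group G] [Finite G]
    (α : G →* (B ≃⋆ₐ[ℂ] B)) (a b c : B) (hc : ∀ g, α g c = c) :
    galInner α a (b * c) = galInner α a b * c := by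
  have := Fintype.ofFinite G
  rw [galInner_eq_sum, galInner_eq_sum, Finset.sum_mul]
  refine Finset.sum_congr rfl fun g _ => ?_
  rw [← mul_assoc, map_mul, hc]

theorem galInner_sum {B : Type*} [NonUnitalCStarAlgebra B] {G : Type*} [Group G] [Finite G]
    (α : G →* (B ≃⋆ₐ[ℂ] B)) {n : ℕ} (a : B) (b : Fin n → B) :
    galInner α a (∑ i, b i) = ∑ i, galInner α a (b i) := by
  have := Fintype.ofFinite G
  simp only [galInner_eq_sum, Finset.mul_sum, map_sum]
  exact Finset.sum_comm

/-- If `B̃` is a finitely generated projective Hilbert `B`-module, the images of the standard basis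
vectors of `Bⁿ` form a frame of `B̃`, and they act on the ideal `Ã` of `B̃` as multipliers. -/
theorem IsFiniteCovering.hasMultiplierFrame.{u} {A At : Type u} [NonUnitalCStarAlgebra A]
    [NonUnitalCStarAlgebra At] {j : A →⋆ₙₐ[ℂ] At} {G : Subgroup (At ≃⋆ₐ[ℂ] At)}
    (h : IsFiniteCovering j G) : HasMultiplierFrame j G := by
  obtain ⟨B, Bt, _, _, i, it, jB, α, hi, hit, hiess, hitess, hji, hα, hcov, hrange⟩ := h
  have := hcov.finite
  have := Fintype.ofFinite G
  have hfix : ∀ x : Bt, (∀ g, α g x = x) ↔ x ∈ Set.range jB := hcov.fixed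
  refine ⟨fun a b hab => hi (hcov.injective (by rw [hji, hji, hab])), hcov.finite,
    fun a => ⟨fun ha => ?_, ?_⟩, ?_⟩
  · have hone : galInner α 1 (it a) = (Fintype.card G : ℂ) • it a := by
      rw [galInner_eq_sum, star_one, one_mul]
      simp_rw [hα]
      rw [Finset.sum_congr rfl fun g _ => by rw [ha g g.2], Finset.sum_const, Finset.card_univ,
        Nat.cast_smul_eq_nsmul]
    obtain ⟨c, hc⟩ := (hrange (it a)).1 ⟨a, rfl⟩ 1
    refine ⟨(Fintype.card G : ℂ)⁻¹ • c, hit ?_⟩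
    replace hc : jB (i c) = galInner α 1 (it a) := hc
    rw [map_smul, map_smul, ← hji, hc, hone, smul_smul, inv_mul_cancel₀ (by simp), one_smul]
  · rintro ⟨c, rfl⟩ g hg
    refine hit ?_
    rw [← hα ⟨g, hg⟩, ← hji]
    exact (hfix _).2 ⟨_, rfl⟩ _
  · obtain ⟨n, V, W, -, hW, hVW, hWV⟩ := hcov.finite_projective
    let w : Fin n → Bt := fun l => W (Pi.single l 1)
    have hWw : ∀ y, W y = ∑ l, w l * jB (y l) := by
      intro y
      conv_lhs => rw [← Finset.univ_sum_single y, map_sum]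
      refine Finset.sum_congr rfl fun l _ => ?_
      rw [← hW]
      congr 1
      ext k
      rcases eq_or_ne k l with rfl | hk
      · simp
      · simp [hk]
    have hV : ∀ x l, jB (V x l) = galInner α (w l) x := by
      intro x l
      have := hVW x (Pi.single l 1)
      rw [← galInner_star, ← this, ← map_star]
      congr 1
      rw [Finset.sum_eq_single l (fun k _ hk => by simp [hk]) (by simp)]
      simp
    have hm : ∀ l, ∃ m : 𝓜(ℂ, At), (∀ a, it (m.fst a) = w l * it a) ∧
        ∀ a, it (m.snd a) = it a * w l := fun l =>
      exists_multiplier it hit (w l) (fun a => hitess.mul_mem_left _ _ ⟨a, rfl⟩)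
        (fun a => hitess.mul_mem_right _ _ ⟨a, rfl⟩)
    choose m hm hm' using hm
    refine ⟨n, m, fun a => hit ?_⟩
    rw [map_sum]
    conv_rhs => rw [← hWV (it a), hWw]
    refine Finset.sum_congr rfl fun l _ => ?_
    rw [hm, hV, galInner_eq_sum, finsum_eq_sum_of_fintype, map_sum]
    congr 1
    refine Finset.sum_congr rfl fun g _ => ?_
    rw [← hα, DoubleCentralizer.star_fst, map_star, hm', star_mul, map_star, star_star]

/-- The fixed point algebra of a finite group acting on `Ã` is essential in the multiplier algebra
of `Ã`. -/
theorem multiplier_eq_zero_of_mul_fixed {j : A →⋆ₙₐ[ℂ] At} {G : Subgroup (At ≃⋆ₐ[ℂ] At)}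
    [Finite G] (hfix : ∀ a : At, (∀ g ∈ G, g a = a) ↔ a ∈ Set.range j) {m : 𝓜(ℂ, At)}
    (hm : ∀ a, m * DoubleCentralizer.coeHom (𝕜 := ℂ) (j a) = 0) : m = 0 := by
  have := Fintype.ofFinite G
  have hfst : ∀ a, m.fst (j a) = 0 := fun a => coeHom_injective (by
    rw [← mul_coeHom, hm, map_zero])
  refine multiplier_ext fun x => ?_
  -- `∑ g (x x*)` lies in `A`, so that `∑ (m g(x)) (m g(x))* = 0`
  have hmem : ∑ g : G, (g : At ≃⋆ₐ[ℂ] At) (x * star x) ∈ Set.range j := by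
    refine (hfix _).1 fun h hh => ?_
    rw [map_sum]
    exact Fintype.sum_equiv (Equiv.mulLeft (⟨h, hh⟩ : G)) _ _ fun g => rfl
  obtain ⟨a, ha⟩ := hmem
  let _ : PartialOrder At := CStarAlgebra.spectralOrder At
  let _ : StarOrderedRing At := CStarAlgebra.spectralOrderedRing At
  have hsum : ∑ g : G, m.fst ((g : At ≃⋆ₐ[ℂ] At) x) * star (m.fst ((g : At ≃⋆ₐ[ℂ] At) x)) = 0 := by
    have h1 : ∀ g : G, m.fst ((g : At ≃⋆ₐ[ℂ] At) x) * star (m.fst ((g : At ≃⋆ₐ[ℂ] At) x)) =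
        (star m).snd (m.fst ((g : At ≃⋆ₐ[ℂ] At) (x * star x))) := by
      intro g
      rw [map_mul, multiplier_fst_mul, multiplier_snd_mul, DoubleCentralizer.star_snd,
        ← map_star (g : At ≃⋆ₐ[ℂ] At), star_star]
    rw [Finset.sum_congr rfl fun g _ => h1 g, ← map_sum, ← map_sum, ← ha, hfst, map_zero]
  have h1 := (Finset.sum_eq_zero_iff_of_nonneg fun g _ => mul_star_self_nonneg _).1 hsum 1
    (Finset.mem_univ _)
  exact (CStarRing.mul_star_self_eq_zero_iff _).1 h1

/-- A covering can be realized in the multiplier algebra of `Ã` and its fixed point algebra. -/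
theorem HasMultiplierFrame.isFiniteCovering.{u} {A At : Type u} [NonUnitalCStarAlgebra A]
    [NonUnitalCStarAlgebra At] {j : A →⋆ₙₐ[ℂ] At} {G : Subgroup (At ≃⋆ₐ[ℂ] At)}
    (h : HasMultiplierFrame j G) : IsFiniteCovering j G := by
  have := h.finite
  have := Fintype.ofFinite G
  obtain ⟨n, w, hw⟩ := h.frame
  let α : G →* (𝓜(ℂ, At) ≃⋆ₐ[ℂ] 𝓜(ℂ, At)) := multiplierAut.comp G.subtype
  let it : At →⋆ₙₐ[ℂ] 𝓜(ℂ, At) := DoubleCentralizer.coeHom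
  have hit : Function.Injective it := coeHom_injective
  have hα : ∀ (g : G) a, α g (it a) = it ((g : At ≃⋆ₐ[ℂ] At) a) := fun g a =>
    multiplierAut_coeHom _ a
  have hml : ∀ m a, m * it a = it (m.fst a) := mul_coeHom
  have hmr : ∀ m a, it a * m = it (m.snd a) := coeHom_mul
  let B : StarSubalgebra ℂ 𝓜(ℂ, At) :=
    { carrier := {m | ∀ g, α g m = m}
      mul_mem' := fun hx hy g => by rw [map_mul, hx, hy]
      add_mem' := fun hx hy g => by rw [map_add, hx, hy]
      algebraMap_mem' := fun c g => by
        rw [Algebra.algebraMap_eq_smul_one, map_smul, map_one]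
      star_mem' := fun hx g => by rw [map_star, hx] }
  have hBcl : IsClosed (B : Set 𝓜(ℂ, At)) := by
    have : (B : Set 𝓜(ℂ, At)) = ⋂ g, {m | α g m = m} := by
      ext m
      simp only [Set.mem_iInter]
      rfl
    rw [this]
    exact isClosed_iInter fun g =>
      isClosed_eq (StarAlgEquiv.isometry (α g)).continuous continuous_id
  let jB : B →⋆ₐ[ℂ] 𝓜(ℂ, At) := B.subtype
  have hjB : ∀ x, x ∈ B ↔ ∀ g, α g x = x := fun x => Iff.rfl
  have hjmem : ∀ a, it (j a) ∈ B := fun a g => by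
    rw [hα, (h.fixed _).2 ⟨a, rfl⟩ g g.2]
  -- the elements of `Ã` in the fixed point algebra are those of `A`
  have hitB : ∀ a, it a ∈ B → ∃ c, it (j c) = it a := fun a ha => by
    obtain ⟨c, hc⟩ := (h.fixed a).1 fun g hg => hit (by rw [← hα ⟨g, hg⟩, ha])
    exact ⟨c, by rw [hc]⟩
  let i : A →⋆ₙₐ[ℂ] B :=
    { toFun := fun a => ⟨it (j a), hjmem a⟩
      map_smul' := fun c a => Subtype.ext (map_smul (it.comp j) c a)
      map_zero' := Subtype.ext (map_zero (it.comp j))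
      map_add' := fun a b => Subtype.ext (map_add (it.comp j) a b)
      map_mul' := fun a b => Subtype.ext (map_mul (it.comp j) a b)
      map_star' := fun a => Subtype.ext (map_star (it.comp j) a) }
  have hi : Function.Injective i := fun a b hab => h.injective (hit (congrArg Subtype.val hab))
  have hiv : ∀ a, (i a : 𝓜(ℂ, At)) = it (j a) := fun _ => rfl
  have hannih : ∀ m : 𝓜(ℂ, At), (∀ a, m * it (j a) = 0) → m = 0 := fun m hm =>
    multiplier_eq_zero_of_mul_fixed h.fixed hm
  have hsum : ∀ x a, (∑ l, w l * galInner α (w l) x) * it (j a) =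
      ∑ l, w l * galInner α (w l) (x * it (j a)) := by
    intro x a
    rw [Finset.sum_mul]
    refine Finset.sum_congr rfl fun l _ => ?_
    rw [galInner_mul_of_fixed α _ _ _ (hjmem a), mul_assoc]
  have hgal : ∀ m a, galInner α m (it a) = it (∑ g : G, (g : At ≃⋆ₐ[ℂ] At) ((star m).fst a)) := by
    intro m a
    rw [galInner_eq_sum, map_sum]
    refine Finset.sum_congr rfl fun g _ => ?_
    rw [hml, hα]
  have hframe : ∀ x : 𝓜(ℂ, At), ∑ l, w l * galInner α (w l) x = x := by
    intro x
    rw [← sub_eq_zero]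
    refine hannih _ fun a => ?_
    rw [sub_mul, hsum, hml, sub_eq_zero]
    conv_rhs => rw [← hw (x.fst (j a)), map_sum]
    refine Finset.sum_congr rfl fun l _ => ?_
    rw [hgal, hml, finsum_eq_sum_of_fintype]
  refine ⟨B, 𝓜(ℂ, At), inferInstance, inferInstance, i, it, jB, α, hi, hit, ?_, ?_, fun _ => rfl,
    hα, ?_, fun x => ⟨?_, fun hx => ?_⟩⟩
  · refine ⟨?_, ⟨0, map_zero i⟩, ?_, ?_, ?_, fun b hb => Subtype.ext (hannih _ fun a => ?_),
      fun b hb => ?_⟩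
    · rw [← NonUnitalStarAlgHom.coe_range]
      exact isClosed_range_of_injective i hi
    · rintro _ ⟨a, rfl⟩ _ ⟨b, rfl⟩
      exact ⟨a + b, map_add i a b⟩
    · rintro b _ ⟨a, rfl⟩
      obtain ⟨c, hc⟩ := hitB ((b : 𝓜(ℂ, At)).fst (j a)) (by
        rw [← hml]; exact B.mul_mem b.2 (hjmem a))
      exact ⟨c, Subtype.ext (by rw [hiv, hc, ← hml]; rfl)⟩
    · rintro b _ ⟨a, rfl⟩
      obtain ⟨c, hc⟩ := hitB ((b : 𝓜(ℂ, At)).snd (j a)) (by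
        rw [← hmr]; exact B.mul_mem (hjmem a) b.2)
      exact ⟨c, Subtype.ext (by rw [hiv, hc, ← hmr]; rfl)⟩
    · exact congrArg Subtype.val (hb _ ⟨a, rfl⟩)
    · rw [← star_eq_zero]
      refine Subtype.ext (hannih _ fun a => ?_)
      change star (b : 𝓜(ℂ, At)) * it (j a) = 0
      rw [← star_eq_zero, star_mul, star_star, ← map_star it, ← map_star j]
      exact congrArg Subtype.val (hb _ ⟨star a, rfl⟩)
  · refine ⟨?_, ⟨0, map_zero it⟩, ?_, ?_, ?_, fun b hb => ?_, fun b hb => ?_⟩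
    · rw [← NonUnitalStarAlgHom.coe_range]
      exact isClosed_range_of_injective it hit
    · rintro _ ⟨a, rfl⟩ _ ⟨b, rfl⟩
      exact ⟨a + b, map_add it a b⟩
    · rintro b _ ⟨a, rfl⟩
      exact ⟨_, (hml b a).symm⟩
    · rintro b _ ⟨a, rfl⟩
      exact ⟨_, (hmr b a).symm⟩
    · exact eq_of_mul_coeHom_eq fun a => by rw [zero_mul]; exact hb _ ⟨a, rfl⟩
    · rw [← star_eq_zero]
      refine eq_of_mul_coeHom_eq fun a => ?_
      rw [zero_mul, ← star_eq_zero, star_mul, star_star, ← map_star]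
      exact hb _ ⟨_, rfl⟩
  · refine ⟨Subtype.val_injective, h.finite, fun g g' hgg => Subtype.ext (StarAlgEquiv.ext fun a =>
      hit ?_), fun b => ⟨fun hb => ⟨⟨b, hb⟩, rfl⟩, ?_⟩, n, ?_⟩
    · rw [← hα, ← hα, hgg]
    · rintro ⟨b, rfl⟩
      exact b.2
    refine ⟨{ toFun := fun x l => ⟨galInner α (w l) x, galInner_fixed α _ _⟩
              map_add' := fun x y => funext fun l => Subtype.ext ?_
              map_smul' := fun c x => funext fun l => Subtype.ext ?_ },
      { toFun := fun y => ∑ l, w l * (y l : 𝓜(ℂ, At))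
        map_add' := fun x y => ?_
        map_smul' := fun c x => ?_ }, fun x b l => Subtype.ext ?_, fun y b => ?_, fun x y => ?_,
      hframe⟩
    · change galInner α (w l) (x + y) = galInner α (w l) x + galInner α (w l) y
      simp only [galInner_eq_sum, mul_add, map_add, Finset.sum_add_distrib]
    · change galInner α (w l) (c • x) = c • galInner α (w l) x
      simp only [galInner_eq_sum, mul_smul_comm, map_smul, Finset.smul_sum]
    · simp [mul_add, Finset.sum_add_distrib]
    · simp [Finset.smul_sum]
    · exact galInner_mul_of_fixed α _ _ _ b.2
    · change ∑ l, w l * ((y l : 𝓜(ℂ, At)) * (b : 𝓜(ℂ, At))) =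
        (∑ l, w l * (y l : 𝓜(ℂ, At))) * (b : 𝓜(ℂ, At))
      simp only [Finset.sum_mul, mul_assoc]
    · change jB (∑ l, star _ * y l) = galInner α x (∑ l, w l * (y l : 𝓜(ℂ, At)))
      rw [galInner_sum, map_sum]
      refine Finset.sum_congr rfl fun l _ => ?_
      rw [galInner_mul_of_fixed α _ _ _ (y l).2, ← galInner_star]
      rfl
  · rintro ⟨a, rfl⟩ b
    obtain ⟨c, hc⟩ := hitB (∑ g : G, (g : At ≃⋆ₐ[ℂ] At) ((star b).fst a)) (by
      rw [← hgal]; exact galInner_fixed α _ _)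
    exact ⟨c, by rw [hgal, ← hc]; rfl⟩
  · rw [← hframe x]
    choose c hc using hx
    refine ⟨∑ l, (w l).fst (j (c (w l))), ?_⟩
    rw [map_sum]
    refine Finset.sum_congr rfl fun l _ => ?_
    rw [← hml, ← hc]
    rfl

end Frames

/-! ### Stabilization of finite coverings -/

section StabCovering

variable {E : Type*} [NormedAddCommGroup E] [InnerProductSpace ℂ E] [CompleteSpace E]
  {H : Type*} [NormedAddCommGroup H] [InnerProductSpace ℂ H] [CompleteSpace H]
  {A : Type*} [NonUnitalCStarAlgebra A] {At : Type*} [NonUnitalCStarAlgebra At]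

/-- A multiplier of `A` is implemented by an operator in any representation of `A`, a weak limit of
the images of `m e`, where `e` runs through an approximate unit of `A`. -/
theorem exists_operator_of_multiplier (ρ : A →⋆ₙₐ[ℂ] (E →L[ℂ] E)) (m : 𝓜(ℂ, A)) :
    ∃ T : E →L[ℂ] E, (∀ a, T * ρ a = ρ (m.fst a)) ∧ ∀ a, ρ a * T = ρ (m.snd a) := by
  let _ : PartialOrder A := CStarAlgebra.spectralOrder A
  let _ : StarOrderedRing A := CStarAlgebra.spectralOrderedRing A
  have hl := CStarAlgebra.increasingApproximateUnit A
  have := hl.neBot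
  let u : Ultrafilter A := Ultrafilter.of (CStarAlgebra.approximateUnit A)
  have hu : (u : Filter A) ≤ CStarAlgebra.approximateUnit A := Ultrafilter.of_le _
  have hbd : ∀ ξ η : E, ∀ᶠ e in (u : Filter A),
      ‖inner ℂ ξ (ρ (m.fst e) η)‖ ≤ ‖m.fst‖ * ‖ξ‖ * ‖η‖ := by
    intro ξ η
    filter_upwards [hu hl.eventually_norm] with e he
    calc ‖inner ℂ ξ (ρ (m.fst e) η)‖ ≤ ‖ξ‖ * ‖ρ (m.fst e) η‖ := norm_inner_le_norm _ _
      _ ≤ ‖ξ‖ * (‖ρ (m.fst e)‖ * ‖η‖) := by gcongr; exact ContinuousLinearMap.le_opNorm _ _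
      _ ≤ ‖ξ‖ * ((‖m.fst‖ * 1) * ‖η‖) := by
        gcongr
        exact (NonUnitalStarAlgHom.norm_apply_le ρ _).trans
          ((m.fst.le_opNorm e).trans (by gcongr))
      _ = ‖m.fst‖ * ‖ξ‖ * ‖η‖ := by ring
  have hex : ∀ ξ η : E, ∃ c : ℂ, ‖c‖ ≤ ‖m.fst‖ * ‖ξ‖ * ‖η‖ ∧
      Tendsto (fun e => inner ℂ ξ (ρ (m.fst e) η)) u (𝓝 c) := by
    intro ξ η
    have hc := isCompact_closedBall (0 : ℂ) (‖m.fst‖ * ‖ξ‖ * ‖η‖)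
    obtain ⟨c, hc, hcl⟩ := hc.ultrafilter_le_nhds (u.map fun e => inner ℂ ξ (ρ (m.fst e) η)) (by
      rw [le_principal_iff]
      exact (hbd ξ η).mono fun e he => by simpa using he)
    exact ⟨c, by simpa using hc, hcl⟩
  choose b hb hbl using hex
  let β : E →ₗ⋆[ℂ] E →ₗ[ℂ] ℂ := LinearMap.mk₂'ₛₗ _ _ b
    (fun ξ ξ' η => tendsto_nhds_unique (hbl _ η) (by
      simpa only [inner_add_left] using (hbl ξ η).add (hbl ξ' η)))
    (fun c ξ η => tendsto_nhds_unique (hbl _ η) (by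
      simpa only [inner_smul_left, smul_eq_mul] using (hbl ξ η).const_mul _))
    (fun ξ η η' => tendsto_nhds_unique (hbl ξ _) (by
      simpa only [map_add, inner_add_right] using (hbl ξ η).add (hbl ξ η')))
    (fun c ξ η => tendsto_nhds_unique (hbl ξ _) (by
      simpa only [map_smul, inner_smul_right, smul_eq_mul, RingHom.id_apply] using
        (hbl ξ η).const_mul _))
  let T : E →L[ℂ] E := (InnerProductSpace.continuousLinearMapOfBilin
    (β.mkContinuous₂ ‖m.fst‖ hb))†
  have hT : ∀ ξ η, Tendsto (fun e => inner ℂ ξ (ρ (m.fst e) η)) u (𝓝 (inner ℂ ξ (T η))) := by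
    intro ξ η
    rw [ContinuousLinearMap.adjoint_inner_right,
      InnerProductSpace.continuousLinearMapOfBilin_apply]
    exact hbl ξ η
  refine ⟨T, fun a => ?_, fun a => ?_⟩
  · ext η
    refine ext_inner_left ℂ fun ξ => tendsto_nhds_unique (hT ξ (ρ a η)) ?_
    have h1 : Tendsto (fun e => e * a) (u : Filter A) (𝓝 a) := (hl.tendsto_mul_right a).mono_left hu
    have hc : Continuous fun x => inner ℂ ξ (ρ (m.fst x) η) := by
      have := map_continuous ρ
      fun_prop
    refine ((hc.tendsto a).comp h1).congr fun e => ?_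
    rw [Function.comp_apply, multiplier_fst_mul, map_mul]
    rfl
  · ext η
    refine ext_inner_left ℂ fun ξ => ?_
    have h2 : inner ℂ ξ ((ρ a * T) η) = inner ℂ (((ρ a)†) ξ) (T η) := by
      rw [ContinuousLinearMap.adjoint_inner_left]
      rfl
    rw [h2]
    refine tendsto_nhds_unique (hT _ η) ?_
    have h1 : Tendsto (fun e => m.snd a * e) (u : Filter A) (𝓝 (m.snd a)) :=
      (hl.tendsto_mul_left (m.snd a)).mono_left hu
    have hc : Continuous fun x => inner ℂ ξ (ρ x η) := by
      have := map_continuous ρ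
      fun_prop
    refine ((hc.tendsto _).comp h1).congr fun e => ?_
    rw [Function.comp_apply, m.central, map_mul, ContinuousLinearMap.adjoint_inner_left]
    rfl

/-- The additive map `a ↦ a ⊗ |ξ⟩⟨η|`. -/
noncomputable def Stab.unitHom (ρ : A →⋆ₙₐ[ℂ] (E →L[ℂ] E)) (ξ η : H) : A →+ Stab H ρ :=
  AddMonoidHom.mk' (fun a => Stab.unit ρ a ξ η) fun a b => Stab.toOp_injective ρ (by
    rw [map_add (Stab.toOp ρ), Stab.toOp_unit, Stab.toOp_unit, Stab.toOp_unit, map_add,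
      opTensor_add_left])

theorem Stab.unit_sum (ρ : A →⋆ₙₐ[ℂ] (E →L[ℂ] E)) {κ : Type*} (s : Finset κ) (f : κ → A)
    (ξ η : H) : Stab.unit ρ (∑ i ∈ s, f i) ξ η = ∑ i ∈ s, Stab.unit ρ (f i) ξ η :=
  map_sum (Stab.unitHom ρ ξ η) f s

theorem Stab.star_unit (ρ : A →⋆ₙₐ[ℂ] (E →L[ℂ] E)) (a : A) (ξ η : H) :
    star (Stab.unit ρ a ξ η) = Stab.unit ρ (star a) η ξ :=
  Stab.toOp_injective ρ (by
    rw [map_star (Stab.toOp ρ), Stab.toOp_unit, Stab.toOp_unit, map_star, star_opTensor_rankOne])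

theorem Stab.incl_unit (ρ : A →⋆ₙₐ[ℂ] (E →L[ℂ] E)) (ρ' : At →⋆ₙₐ[ℂ] (E →L[ℂ] E))
    (f : A → At) (h : ∀ a, ρ' (f a) = ρ a) (a : A) (ξ η : H) :
    Stab.incl H ρ ρ' f h (Stab.unit ρ a ξ η) = Stab.unit ρ' (f a) ξ η :=
  Stab.incl_tmul ρ ρ' f h a _

theorem Stab.incl_injective (ρ : A →⋆ₙₐ[ℂ] (E →L[ℂ] E)) (ρ' : At →⋆ₙₐ[ℂ] (E →L[ℂ] E))
    (f : A → At) (h : ∀ a, ρ' (f a) = ρ a) : Function.Injective (Stab.incl H ρ ρ' f h) :=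
  fun x y hxy => Stab.toOp_injective ρ (by
    rw [← Stab.toOp_incl ρ ρ' f h, hxy, Stab.toOp_incl])

/-- The multiplier `m ⊗ 1` of `A ⊗ 𝒦`. -/
theorem Stab.exists_multiplier (ρ : A →⋆ₙₐ[ℂ] (E →L[ℂ] E)) (m : 𝓜(ℂ, A)) :
    ∃ M : 𝓜(ℂ, Stab H ρ),
      (∀ (a : A) (ξ η : H), M.fst (Stab.unit ρ a ξ η) = Stab.unit ρ (m.fst a) ξ η) ∧
      ∀ (a : A) (ξ η : H), M.snd (Stab.unit ρ a ξ η) = Stab.unit ρ (m.snd a) ξ η := by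
  obtain ⟨T, hT, hT'⟩ := exists_operator_of_multiplier ρ m
  have h1 : ∀ (a : A) (ξ η : H), opTensor T 1 * Stab.toOp ρ (Stab.unit (H := H) ρ a ξ η) =
      Stab.toOp ρ (Stab.unit ρ (m.fst a) ξ η) := fun a ξ η => by
    rw [Stab.toOp_unit, ← opTensor_mul, hT, one_mul, Stab.toOp_unit]
  have h2 : ∀ (a : A) (ξ η : H), Stab.toOp ρ (Stab.unit (H := H) ρ a ξ η) * opTensor T 1 =
      Stab.toOp ρ (Stab.unit ρ (m.snd a) ξ η) := fun a ξ η => by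
    rw [Stab.toOp_unit, ← opTensor_mul, hT', mul_one, Stab.toOp_unit]
  have hcl : IsClosed (Set.range (Stab.toOp (H := H) ρ)) :=
    (Stab.isometry_toOp ρ).isClosedEmbedding.isClosed_range
  have hl : ∀ x, opTensor T 1 * Stab.toOp (H := H) ρ x ∈ Set.range (Stab.toOp ρ) := fun x => by
    refine Stab.induction (p := fun x => opTensor T 1 * Stab.toOp ρ x ∈ Set.range (Stab.toOp ρ))
      (hcl.preimage ((continuous_const_mul (opTensor T 1)).comp (Stab.isometry_toOp ρ).continuous))
      ?_ ?_
      (fun a ξ η => ⟨_, (h1 a ξ η).symm⟩) x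
    · exact ⟨0, by rw [map_zero (Stab.toOp ρ), mul_zero]⟩
    · rintro x y ⟨x', hx⟩ ⟨y', hy⟩
      exact ⟨x' + y', by rw [map_add (Stab.toOp ρ), map_add (Stab.toOp ρ), hx, hy, mul_add]⟩
  have hr : ∀ x, Stab.toOp (H := H) ρ x * opTensor T 1 ∈ Set.range (Stab.toOp ρ) := fun x => by
    refine Stab.induction (p := fun x => Stab.toOp ρ x * opTensor T 1 ∈ Set.range (Stab.toOp ρ))
      (hcl.preimage ((continuous_mul_const (opTensor T 1)).comp (Stab.isometry_toOp ρ).continuous))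
      ?_ ?_
      (fun a ξ η => ⟨_, (h2 a ξ η).symm⟩) x
    · exact ⟨0, by rw [map_zero (Stab.toOp ρ), zero_mul]⟩
    · rintro x y ⟨x', hx⟩ ⟨y', hy⟩
      exact ⟨x' + y', by rw [map_add (Stab.toOp ρ), map_add (Stab.toOp ρ), hx, hy, add_mul]⟩
  obtain ⟨M, hM, hM'⟩ := NCCov.exists_multiplier (Stab.toOp (H := H) ρ) (Stab.toOp_injective ρ)
    (opTensor T 1) hl hr
  exact ⟨M, fun a ξ η => Stab.toOp_injective ρ (by rw [hM, h1]),
    fun a ξ η => Stab.toOp_injective ρ (by rw [hM', h2])⟩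

theorem Stab.gal_eq_map {ρ : A →⋆ₙₐ[ℂ] (E →L[ℂ] E)} (hρ : Function.Injective ρ)
    (G : Subgroup (A ≃⋆ₐ[ℂ] A)) : Stab.gal H ρ G = G.map (Stab.aut H ρ hρ) := by
  ext γ
  rw [Stab.mem_gal hρ, Subgroup.mem_map]

variable (H) in
/-- The isomorphism `G ≃ {g ⊗ id | g ∈ G}`. -/
noncomputable def Stab.galEquiv [Nontrivial H] {ρ : A →⋆ₙₐ[ℂ] (E →L[ℂ] E)}
    (hρ : Function.Injective ρ) (G : Subgroup (A ≃⋆ₐ[ℂ] A)) : G ≃* Stab.gal H ρ G :=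
  (G.equivMapOfInjective _ (Stab.aut_injective ρ hρ)).trans
    (MulEquiv.subgroupCongr (Stab.gal_eq_map hρ G).symm)

/-- The frame of multipliers `wᵢ` of `Ã` gives the frame of multipliers `wᵢ ⊗ 1` of `Ã ⊗ 𝒦`. -/
theorem HasMultiplierFrame.stab [Nontrivial H] {j : A →⋆ₙₐ[ℂ] At} {G : Subgroup (At ≃⋆ₐ[ℂ] At)}
    (h : HasMultiplierFrame j G) (ρ : A →⋆ₙₐ[ℂ] (E →L[ℂ] E)) (ρ' : At →⋆ₙₐ[ℂ] (E →L[ℂ] E))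
    (hρ' : Function.Injective ρ') (hj : ∀ a, ρ' (j a) = ρ a) :
    HasMultiplierFrame (Stab.incl H ρ ρ' j hj) (Stab.gal H ρ' G) := by
  have := h.finite
  have := Fintype.ofFinite G
  have hcl : IsClosed (Set.range (Stab.incl H ρ ρ' j hj)) :=
    (NonUnitalStarAlgHom.isometry _
      (Stab.incl_injective ρ ρ' j hj)).isClosedEmbedding.isClosed_range
  refine ⟨Stab.incl_injective ρ ρ' j hj, Finite.of_equiv _ (Stab.galEquiv H hρ' G).toEquiv,
    fun x => ⟨fun hx => ?_, ?_⟩, ?_⟩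
  · -- the average over `G` of any element lies in `A ⊗ 𝒦`
    have havg : ∀ x : Stab H ρ', ∑ g : G, Stab.aut H ρ' hρ' g x ∈
        Set.range (Stab.incl H ρ ρ' j hj) := by
      intro x
      refine Stab.induction (p := fun x => ∑ g : G, Stab.aut H ρ' hρ' g x ∈
        Set.range (Stab.incl H ρ ρ' j hj))
          (hcl.preimage (continuous_finsetSum Finset.univ fun (g : G) _ =>
            (StarAlgEquiv.isometry (Stab.aut H ρ' hρ' g)).continuous)) ?_ ?_ ?_ x
      · exact ⟨0, by simp only [map_zero, Finset.sum_const_zero]⟩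
      · rintro x y ⟨x', hx⟩ ⟨y', hy⟩
        exact ⟨x' + y', by simp only [map_add, Finset.sum_add_distrib, hx, hy]⟩
      · intro a ξ η
        obtain ⟨c, hc⟩ : ∑ g : G, (g : At ≃⋆ₐ[ℂ] At) a ∈ Set.range j := by
          refine (h.fixed _).1 fun k hk => ?_
          rw [map_sum]
          exact Fintype.sum_equiv (Equiv.mulLeft (⟨k, hk⟩ : G)) _ _ fun g => rfl
        refine ⟨Stab.unit ρ c ξ η, ?_⟩
        simp only [Stab.incl_unit, Stab.aut_unit, hc, Stab.unit_sum]
    obtain ⟨y, hy⟩ := havg x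
    refine ⟨(Fintype.card G : ℂ)⁻¹ • y, ?_⟩
    rw [map_smul, hy, Finset.sum_congr rfl fun (g : G) _ =>
      hx _ ((Stab.mem_gal hρ').2 ⟨g, g.2, rfl⟩), Finset.sum_const, Finset.card_univ,
      ← Nat.cast_smul_eq_nsmul ℂ, smul_smul, inv_mul_cancel₀ (by simp), one_smul]
  · rintro ⟨y, rfl⟩ γ hγ
    obtain ⟨g, hg, rfl⟩ := (Stab.mem_gal hρ').1 hγ
    refine Stab.induction (p := fun y => Stab.aut H ρ' hρ' g (Stab.incl H ρ ρ' j hj y) =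
      Stab.incl H ρ ρ' j hj y) (isClosed_eq ((StarAlgEquiv.isometry _).continuous.comp
        (map_continuous (Stab.incl H ρ ρ' j hj))) (map_continuous (Stab.incl H ρ ρ' j hj)))
        ?_ ?_ ?_ y
    · rw [map_zero, map_zero]
    · intro x y hx hy
      rw [map_add, map_add, hx, hy]
    · intro a ξ η
      rw [Stab.incl_unit, Stab.aut_unit, (h.fixed _).2 ⟨a, rfl⟩ g hg]
  · obtain ⟨n, w, hw⟩ := h.frame
    choose W hW hW' using fun l => Stab.exists_multiplier (H := H) ρ' (w l)
    have hWs : ∀ l a ξ η, (star (W l)).fst (Stab.unit ρ' a ξ η) =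
        Stab.unit ρ' ((star (w l)).fst a) ξ η := by
      intro l a ξ η
      rw [DoubleCentralizer.star_fst, Stab.star_unit, hW', Stab.star_unit,
        DoubleCentralizer.star_fst]
    refine ⟨n, W, fun x => ?_⟩
    have hsum : ∀ y : Stab H ρ', ∑ᶠ γ : Stab.gal H ρ' G,
        (γ : Stab H ρ' ≃⋆ₐ[ℂ] Stab H ρ') y = ∑ g : G, Stab.aut H ρ' hρ' g y := by
      intro y
      rw [← finsum_eq_sum_of_fintype,
        ← finsum_comp_equiv (Stab.galEquiv H hρ' G).toEquiv]
      rfl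
    simp only [hsum]
    refine Stab.induction (p := fun x => ∑ l, (W l).fst (∑ g : G, Stab.aut H ρ' hρ' g
      ((star (W l)).fst x)) = x) (isClosed_eq (continuous_finsetSum _ fun l _ =>
        (W l).fst.continuous.comp (continuous_finsetSum _ fun g _ =>
          (StarAlgEquiv.isometry _).continuous.comp (star (W l)).fst.continuous))
        continuous_id) ?_ ?_ ?_ x
    · simp only [map_zero, Finset.sum_const_zero]
    · intro x y hx hy
      simp only [map_add, Finset.sum_add_distrib, hx, hy]
    · intro a ξ η
      conv_rhs => rw [← hw a]
      simp only [hWs, Stab.aut_unit, ← Stab.unit_sum, hW, finsum_eq_sum_of_fintype]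

end StabCovering

/-! ### Stabilization of covering sequences -/

section StabSeq

variable {E : Type*} [NormedAddCommGroup E] [InnerProductSpace ℂ E] [CompleteSpace E]
  {H : Type*} [NormedAddCommGroup H] [InnerProductSpace ℂ H] [CompleteSpace H]

theorem Stab.aut_incl {A : Type*} [NonUnitalCStarAlgebra A] {At : Type*} [NonUnitalCStarAlgebra At]
    {ρ : A →⋆ₙₐ[ℂ] (E →L[ℂ] E)} {ρ' : At →⋆ₙₐ[ℂ] (E →L[ℂ] E)} (hρ : Function.Injective ρ)
    (hρ' : Function.Injective ρ') {f : A → At} (h : ∀ a, ρ' (f a) = ρ a)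
    {g : At ≃⋆ₐ[ℂ] At} {g' : A ≃⋆ₐ[ℂ] A} (hg : ∀ a, g (f a) = f (g' a)) (x : Stab H ρ) :
    Stab.aut H ρ' hρ' g (Stab.incl H ρ ρ' f h x) =
      Stab.incl H ρ ρ' f h (Stab.aut H ρ hρ g' x) := by
  refine Stab.induction (p := fun x => Stab.aut H ρ' hρ' g (Stab.incl H ρ ρ' f h x) =
    Stab.incl H ρ ρ' f h (Stab.aut H ρ hρ g' x)) (isClosed_eq
      ((StarAlgEquiv.isometry _).continuous.comp (map_continuous (Stab.incl H ρ ρ' f h)))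
      ((map_continuous (Stab.incl H ρ ρ' f h)).comp (StarAlgEquiv.isometry _).continuous))
      ?_ ?_ ?_ x
  · simp only [map_zero]
  · intro x y hx hy
    simp only [map_add, hx, hy]
  · intro a ξ η
    rw [Stab.incl_unit, Stab.aut_unit, Stab.aut_unit, Stab.incl_unit, hg]

/-- Conversely, `g ⊗ id` determines how `g` acts on a subalgebra. -/
theorem Stab.eq_of_aut_incl [Nontrivial H] {A : Type*} [NonUnitalCStarAlgebra A] {At : Type*}
    [NonUnitalCStarAlgebra At]
    {ρ : A →⋆ₙₐ[ℂ] (E →L[ℂ] E)} {ρ' : At →⋆ₙₐ[ℂ] (E →L[ℂ] E)} (hρ : Function.Injective ρ)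
    (hρ' : Function.Injective ρ') {f : A → At} (h : ∀ a, ρ' (f a) = ρ a)
    {g : At ≃⋆ₐ[ℂ] At} {g' : A ≃⋆ₐ[ℂ] A}
    (hg : ∀ x : Stab H ρ, Stab.aut H ρ' hρ' g (Stab.incl H ρ ρ' f h x) =
      Stab.incl H ρ ρ' f h (Stab.aut H ρ hρ g' x)) (a : A) : g (f a) = f (g' a) := by
  obtain ⟨e, he⟩ := exists_ne (0 : H)
  refine Stab.unit_injective hρ' he ?_
  have := hg (Stab.unit ρ a e e)
  rwa [Stab.incl_unit, Stab.aut_unit, Stab.aut_unit, Stab.incl_unit] at this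

namespace CovSeq

variable (S : CovSeq) {L : Type*} [NonUnitalCStarAlgebra L] (ι : ∀ n, S.A n →⋆ₙₐ[ℂ] L)
  (hι : S.IsInductiveLimit ι) (σ : L →⋆ₙₐ[ℂ] (E →L[ℂ] E))

theorem comp_injective (S : CovSeq) {L : Type*} [NonUnitalCStarAlgebra L]
    {ι : ∀ n, S.A n →⋆ₙₐ[ℂ] L} (hι : S.IsInductiveLimit ι) {σ : L →⋆ₙₐ[ℂ] (E →L[ℂ] E)}
    (hσ : Function.Injective σ) (n : ℕ) : Function.Injective (σ.comp (ι n)) :=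
  hσ.comp (hι.injective n)

/-- The stabilized sequence consists of coverings by `HasMultiplierFrame.stab`; its exact sequences
are the images of the original ones under `g ↦ g ⊗ id`. -/
theorem stab_isFiniteCoveringSeq [Nontrivial H] (hσ : Function.Injective σ)
    (hS : S.IsFiniteCoveringSeq) :
    (S.stab H ι hι σ).IsFiniteCoveringSeq := by
  have hinj : ∀ n, Function.Injective (σ.comp (ι n)) := S.comp_injective hι hσ
  have hc : ∀ {k m} (h : k ≤ m) (a : S.A k), σ.comp (ι m) (S.map h a) = σ.comp (ι k) a :=
    fun h => S.comp_compat hι σ h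
  -- intertwining relations for `A_l → A_m`
  have hint : ∀ {l m} (h : l ≤ m) {g : S.A m ≃⋆ₐ[ℂ] S.A m} {g' : S.A l ≃⋆ₐ[ℂ] S.A l},
      (∀ a, g (S.map h a) = S.map h (g' a)) → ∀ x : Stab H (σ.comp (ι l)),
      Stab.aut H _ (hinj m) g (Stab.incl H _ _ (S.map h) (hc h) x) =
        Stab.incl H _ _ (S.map h) (hc h) (Stab.aut H _ (hinj l) g' x) := fun h _ _ hg x =>
    Stab.aut_incl (hinj _) (hinj _) (hc h) hg x
  refine ⟨fun n => ?_, fun k m h => ?_, fun k l m hkl hlm γ hγ => ?_, fun k l m hkl hlm => ?_,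
    fun k l m hkl hlm γ hγ => ?_, fun k l m hkl hlm γ hγ => ?_, fun k l m hkl hlm γ hγ hfix => ?_,
    fun k l m hkl hlm γ hγ x => ?_⟩
  · change Stab.gal H _ (S.gal n n) = ⊥
    rw [hS.gal_self, Stab.gal_eq_map (hinj n), Subgroup.map_bot]
  · exact ((hS.covering k m h).hasMultiplierFrame.stab _ _ (hinj m) (hc h.le)).isFiniteCovering
  · obtain ⟨g, hg, rfl⟩ := (Stab.mem_gal (hinj m)).1 hγ
    obtain ⟨g', hg', hgg⟩ := hS.restrict k l m hkl hlm g hg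
    have hx := hint hlm.le hgg
    apply Set.Subset.antisymm
    · rintro _ ⟨_, ⟨x, rfl⟩, rfl⟩
      exact ⟨_, (hx x).symm⟩
    · rintro _ ⟨x, rfl⟩
      obtain ⟨y, rfl⟩ := EquivLike.surjective (Stab.aut H _ (hinj l) g') x
      exact ⟨_, ⟨y, rfl⟩, hx y⟩
  · change Stab.gal H _ (S.gal l m) ≤ Stab.gal H _ (S.gal k m)
    rw [Stab.gal_eq_map (hinj m), Stab.gal_eq_map (hinj m)]
    exact Subgroup.map_mono (hS.le k l m hkl hlm)
  · obtain ⟨g, hg, rfl⟩ := (Stab.mem_gal (hinj m)).1 hγ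
    obtain ⟨g', hg', hgg⟩ := hS.restrict k l m hkl hlm g hg
    exact ⟨_, (Stab.mem_gal (hinj l)).2 ⟨g', hg', rfl⟩, hint hlm.le hgg⟩
  · obtain ⟨g', hg', rfl⟩ := (Stab.mem_gal (hinj l)).1 hγ
    obtain ⟨g, hg, hgg⟩ := hS.extend k l m hkl hlm g' hg'
    exact ⟨_, (Stab.mem_gal (hinj m)).2 ⟨g, hg, rfl⟩, hint hlm.le hgg⟩
  · obtain ⟨g, hg, rfl⟩ := (Stab.mem_gal (hinj m)).1 hγ
    refine (Stab.mem_gal (hinj m)).2 ⟨g, hS.ker k l m hkl hlm g hg fun a => ?_, rfl⟩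
    refine Stab.eq_of_aut_incl (H := H) (hinj l) (hinj m) (hc hlm.le) (g' := 1) (fun x => ?_) a
    rw [map_one]
    exact hfix x
  · obtain ⟨g, hg, rfl⟩ := (Stab.mem_gal (hinj m)).1 hγ
    have := hint hlm.le (g' := 1) (hS.fixes k l m hkl hlm g hg) x
    rwa [map_one] at this

theorem stab_isInductiveLimit : (S.stab H ι hι σ).IsInductiveLimit (S.stabι H ι hι σ) := by
  refine ⟨fun h x => Stab.toOp_injective σ ?_, fun n => Stab.incl_injective _ _ _ _, fun x => ?_⟩
  · exact (Stab.toOp_incl _ _ _ _ _).trans ((Stab.toOp_incl _ _ _ _ _).trans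
      (Stab.toOp_incl _ _ _ _ _).symm)
  · have hmono : ∀ {k m}, k ≤ m →
        Set.range (S.stabι H ι hι σ k) ⊆ Set.range (S.stabι H ι hι σ m) := by
      rintro k m h _ ⟨x, rfl⟩
      refine ⟨(S.stab H ι hι σ).map h x, Stab.toOp_injective σ ?_⟩
      exact (Stab.toOp_incl _ _ _ _ _).trans ((Stab.toOp_incl _ _ _ _ _).trans
        (Stab.toOp_incl _ _ _ _ _).symm)
    refine Stab.induction (p := fun x => x ∈ closure (⋃ n, Set.range (S.stabι H ι hι σ n)))
      isClosed_closure (subset_closure (Set.mem_iUnion.2 ⟨0, 0, map_zero _⟩)) ?_ ?_ x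
    · intro x y hx hy
      refine map_mem_closure₂ continuous_add hx hy fun x hx y hy => ?_
      obtain ⟨k, hk⟩ := Set.mem_iUnion.1 hx
      obtain ⟨m, hm⟩ := Set.mem_iUnion.1 hy
      obtain ⟨x', rfl⟩ := hmono (le_max_left k m) hk
      obtain ⟨y', rfl⟩ := hmono (le_max_right k m) hm
      exact Set.mem_iUnion.2 ⟨max k m, x' + y', map_add _ _ _⟩
    · intro a ξ η
      have hcont : Continuous fun a : L => Stab.unit (H := H) σ a ξ η := by
        rw [(Stab.isometry_toOp σ).isEmbedding.continuous_iff]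
        exact (continuous_opTensor_left _).comp (map_continuous σ)
      refine map_mem_closure (f := fun a => Stab.unit (H := H) σ a ξ η) hcont (hι.dense a)
        fun b hb => ?_
      obtain ⟨n, c, rfl⟩ := Set.mem_iUnion.1 hb
      exact Set.mem_iUnion.2 ⟨n, Stab.unit (σ.comp (ι n)) c ξ η, Stab.incl_unit _ _ _ _ _ _ _⟩

variable (H) in
/-- The isomorphism `g ↦ g ⊗ id` of `G(A_n | A)` onto the corresponding group of the stabilized
sequence. -/
noncomputable def stabGalEquiv [Nontrivial H] (hσ : Function.Injective σ) (n : ℕ) :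
    S.gal 0 n ≃* (S.stab H ι hι σ).gal 0 n :=
  Stab.galEquiv H (S.comp_injective hι hσ n) (S.gal 0 n)

theorem stabGalEquiv_mem_limGal [Nontrivial H] (hσ : Function.Injective σ)
    (g : ∀ n, S.gal 0 n) :
    (fun n => S.stabGalEquiv H ι hι σ hσ n (g n)) ∈ (S.stab H ι hι σ).limGal ↔
      g ∈ S.limGal := by
  refine ⟨fun hg k m h a => ?_, fun hg k m h x => ?_⟩
  · exact Stab.eq_of_aut_incl (H := H) (S.comp_injective hι hσ k)
      (S.comp_injective hι hσ m) (S.comp_compat hι σ h) (fun x => hg k m h x) a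
  · exact Stab.aut_incl (S.comp_injective hι hσ k) (S.comp_injective hι hσ m)
      (S.comp_compat hι σ h) (hg k m h) x

variable (H) in
/-- The homomorphism `g ↦ g ⊗ id` from `Ĝ` to the projective limit of the groups of the stabilized
sequence. -/
noncomputable def stabLimGalHom [Nontrivial H] (hσ : Function.Injective σ) :
    S.LimGal →* (S.stab H ι hι σ).LimGal where
  toFun g := ⟨fun n => S.stabGalEquiv H ι hι σ hσ n (g.1 n),
        (S.stabGalEquiv_mem_limGal ι hι σ hσ g.1).2 g.2⟩
  map_one' := Subtype.ext (funext fun n => (S.stabGalEquiv H ι hι σ hσ n).map_one)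
  map_mul' _ _ := Subtype.ext (funext fun n => (S.stabGalEquiv H ι hι σ hσ n).map_mul _ _)

theorem stabLimGalHom_bijective [Nontrivial H] (hσ : Function.Injective σ) :
    Function.Bijective (S.stabLimGalHom H ι hι σ hσ) := by
  refine ⟨fun _ _ hgh => Subtype.ext (funext fun n =>
    (S.stabGalEquiv H ι hι σ hσ n).injective (congrFun (congrArg Subtype.val hgh) n)), fun γ => ?_⟩
  have hγ : (fun n => S.stabGalEquiv H ι hι σ hσ n
      ((S.stabGalEquiv H ι hι σ hσ n).symm (γ.1 n))) = γ.1 :=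
    funext fun n => (S.stabGalEquiv H ι hι σ hσ n).apply_symm_apply _
  exact ⟨⟨fun n => (S.stabGalEquiv H ι hι σ hσ n).symm (γ.1 n),
    (S.stabGalEquiv_mem_limGal ι hι σ hσ _).1 (hγ ▸ γ.2)⟩, Subtype.ext hγ⟩

variable (H) in
/-- The isomorphism of `Ĝ` onto the projective limit of the groups of the stabilized sequence. -/
noncomputable def stabLimGal [Nontrivial H] (hσ : Function.Injective σ) :
    S.LimGal ≃* (S.stab H ι hι σ).LimGal :=
  MulEquiv.ofBijective (S.stabLimGalHom H ι hι σ hσ) (S.stabLimGalHom_bijective ι hι σ hσ)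

theorem proj_stabLimGal [Nontrivial H] (hσ : Function.Injective σ) (g : S.LimGal) (n : ℕ) :
    ((S.stab H ι hι σ).proj n (S.stabLimGal H ι hι σ hσ g) :
      (S.stab H ι hι σ).A n ≃⋆ₐ[ℂ] (S.stab H ι hι σ).A n) =
      Stab.aut H _ (S.comp_injective hι hσ n) (S.proj n g) := rfl

end CovSeq

end StabSeq

/-! ### Functional calculus and intertwining operators -/

section Intertwine

variable {F : Type*} [NormedAddCommGroup F] [InnerProductSpace ℂ F] [CompleteSpace F]
  {G : Type*} [NormedAddCommGroup G] [InnerProductSpace ℂ G] [CompleteSpace G]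

theorem comp_aeval_of_intertwines (x : F →L[ℂ] G) {a : F →L[ℂ] F} {b : G →L[ℂ] G}
    (h : x ∘L a = b ∘L x) (p : Polynomial ℝ) :
    x ∘L Polynomial.aeval a p = Polynomial.aeval b p ∘L x := by
  have hpow : ∀ n : ℕ, x ∘L (a ^ n) = (b ^ n) ∘L x := by
    intro n
    induction n with
    | zero => ext; simp
    | succ n ih =>
      rw [pow_succ, pow_succ, ContinuousLinearMap.mul_def, ContinuousLinearMap.mul_def,
        ← ContinuousLinearMap.comp_assoc, ih, ContinuousLinearMap.comp_assoc, h,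
        ContinuousLinearMap.comp_assoc]
  induction p using Polynomial.induction_on' with
  | add p q hp hq =>
    rw [map_add, map_add, ContinuousLinearMap.comp_add, ContinuousLinearMap.add_comp, hp, hq]
  | monomial n r =>
    rw [Polynomial.aeval_monomial, Polynomial.aeval_monomial, Algebra.algebraMap_eq_smul_one,
      Algebra.algebraMap_eq_smul_one, smul_one_mul, smul_one_mul]
    ext ξ
    have := congrArg (fun f : F →L[ℂ] G => f ξ) (hpow n)
    simp only [ContinuousLinearMap.comp_apply, smul_apply] at this ⊢
    rw [← this]
    exact map_real_smul x x.continuous r _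

theorem norm_cfc_sub_aeval_le {a : F →L[ℂ] F} (ha : IsSelfAdjoint a) {f : ℝ → ℝ}
    (hf : Continuous f) (p : Polynomial ℝ) {ε : ℝ} (hε : 0 ≤ ε)
    (hp : ∀ t ∈ spectrum ℝ a, |p.eval t - f t| ≤ ε) :
    ‖cfc f a - Polynomial.aeval a p‖ ≤ ε := by
  rw [← cfc_polynomial p a ha, ← cfc_sub f (fun t => p.eval t) a hf.continuousOn
    p.continuous.continuousOn]
  refine norm_cfc_le hε fun t ht => ?_
  rw [Real.norm_eq_abs, abs_sub_comm]
  exact hp t ht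

/-- An operator that intertwines two self-adjoint operators intertwines all continuous functions
of them. -/
theorem comp_cfc_of_intertwines (x : F →L[ℂ] G) {a : F →L[ℂ] F} {b : G →L[ℂ] G}
    (ha : IsSelfAdjoint a) (hb : IsSelfAdjoint b) (h : x ∘L a = b ∘L x) {f : ℝ → ℝ}
    (hf : Continuous f) : x ∘L cfc f a = cfc f b ∘L x := by
  refine eq_of_dist_eq_zero (le_antisymm (le_of_forall_pos_le_add fun δ hδ => ?_) dist_nonneg)
  set R : ℝ := max (‖a‖ * ‖(1 : F →L[ℂ] F)‖) (‖b‖ * ‖(1 : G →L[ℂ] G)‖)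
  set ε : ℝ := δ / (2 * (‖x‖ + 1))
  have hε : 0 < ε := by positivity
  obtain ⟨p, hp⟩ := exists_polynomial_near_of_continuousOn (-R) R f hf.continuousOn ε hε
  have ha' : ‖cfc f a - Polynomial.aeval a p‖ ≤ ε :=
    norm_cfc_sub_aeval_le ha hf p hε.le fun t ht => (hp t (abs_le.1
      ((spectrum.norm_le_norm_mul_of_mem ht).trans (le_max_left _ _)))).le
  have hb' : ‖cfc f b - Polynomial.aeval b p‖ ≤ ε :=
    norm_cfc_sub_aeval_le hb hf p hε.le fun t ht => (hp t (abs_le.1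
      ((spectrum.norm_le_norm_mul_of_mem ht).trans (le_max_right _ _)))).le
  have key : x ∘L cfc f a - cfc f b ∘L x =
      x ∘L (cfc f a - Polynomial.aeval a p) - (cfc f b - Polynomial.aeval b p) ∘L x := by
    rw [ContinuousLinearMap.comp_sub, ContinuousLinearMap.sub_comp,
      comp_aeval_of_intertwines x h p]
    abel
  rw [dist_eq_norm, key, zero_add]
  calc _ ≤ ‖x‖ * ε + ε * ‖x‖ := (norm_sub_le _ _).trans (add_le_add
        ((ContinuousLinearMap.opNorm_comp_le _ _).trans (by gcongr))
        ((ContinuousLinearMap.opNorm_comp_le _ _).trans (by gcongr)))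
    _ ≤ 2 * (‖x‖ + 1) * ε := by nlinarith [norm_nonneg x]
    _ = δ := by simp only [ε]; field_simp

/-- `f(y y*) = y k(y* y) y*` for `f(s) = s k(s)`. -/
theorem cfc_comp_adjoint (y : F →L[ℂ] G) {f k : ℝ → ℝ} (hk : Continuous k)
    (hf : ∀ s, f s = s * k s) : cfc f (y ∘L y†) = y ∘L cfc k (y† ∘L y) ∘L y† := by
  have ha : IsSelfAdjoint (y† ∘L y) :=
    (ContinuousLinearMap.isPositive_adjoint_comp_self y).isSelfAdjoint
  have hb : IsSelfAdjoint (y ∘L y†) :=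
    (ContinuousLinearMap.isPositive_self_comp_adjoint y).isSelfAdjoint
  have h := comp_cfc_of_intertwines (y†) hb ha rfl hk
  rw [funext hf, cfc_mul (fun s => s) k _ continuousOn_id hk.continuousOn, cfc_id' ℝ (y ∘L y†),
    ← h]
  rfl

end Intertwine

/-! ### Strongly convergent sums over a group of unitaries -/

section StrongSum

variable {F : Type*} [NormedAddCommGroup F] [InnerProductSpace ℂ F] [CompleteSpace F]
  {G : Type*} [NormedAddCommGroup G] [InnerProductSpace ℂ G] [CompleteSpace G] {Γ : Type*}

/-- The series `∑_g u_g x u_g*` is strongly convergent with sum `s`. -/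
def IsStrongSum (u : Γ → unitary (F →L[ℂ] F)) (x s : F →L[ℂ] F) : Prop :=
  ∀ ξ : F, HasSum (fun g => ((u g : F →L[ℂ] F) * x * star (u g : F →L[ℂ] F)) ξ) (s ξ)

theorem IsStrongSum.unique {u : Γ → unitary (F →L[ℂ] F)} {x s s' : F →L[ℂ] F}
    (h : IsStrongSum u x s) (h' : IsStrongSum u x s') : s = s' :=
  ContinuousLinearMap.ext fun ξ => (h ξ).unique (h' ξ)

/-- Compression by operators intertwining two families of unitaries preserves strong sums. -/
theorem IsStrongSum.comp {u : Γ → unitary (F →L[ℂ] F)} {v : Γ → unitary (G →L[ℂ] G)}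
    {x s : F →L[ℂ] F} (h : IsStrongSum u x s) (P : F →L[ℂ] G) (Q : G →L[ℂ] F)
    (hP : ∀ g, P ∘L (u g : F →L[ℂ] F) = (v g : G →L[ℂ] G) ∘L P)
    (hQ : ∀ g, (u g : F →L[ℂ] F) ∘L Q = Q ∘L (v g : G →L[ℂ] G)) :
    IsStrongSum v (P ∘L x ∘L Q) (P ∘L s ∘L Q) := by
  intro ζ
  have := (h (Q ζ)).mapL P
  refine this.congr_fun fun g => ?_
  have hQ' : Q (star (v g : G →L[ℂ] G) ζ) = star (u g : F →L[ℂ] F) (Q ζ) := by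
    have h1 : (u g : F →L[ℂ] F) (Q (star (v g : G →L[ℂ] G) ζ)) = Q ζ := by
      have := congrArg (fun f : G →L[ℂ] F => f (star (v g : G →L[ℂ] G) ζ)) (hQ g)
      refine this.trans ?_
      change Q (((v g : G →L[ℂ] G) * star (v g : G →L[ℂ] G)) ζ) = _
      rw [Unitary.mul_star_self_of_mem (v g).2]; rfl
    rw [← h1]
    change _ = (star (u g : F →L[ℂ] F) * (u g : F →L[ℂ] F)) _
    rw [Unitary.star_mul_self_of_mem (u g).2]; rfl
  have hP' := congrArg (fun f : F →L[ℂ] G => f (x (Q (star (v g : G →L[ℂ] G) ζ)))) (hP g)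
  refine hP'.symm.trans ?_
  change P ((u g : F →L[ℂ] F) (x (Q _))) = P ((u g : F →L[ℂ] F) (x _))
  rw [hQ']
  rfl

theorem IsStrongSum.mul {u : Γ → unitary (F →L[ℂ] F)} {x s : F →L[ℂ] F} (h : IsStrongSum u x s)
    {P Q : F →L[ℂ] F} (hP : ∀ g, Commute P (u g : F →L[ℂ] F))
    (hQ : ∀ g, Commute Q (u g : F →L[ℂ] F)) : IsStrongSum u (P * x * Q) (P * s * Q) :=
  h.comp P Q (fun g => (hP g).eq) (fun g => (hQ g).eq.symm)

/-- The Cauchy–Schwarz inequality for the form of a positive operator `T` bounded by `M`. -/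
theorem norm_apply_sq_le_of_nonneg {T : F →L[ℂ] F} (hT : 0 ≤ T) {M : ℝ} (hM : 0 ≤ M)
    (h : ∀ ξ, (inner ℂ ξ (T ξ)).re ≤ M * ‖ξ‖ ^ 2) (ξ : F) :
    ‖T ξ‖ ^ 2 ≤ M * (inner ℂ ξ (T ξ)).re := by
  set r := CFC.sqrt T
  have hr : 0 ≤ r := CFC.sqrt_nonneg T
  have hrr : r * r = T := CFC.sqrt_mul_sqrt_self T hT
  have hsa : star r = r := hr.isSelfAdjoint
  have h1 : ∀ ξ, (inner ℂ ξ (T ξ)).re = ‖r ξ‖ ^ 2 := by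
    intro ξ
    rw [← hrr, InnerProductSpace.norm_sq_eq_re_inner (𝕜 := ℂ)]
    change (inner ℂ ξ (r (r ξ))).re = (inner ℂ (r ξ) (r ξ)).re
    rw [← ContinuousLinearMap.adjoint_inner_left, ← ContinuousLinearMap.star_eq_adjoint, hsa]
  have h2 : ‖r‖ ≤ √M := by
    refine ContinuousLinearMap.opNorm_le_bound _ (Real.sqrt_nonneg _) fun ξ => ?_
    refine abs_le_of_sq_le_sq' ?_ (by positivity) |>.2
    rw [← h1, mul_pow, Real.sq_sqrt hM]
    exact h ξ
  have h3 : ‖T ξ‖ ≤ ‖r‖ * ‖r ξ‖ := by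
    rw [← hrr]; exact r.le_opNorm _
  rw [h1]
  calc ‖T ξ‖ ^ 2 ≤ (√M * ‖r ξ‖) ^ 2 := by gcongr; exact h3.trans (by gcongr)
    _ = _ := by rw [mul_pow, Real.sq_sqrt hM]

theorem re_inner_mono {T T' : F →L[ℂ] F} (h : T ≤ T') (ξ : F) :
    (inner ℂ ξ (T ξ)).re ≤ (inner ℂ ξ (T' ξ)).re := by
  have := ((ContinuousLinearMap.le_def _ _).1 h).re_inner_nonneg_right ξ
  rw [sub_apply, inner_sub_right, map_sub] at this
  exact sub_nonneg.1 this

/-- If `0 ≤ t ≤ C a` and the series of `a` converges strongly, so does the series of `t`. -/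
theorem IsStrongSum.exists_of_le {u : Γ → unitary (F →L[ℂ] F)} {a s t : F →L[ℂ] F}
    (h : IsStrongSum u a s) (ha : 0 ≤ a) (ht : 0 ≤ t) {C : ℝ} (hC : 0 ≤ C) (hta : t ≤ C • a) :
    ∃ T, IsStrongSum u t T := by
  let c : Γ → (F →L[ℂ] F) → F →L[ℂ] F := fun g x => (u g : F →L[ℂ] F) * x * star (u g : F →L[ℂ] F)
  have hc0 : ∀ g {x}, 0 ≤ x → 0 ≤ c g x := fun g x hx => star_right_conjugate_nonneg hx _
  -- the quadratic forms of the partial sums are dominated by that of `s`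
  have hsum : ∀ ξ, HasSum (fun g => (inner ℂ ξ (c g a ξ)).re) (inner ℂ ξ (s ξ)).re := fun ξ =>
    Complex.reCLM.hasSum ((innerSL ℂ ξ).hasSum (h ξ))
  have hpos : ∀ g ξ, 0 ≤ (inner ℂ ξ (c g a ξ)).re := fun g ξ => by
    simpa using re_inner_mono (hc0 g ha) ξ
  have hle : ∀ (K : Finset Γ) ξ, (inner ℂ ξ ((∑ g ∈ K, c g t) ξ)).re ≤
      C * ∑ g ∈ K, (inner ℂ ξ (c g a ξ)).re := by
    intro K ξ
    have h1 : ∑ g ∈ K, c g t ≤ C • ∑ g ∈ K, c g a := by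
      rw [Finset.smul_sum]
      refine Finset.sum_le_sum fun g _ => (star_right_conjugate_le_conjugate hta _).trans_eq ?_
      simp only [c, mul_smul_comm, smul_mul_assoc]
    refine (re_inner_mono h1 ξ).trans_eq ?_
    rw [smul_apply, sum_apply, ← Complex.coe_smul, inner_smul_right, inner_sum,
      Complex.re_ofReal_mul, Complex.re_sum]
  have hbound : ∀ (K : Finset Γ) ξ, ‖(∑ g ∈ K, c g t) ξ‖ ^ 2 ≤
      C * ‖s‖ * (C * ∑ g ∈ K, (inner ℂ ξ (c g a ξ)).re) := by
    intro K ξ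
    refine (norm_apply_sq_le_of_nonneg (Finset.sum_nonneg fun g _ => hc0 g ht) (M := C * ‖s‖)
      (by positivity) (fun ζ => ?_) ξ).trans (mul_le_mul_of_nonneg_left (hle K ξ) (by positivity))
    refine (hle K ζ).trans ?_
    rw [mul_assoc]
    refine mul_le_mul_of_nonneg_left ((sum_le_hasSum K (fun g _ => hpos g ζ) (hsum ζ)).trans ?_) hC
    calc _ ≤ ‖inner ℂ ζ (s ζ)‖ := Complex.re_le_norm _
      _ ≤ ‖ζ‖ * ‖s ζ‖ := norm_inner_le_norm _ _
      _ ≤ ‖ζ‖ * (‖s‖ * ‖ζ‖) := by gcongr; exact s.le_opNorm _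
      _ = _ := by ring
  have hsumm : ∀ ξ, Summable fun g => c g t ξ := by
    intro ξ
    rw [summable_iff_vanishing_norm]
    intro ε hε
    set D := C * ‖s‖ * C
    have hD : 0 ≤ D := by positivity
    obtain ⟨K, hK⟩ := summable_iff_vanishing_norm.1 (hsum ξ).summable (ε ^ 2 / (D + 1))
      (by positivity)
    refine ⟨K, fun K' hK' => ?_⟩
    have h1 := hbound K' ξ
    rw [sum_apply] at h1
    have h2 := hK K' hK'
    rw [Real.norm_of_nonneg (Finset.sum_nonneg fun g _ => hpos g ξ)] at h2
    refine lt_of_pow_lt_pow_left₀ 2 hε.le (h1.trans_lt ?_)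
    rw [← mul_assoc, lt_div_iff₀ (by positivity)] at *
    have h3 := Finset.sum_nonneg fun g (_ : g ∈ K') => hpos g ξ
    nlinarith
  let T₀ : F →ₗ[ℂ] F :=
    { toFun := fun ξ => ∑' g, c g t ξ
      map_add' := fun ξ ζ => by simp only [map_add]; exact (hsumm ξ).tsum_add (hsumm ζ)
      map_smul' := fun r ξ => by simp only [map_smul]; exact (hsumm ξ).tsum_const_smul r }
  refine ⟨T₀.mkContinuous (C * ‖s‖) fun ξ => ?_, fun ξ => (hsumm ξ).hasSum⟩
  refine le_of_tendsto (hsumm ξ).hasSum.norm (Eventually.of_forall fun K => ?_)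
  have h1 := hbound K ξ
  rw [sum_apply] at h1
  refine abs_le_of_sq_le_sq' (h1.trans ?_) (by positivity) |>.2
  have h2 : ∑ g ∈ K, (inner ℂ ξ (c g a ξ)).re ≤ ‖s‖ * ‖ξ‖ ^ 2 := by
    refine (sum_le_hasSum K (fun g _ => hpos g ξ) (hsum ξ)).trans ?_
    calc _ ≤ ‖inner ℂ ξ (s ξ)‖ := Complex.re_le_norm _
      _ ≤ ‖ξ‖ * ‖s ξ‖ := norm_inner_le_norm _ _
      _ ≤ ‖ξ‖ * (‖s‖ * ‖ξ‖) := by gcongr; exact s.le_opNorm _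
      _ = _ := by ring
  calc _ ≤ C * ‖s‖ * (C * (‖s‖ * ‖ξ‖ ^ 2)) := by gcongr
    _ = _ := by ring

end StrongSum

/-! ### Special elements and stabilization -/

section Special

variable {F : Type*} [NormedAddCommGroup F] [InnerProductSpace ℂ F] [CompleteSpace F]
  {G : Type*} [NormedAddCommGroup G] [InnerProductSpace ℂ G] [CompleteSpace G]
  {H : Type*} [NormedAddCommGroup H] [InnerProductSpace ℂ H] [CompleteSpace H]
  {Γ : Type*}

theorem ampUnitary_coe (u : unitary (F →L[ℂ] F)) :
    (ampUnitary H u : HTensor F H →L[ℂ] HTensor F H) = opTensor (u : F →L[ℂ] F) 1 := rfl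

theorem tensorRight_comp_eq_ampUnitary_comp (u : unitary (F →L[ℂ] F)) (η : H) :
    tensorRight F η ∘L (u : F →L[ℂ] F) =
      (ampUnitary H u : HTensor F H →L[ℂ] HTensor F H) ∘L tensorRight F η := by
  rw [ampUnitary_coe, opTensor_comp_tensorRight]
  rfl

theorem comp_adjoint_tensorRight (u : unitary (F →L[ℂ] F)) (η : H) :
    (u : F →L[ℂ] F) ∘L (tensorRight F η)† =
      (tensorRight F η)† ∘L (ampUnitary H u : HTensor F H →L[ℂ] HTensor F H) := by
  rw [ampUnitary_coe, adjoint_tensorRight_comp_opTensor, ← ContinuousLinearMap.star_eq_adjoint,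
    star_one]
  rfl

theorem commute_ampUnitary_of_mem_stabAlg {M : NonUnitalStarSubalgebra ℂ (F →L[ℂ] F)}
    {u : unitary (F →L[ℂ] F)} (h : ∀ x ∈ M, Commute x (u : F →L[ℂ] F))
    {z : HTensor F H →L[ℂ] HTensor F H} (hz : z ∈ stabAlg H M) :
    Commute z (ampUnitary H u : HTensor F H →L[ℂ] HTensor F H) := by
  refine stabAlg_induction
    (p := fun z => Commute z (ampUnitary H u : HTensor F H →L[ℂ] HTensor F H)) ?_
    (Commute.zero_left _) (fun S T hS hT => hS.add_left hT) (fun x hx ξ η => ?_) hz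
  · exact isClosed_eq (continuous_mul_const _) (continuous_const_mul _)
  · change _ * _ = _ * _
    rw [ampUnitary_coe, ← opTensor_mul, ← opTensor_mul, (h x hx).eq, mul_one, one_mul]

/-- Two ways of compressing an operator series. If `v : F → G` and `w = (v* v)^{1/2}`, then the
series of `f(v a v*)` and of `f(w a w)` are the compressions by `v` and by `w` of the series of one
operator `t = a^{1/2} k(a^{1/2} w² a^{1/2}) a^{1/2}` dominated by `a`, for `f(s) = s k(s)`. -/
theorem exists_strongSum_cfc {u : Γ → unitary (F →L[ℂ] F)} {u' : Γ → unitary (G →L[ℂ] G)}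
    {a s : F →L[ℂ] F} (ha : 0 ≤ a) (has : IsStrongSum u a s)
    {v : F →L[ℂ] G} {w : F →L[ℂ] F} (hw : IsSelfAdjoint w) (hvw : v† ∘L v = w * w)
    (hv : ∀ g, v ∘L (u g : F →L[ℂ] F) = (u' g : G →L[ℂ] G) ∘L v)
    (hv' : ∀ g, (u g : F →L[ℂ] F) ∘L v† = v† ∘L (u' g : G →L[ℂ] G))
    (hwu : ∀ g, Commute w (u g : F →L[ℂ] F))
    {f k : ℝ → ℝ} (hk : Continuous k) (hk0 : ∀ s, 0 ≤ s → 0 ≤ k s) (hf : ∀ s, f s = s * k s) :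
    ∃ T, IsStrongSum u (cfc f (w * a * star w)) (w * T * w) ∧
      IsStrongSum u' (cfc f (v ∘L a ∘L v†)) (v ∘L T ∘L v†) := by
  set r := CFC.sqrt a
  have hr : star r = r := (CFC.sqrt_nonneg a).isSelfAdjoint
  have hr' : r† = r := hr
  have hrr : r ∘L r = a := CFC.sqrt_mul_sqrt_self a ha
  set b := r * (w * w) * r
  have hb : 0 ≤ b := by
    have h1 : 0 ≤ w * w := by
      have := star_mul_self_nonneg w
      rwa [hw.star_eq] at this
    have := star_left_conjugate_nonneg h1 r
    rwa [hr] at this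
  set K := cfc k b
  have hK : 0 ≤ K := cfc_nonneg fun t ht => hk0 t (spectrum_nonneg_of_nonneg hb ht)
  set t := r * K * r
  have ht : 0 ≤ t := by
    have := star_left_conjugate_nonneg hK r
    rwa [hr] at this
  have hta : t ≤ ‖K‖ • a := by
    have h1 : K ≤ algebraMap ℝ _ ‖K‖ := IsSelfAdjoint.le_algebraMap_norm_self hK.isSelfAdjoint
    have := star_left_conjugate_le_conjugate h1 r
    rw [hr, Algebra.algebraMap_eq_smul_one, mul_smul_comm, mul_one, smul_mul_assoc] at this
    exact this.trans_eq (congrArg (‖K‖ • ·) hrr)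
  obtain ⟨T, hT⟩ := has.exists_of_le ha ht (norm_nonneg K) hta
  have hv1 : cfc f (v ∘L a ∘L v†) = v ∘L t ∘L v† := by
    have := cfc_comp_adjoint (v ∘L r) hk hf
    rw [ContinuousLinearMap.adjoint_comp, hr'] at this
    have h2 : (r ∘L v†) ∘L v ∘L r = b := by
      rw [ContinuousLinearMap.comp_assoc, ← ContinuousLinearMap.comp_assoc (v†), hvw]; rfl
    rw [h2] at this
    have h3 : (v ∘L r) ∘L r ∘L v† = v ∘L a ∘L v† := by rw [← hrr]; rfl
    rw [h3] at this
    rw [this]; rfl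
  have hw1 : cfc f (w * a * star w) = w * t * w := by
    have := cfc_comp_adjoint (w ∘L r) hk hf
    have hw' : w† = w := hw
    rw [ContinuousLinearMap.adjoint_comp, hr', hw'] at this
    have h3 : (w ∘L r) ∘L r ∘L w = w * a * star w := by rw [← hrr, hw.star_eq]; rfl
    rw [h3] at this
    exact this
  refine ⟨T, ?_, ?_⟩
  · rw [hw1]; exact hT.mul hwu hwu
  · rw [hv1]; exact hT.comp _ _ hv hv'

theorem norm_comp_eq_of_adjoint_comp_self {v : F →L[ℂ] G} {w : F →L[ℂ] F} (hw : IsSelfAdjoint w)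
    (hvw : v† ∘L v = w * w) {G' : Type*} [NormedAddCommGroup G'] [InnerProductSpace ℂ G']
    (x : G' →L[ℂ] F) : ‖v ∘L x‖ = ‖w ∘L x‖ := by
  have h : ∀ ξ, ‖v ξ‖ = ‖w ξ‖ := fun ξ => by
    refine (sq_eq_sq₀ (norm_nonneg _) (norm_nonneg _)).1 ?_
    rw [InnerProductSpace.norm_sq_eq_re_inner (𝕜 := ℂ),
      InnerProductSpace.norm_sq_eq_re_inner (𝕜 := ℂ),
      ← ContinuousLinearMap.adjoint_inner_left, ← ContinuousLinearMap.adjoint_inner_left,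
      ← ContinuousLinearMap.star_eq_adjoint w, hw.star_eq]
    exact congrArg (fun f : F →L[ℂ] F => RCLike.re (inner ℂ (f ξ) ξ)) hvw
  exact ContinuousLinearMap.opNorm_ext _ _ fun ξ => h _

theorem norm_comp_comp_adjoint_eq {v : F →L[ℂ] G} {w : F →L[ℂ] F} (hw : IsSelfAdjoint w)
    (hvw : v† ∘L v = w * w) (q : F →L[ℂ] F) : ‖v ∘L q ∘L v†‖ = ‖w * q * w‖ := by
  have hw' : w† = w := hw
  have h : ‖w ∘L q ∘L v†‖ = ‖v ∘L q† ∘L w‖ := by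
    rw [← LinearIsometryEquiv.norm_map ContinuousLinearMap.adjoint,
      ContinuousLinearMap.adjoint_comp,
      ContinuousLinearMap.adjoint_comp, ContinuousLinearMap.adjoint_adjoint, hw']
    rfl
  rw [norm_comp_eq_of_adjoint_comp_self hw hvw, h, norm_comp_eq_of_adjoint_comp_self hw hvw,
    ← LinearIsometryEquiv.norm_map ContinuousLinearMap.adjoint, ContinuousLinearMap.adjoint_comp,
      ContinuousLinearMap.adjoint_comp, ContinuousLinearMap.adjoint_adjoint, hw']
  rfl

/-- A self-adjoint `w` in a C*-algebra is a limit of elements `w x w`. -/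
theorem exists_norm_sub_mul_mul_lt {M : NonUnitalStarSubalgebra ℂ (F →L[ℂ] F)}
    (hM : IsClosed (M : Set (F →L[ℂ] F))) {w : F →L[ℂ] F} (hwM : w ∈ M) (hw : IsSelfAdjoint w)
    {ε : ℝ} (hε : 0 < ε) : ∃ x ∈ M, ‖w - w * x * w‖ < ε := by
  -- `t - t k(t) t = δ t / (t² + δ)` is bounded by `ε / 2` for `k(t) = t / (t² + δ)` and `δ = ε²`
  set δ := ε ^ 2
  have hδ : 0 < δ := by positivity
  have hne : ∀ t : ℝ, t ^ 2 + δ ≠ 0 := fun t => by positivity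
  have hcont : Continuous fun t : ℝ => t / (t ^ 2 + δ) := continuous_id.div (by fun_prop) hne
  have := hM
  refine ⟨cfc (fun t : ℝ => t / (t ^ 2 + δ)) w, ?_, ?_⟩
  · rw [← cfcₙ_eq_cfc hcont.continuousOn (by simp)]
    exact cfcₙ_mem (𝕜' := ℂ) _ hwM
  · have h1 : w - w * cfc (fun t : ℝ => t / (t ^ 2 + δ)) w * w =
        cfc (fun t : ℝ => t - t * (t / (t ^ 2 + δ)) * t) w := by
      rw [cfc_sub (fun t : ℝ => t) (fun t => t * (t / (t ^ 2 + δ)) * t) w continuousOn_id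
          ((continuous_id.mul hcont).mul continuous_id).continuousOn,
        cfc_mul (fun t : ℝ => t * (t / (t ^ 2 + δ))) (fun t => t) w
          (continuous_id.mul hcont).continuousOn continuousOn_id,
        cfc_mul (fun t : ℝ => t) (fun t => t / (t ^ 2 + δ)) w continuousOn_id hcont.continuousOn,
        cfc_id' ℝ w]
    rw [h1]
    refine (norm_cfc_le (c := ε / 2) (by positivity) fun t _ => ?_).trans_lt (by linarith)
    have h2 : t - t * (t / (t ^ 2 + δ)) * t = δ * t / (t ^ 2 + δ) := by
      field_simp [hne t]; ring
    rw [h2, Real.norm_eq_abs, abs_div, abs_of_pos (show 0 < t ^ 2 + δ by positivity), abs_mul,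
      abs_of_pos hδ, div_le_iff₀ (by positivity)]
    simp only [δ]
    nlinarith [mul_nonneg hε.le (sq_nonneg (|t| - ε)), sq_abs t]

/-- If `w T w` lies in `M`, then `v T v*` lies in `M ⊗ 𝒦`, where `v = z (1 ⊗ |e⟩)` with
`z ∈ M₀ ⊗ 𝒦` and `w = (v* v)^{1/2}`. -/
theorem comp_comp_adjoint_mem_stabAlg {M₀ M : NonUnitalStarSubalgebra ℂ (F →L[ℂ] F)}
    (hM₀ : IsClosed (M₀ : Set (F →L[ℂ] F))) (hle : M₀ ≤ M) {z : HTensor F H →L[ℂ] HTensor F H}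
    (hz : z ∈ stabAlg H M₀) (e : H) {w : F →L[ℂ] F} (hwM : w ∈ M₀) (hw : IsSelfAdjoint w)
    (hvw : (z ∘L tensorRight F e)† ∘L (z ∘L tensorRight F e) = w * w) {T : F →L[ℂ] F}
    (hT : w * T * w ∈ M) :
    (z ∘L tensorRight F e) ∘L T ∘L (z ∘L tensorRight F e)† ∈ stabAlg H M := by
  set v := z ∘L tensorRight F e
  have hzM : z ∈ stabAlg H M := stabAlg_mono hle hz
  choose x hx hxw using fun n : ℕ =>
    exists_norm_sub_mul_mul_lt hM₀ hwM hw (ε := 1 / ((n : ℝ) + 1)) (by positivity)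
  have hlim : Tendsto (fun n => v ∘L (x n * w)) atTop (𝓝 v) := by
    rw [tendsto_iff_norm_sub_tendsto_zero]
    refine squeeze_zero (fun _ => norm_nonneg _) (fun n => ?_)
      tendsto_one_div_add_atTop_nhds_zero_nat
    have h1 : v ∘L (x n * w) - v = v ∘L (x n * w - 1) := by
      rw [ContinuousLinearMap.comp_sub]; rfl
    have h2 : w ∘L (x n * w - 1) = -(w - w * x n * w) := by
      change w * (x n * w - 1) = _
      rw [mul_sub, mul_one, mul_assoc, neg_sub]
    rw [h1, norm_comp_eq_of_adjoint_comp_self hw hvw, h2, norm_neg]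
    exact (hxw n).le
  have hcont : Continuous fun y : F →L[ℂ] HTensor F H => y ∘L T ∘L y† :=
    continuous_id.clm_comp (continuous_const.clm_comp ContinuousLinearMap.adjoint.continuous)
  have hlim' : Tendsto (fun n => (v ∘L (x n * w)) ∘L T ∘L (v ∘L (x n * w))†) atTop
      (𝓝 (v ∘L T ∘L v†)) := (hcont.tendsto v).comp hlim
  refine (stabAlg_isClosed M).mem_of_tendsto hlim' (Eventually.of_forall fun n => ?_)
  have hw' : w† = w := hw
  have h1 : (v ∘L (x n * w)) ∘L T ∘L (v ∘L (x n * w))† =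
      z * opTensor (x n * (w * T * w) * star (x n)) (rankOne ℂ e e) * star z := by
    have h2 : (v ∘L (x n * w))† = w ∘L (x n)† ∘L (tensorRight F e)† ∘L z† := by
      simp only [v]
      rw [ContinuousLinearMap.adjoint_comp, ContinuousLinearMap.adjoint_comp,
        ContinuousLinearMap.mul_def, ContinuousLinearMap.adjoint_comp, hw']
      rfl
    rw [h2, opTensor_rankOne]
    rfl
  rw [SetLike.mem_coe, h1]
  exact mul_mem (mul_mem hzM (opTensor_rankOne_mem_stabAlg
    (mul_mem (mul_mem (hle (hx n)) hT) (star_mem (hle (hx n)))) e e)) (star_mem hzM)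

/-- The conditions on special elements, for families `u n` of unitaries and algebras `M n` in the
place of the kernels of `Ĝ → G(A_n | A)` and of the algebras `A_n`. -/
structure IsSpecialFor {Γ : ℕ → Type*} (u : ∀ n, Γ n → unitary (F →L[ℂ] F))
    (M : ℕ → NonUnitalStarSubalgebra ℂ (F →L[ℂ] F)) (x : F →L[ℂ] F) : Prop where
  positive : 0 ≤ x
  sum : ∀ n, ∃ s ∈ M n, IsStrongSum (u n) x s
  sum_conj : ∀ n, ∀ z ∈ M 0, ∃ s ∈ M n, IsStrongSum (u n) (z * x * star z) s
  sum_sq : ∀ n, ∀ z ∈ M 0, ∃ s ∈ M n, IsStrongSum (u n) ((z * x * star z) ^ 2) s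
  sum_cut : ∀ n, ∀ z ∈ M 0, ∀ ε : ℝ, 0 < ε →
    ∃ s ∈ M n, IsStrongSum (u n) (cfc (fun t : ℝ => max (t - ε) 0) (z * x * star z)) s
  norm_lt : ∀ z ∈ M 0, ∀ ε : ℝ, 0 < ε → ∃ N : ℕ, ∀ n ≥ N, ∀ b c : F →L[ℂ] F,
    IsStrongSum (u n) (z * x * star z) b → IsStrongSum (u n) ((z * x * star z) ^ 2) c →
    ‖b ^ 2 - c‖ < ε

theorem conj_opTensor_rankOne (z : HTensor F H →L[ℂ] HTensor F H) (a : F →L[ℂ] F) (e : H) :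
    z * opTensor a (rankOne ℂ e e) * star z =
      (z ∘L tensorRight F e) ∘L a ∘L (z ∘L tensorRight F e)† := by
  rw [opTensor_rankOne, ContinuousLinearMap.adjoint_comp]
  rfl

/-- An algebra of operators contains `(v* v)^{1/2}` for `v = z (1 ⊗ |e⟩)`. -/
theorem exists_sqrt_slice {M : NonUnitalStarSubalgebra ℂ (F →L[ℂ] F)}
    (hM : IsClosed (M : Set (F →L[ℂ] F))) {z : HTensor F H →L[ℂ] HTensor F H}
    (hz : z ∈ stabAlg H M) (e : H) : ∃ w ∈ M, IsSelfAdjoint w ∧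
      (z ∘L tensorRight F e)† ∘L (z ∘L tensorRight F e) = w * w := by
  have h1 : (z ∘L tensorRight F e)† ∘L (z ∘L tensorRight F e) = slice e e (star z * z) := by
    rw [ContinuousLinearMap.adjoint_comp, slice_apply]
    rfl
  have h0 : 0 ≤ slice e e (star z * z) := by
    rw [← h1, ContinuousLinearMap.nonneg_iff_isPositive]
    exact ContinuousLinearMap.isPositive_adjoint_comp_self _
  have hm : slice e e (star z * z) ∈ M := slice_mem_of_mem_stabAlg hM (mul_mem (star_mem hz) hz) e e
  refine ⟨CFC.sqrt (slice e e (star z * z)), ?_, (CFC.sqrt_nonneg _).isSelfAdjoint, ?_⟩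
  · have := hM
    rw [CFC.sqrt_eq_real_sqrt _ h0]
    exact cfcₙ_mem (𝕜' := ℂ) _ hm
  · rw [h1, CFC.sqrt_mul_sqrt_self _ h0]

/-- If `a` is special for `M`, then `a ⊗ |e⟩⟨e|` is special for `M ⊗ 𝒦`. -/
theorem IsSpecialFor.opTensor {Γ : ℕ → Type*} {u : ∀ n, Γ n → unitary (F →L[ℂ] F)}
    {M : ℕ → NonUnitalStarSubalgebra ℂ (F →L[ℂ] F)} (hM : ∀ n, IsClosed (M n : Set (F →L[ℂ] F)))
    (hle : ∀ n, M 0 ≤ M n) (hu : ∀ n g, ∀ z ∈ M 0, Commute z (u n g : F →L[ℂ] F))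
    {a : F →L[ℂ] F} (ha : IsSpecialFor u M a) (e : H) :
    IsSpecialFor (fun n g => ampUnitary H (u n g)) (fun n => stabAlg H (M n))
      (opTensor a (rankOne ℂ e e)) := by
  -- the intertwining relations of `v = z (1 ⊗ |e⟩)`
  have hv : ∀ {n} (g : Γ n) {z : HTensor F H →L[ℂ] HTensor F H}, z ∈ stabAlg H (M 0) →
      (z ∘L tensorRight F e) ∘L (u n g : F →L[ℂ] F) =
        (ampUnitary H (u n g) : HTensor F H →L[ℂ] HTensor F H) ∘L (z ∘L tensorRight F e) := by
    intro n g z hz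
    rw [ContinuousLinearMap.comp_assoc, tensorRight_comp_eq_ampUnitary_comp,
      ← ContinuousLinearMap.comp_assoc, ← ContinuousLinearMap.comp_assoc]
    exact congrArg (· ∘L tensorRight F e) (commute_ampUnitary_of_mem_stabAlg (hu n g) hz).eq
  have hv' : ∀ {n} (g : Γ n) {z : HTensor F H →L[ℂ] HTensor F H}, z ∈ stabAlg H (M 0) →
      (u n g : F →L[ℂ] F) ∘L (z ∘L tensorRight F e)† = (z ∘L tensorRight F e)† ∘L
        (ampUnitary H (u n g) : HTensor F H →L[ℂ] HTensor F H) := by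
    intro n g z hz
    rw [ContinuousLinearMap.adjoint_comp, ← ContinuousLinearMap.comp_assoc,
      comp_adjoint_tensorRight, ContinuousLinearMap.comp_assoc, ContinuousLinearMap.comp_assoc]
    exact congrArg ((tensorRight F e)† ∘L ·)
      (commute_ampUnitary_of_mem_stabAlg (hu n g) (star_mem hz)).eq.symm
  -- the sums of the continuous functions that occur in the definition
  have key : ∀ {f k : ℝ → ℝ}, Continuous k → (∀ s, 0 ≤ s → 0 ≤ k s) → (∀ s, f s = s * k s) →
      ∀ n, (∀ z ∈ M 0, ∃ s ∈ M n, IsStrongSum (u n) (cfc f (z * a * star z)) s) →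
      ∀ z ∈ stabAlg H (M 0), ∃ s ∈ stabAlg H (M n), IsStrongSum (fun g => ampUnitary H (u n g))
        (cfc f (z * NCCov.opTensor a (rankOne ℂ e e) * star z)) s := by
    intro f k hk hk0 hf n hsum z hz
    obtain ⟨w, hwM, hw, hvw⟩ := exists_sqrt_slice (hM 0) hz e
    obtain ⟨s, -, hs⟩ := ha.sum n
    obtain ⟨T, hT, hT'⟩ := exists_strongSum_cfc (u' := fun g => ampUnitary H (u n g)) ha.positive hs
      hw hvw (fun g => hv g hz) (fun g => hv' g hz) (fun g => hu n g w hwM) hk hk0 hf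
    obtain ⟨s', hs'M, hs'⟩ := hsum w hwM
    rw [hs'.unique hT] at hs'M
    rw [conj_opTensor_rankOne]
    exact ⟨_, comp_comp_adjoint_mem_stabAlg (hM 0) (hle n) hz e hwM hw hvw hs'M, hT'⟩
  have hsa : ∀ z : F →L[ℂ] F, IsSelfAdjoint (z * a * star z) := fun z =>
    (star_right_conjugate_nonneg ha.positive z).isSelfAdjoint
  have hpos : 0 ≤ NCCov.opTensor a (rankOne ℂ e e) := by
    rw [opTensor_rankOne, ContinuousLinearMap.nonneg_iff_isPositive]
    exact ((ContinuousLinearMap.nonneg_iff_isPositive _).1 ha.positive).conj_adjoint _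
  have hsa' : ∀ z : HTensor F H →L[ℂ] HTensor F H,
      IsSelfAdjoint (z * NCCov.opTensor a (rankOne ℂ e e) * star z) := fun z =>
    (star_right_conjugate_nonneg hpos z).isSelfAdjoint
  refine ⟨hpos, fun n => ?_, fun n z hz => ?_, fun n z hz => ?_, fun n z hz ε hε => ?_,
    fun z hz ε hε => ?_⟩
  · obtain ⟨s, hsM, hs⟩ := ha.sum n
    refine ⟨_, opTensor_rankOne_mem_stabAlg hsM e e, ?_⟩
    rw [opTensor_rankOne, opTensor_rankOne]
    exact hs.comp _ _ (fun g => tensorRight_comp_eq_ampUnitary_comp _ _)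
      (fun g => comp_adjoint_tensorRight _ _)
  · have := key (f := fun s => s) (k := fun _ => 1) continuous_const (fun _ _ => zero_le_one)
      (fun s => (mul_one s).symm) n (fun z hz => by
        rw [cfc_id' ℝ _ (hsa z)]; exact ha.sum_conj n z hz) z hz
    rwa [cfc_id' ℝ _ (hsa' z)] at this
  · have := key (f := fun s => s ^ 2) (k := fun s => s) continuous_id (fun _ h => h)
      (fun s => sq s) n (fun z hz => by
        rw [cfc_pow_id _ 2 (hsa z)]; exact ha.sum_sq n z hz) z hz
    rwa [cfc_pow_id _ 2 (hsa' z)] at this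
  · refine key (f := fun t => max (t - ε) 0) (k := fun t => max (t - ε) 0 / max t ε) ?_
      (fun s _ => div_nonneg (le_max_right _ _) (hε.le.trans (le_max_right _ _))) (fun s => ?_) n
      (fun z hz => ha.sum_cut n z hz ε hε) z hz
    · exact Continuous.div (by fun_prop) (by fun_prop) fun t => (hε.trans_le (le_max_right _ _)).ne'
    · rcases le_total s ε with h | h
      · rw [max_eq_right (sub_nonpos.2 h)]; simp
      · rw [max_eq_left h, mul_div_cancel₀ _ (hε.trans_le h).ne']
  · obtain ⟨w, hwM, hw, hvw⟩ := exists_sqrt_slice (hM 0) hz e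
    obtain ⟨N, hN⟩ := ha.norm_lt w hwM ε hε
    refine ⟨N, fun n hn b c hb hc => ?_⟩
    obtain ⟨s, -, hs⟩ := ha.sum n
    obtain ⟨T, hT, hT'⟩ := exists_strongSum_cfc (u' := fun g => ampUnitary H (u n g)) ha.positive hs
      hw hvw (fun g => hv g hz) (fun g => hv' g hz) (fun g => hu n g w hwM)
      (f := fun s => s ^ 2) (k := fun s => s) continuous_id (fun _ h => h) (fun s => sq s)
    rw [cfc_pow_id _ 2 (hsa w)] at hT
    rw [← conj_opTensor_rankOne, cfc_pow_id _ 2 (hsa' z)] at hT'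
    have hs1 : IsStrongSum (u n) (w * a * star w) (w * s * w) := by
      rw [hw.star_eq]
      exact hs.mul (fun g => hu n g w hwM) (fun g => hu n g w hwM)
    have hs2 := hs.comp (v := fun g => ampUnitary H (u n g)) _ _ (fun g => hv g hz)
      (fun g => hv' g hz)
    rw [← conj_opTensor_rankOne] at hs2
    have := hN n hn _ _ hs1 hT
    rw [hb.unique hs2, hc.unique hT']
    set v := z ∘L tensorRight F e
    have e1 : (v ∘L s ∘L v†) ^ 2 - v ∘L T ∘L v† = v ∘L (s * (w * w) * s - T) ∘L v† := by
      rw [ContinuousLinearMap.sub_comp, ContinuousLinearMap.comp_sub, ← hvw, sq]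
      rfl
    have e2 : (w * s * w) ^ 2 - w * T * w = w * (s * (w * w) * s - T) * w := by noncomm_ring
    rwa [e1, norm_comp_comp_adjoint_eq hw hvw, ← e2]

end Special

/-! ### Slices of special elements -/

section Special

variable {F : Type*} [NormedAddCommGroup F] [InnerProductSpace ℂ F] [CompleteSpace F]
  {H : Type*} [NormedAddCommGroup H] [InnerProductSpace ℂ H] [CompleteSpace H]

theorem exists_norm_eq_one [Nontrivial H] : ∃ e : H, ‖e‖ = 1 := by
  obtain ⟨e₀, he₀⟩ := exists_ne (0 : H)
  exact ⟨(‖e₀‖⁻¹ : ℂ) • e₀, by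
      rw [norm_smul, norm_inv, Complex.norm_real, norm_norm,
        inv_mul_cancel₀ (norm_ne_zero_iff.2 he₀)]⟩

theorem rankOne_mul_rankOne_of_norm_eq_one {e : H} (he : ‖e‖ = 1) (ξ η : H) :
    rankOne ℂ ξ e * rankOne ℂ e η = rankOne ℂ ξ η := by
  ext ζ
  change rankOne ℂ ξ e (rankOne ℂ e η ζ) = _
  rw [InnerProductSpace.rankOne_apply, InnerProductSpace.rankOne_apply, inner_smul_right,
    inner_self_eq_norm_sq_to_K, he, InnerProductSpace.rankOne_apply]
  simp

theorem adjoint_tensorRight_comp_self {e : H} (he : ‖e‖ = 1) :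
    (tensorRight F e)† ∘L tensorRight F e = ContinuousLinearMap.id ℂ F := by
  rw [adjoint_tensorRight_comp_tensorRight, inner_self_eq_norm_sq_to_K, he]
  simp

theorem opTensor_rankOne_comp_tensorRight {e : H} (he : ‖e‖ = 1) (x : F →L[ℂ] F) :
    opTensor x (rankOne ℂ e e) ∘L tensorRight F e = tensorRight F e ∘L x := by
  rw [opTensor_rankOne, ContinuousLinearMap.comp_assoc, ContinuousLinearMap.comp_assoc,
    adjoint_tensorRight_comp_self he]
  rfl

theorem slice_opTensor_rankOne_self {e : H} (he : ‖e‖ = 1) (x : F →L[ℂ] F) :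
    slice e e (opTensor x (rankOne ℂ e e)) = x := by
  rw [slice_apply, opTensor_rankOne_comp_tensorRight he, ← ContinuousLinearMap.comp_assoc,
    adjoint_tensorRight_comp_self he]
  rfl

theorem norm_slice_self_le {e : H} (he : ‖e‖ = 1) (T : HTensor F H →L[ℂ] HTensor F H) :
    ‖slice e e T‖ ≤ ‖T‖ := by
  have h1 : ‖tensorRight F e‖ ≤ 1 := by
    refine ContinuousLinearMap.opNorm_le_bound _ zero_le_one fun ξ => ?_
    rw [tensorRight_apply, LinearIsometry.norm_map, TensorProduct.norm_tmul, he, mul_one, one_mul]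
  rw [slice_apply]
  calc _ ≤ ‖(tensorRight F e)†‖ * (‖T‖ * ‖tensorRight F e‖) :=
        (ContinuousLinearMap.opNorm_comp_le _ _).trans
          (mul_le_mul_of_nonneg_left (ContinuousLinearMap.opNorm_comp_le _ _) (norm_nonneg _))
    _ ≤ 1 * (‖T‖ * 1) := by
        gcongr
        rwa [LinearIsometryEquiv.norm_map ContinuousLinearMap.adjoint]
    _ = ‖T‖ := by ring

theorem IsStrongSum.slice {Γ : Type*} {u : Γ → unitary (F →L[ℂ] F)}
    {X S : HTensor F H →L[ℂ] HTensor F H} (h : IsStrongSum (fun g => ampUnitary H (u g)) X S)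
    (ξ η : H) : IsStrongSum u (slice ξ η X) (slice ξ η S) :=
  h.comp _ _ (fun g => (comp_adjoint_tensorRight (u g) ξ).symm)
    fun g => (tensorRight_comp_eq_ampUnitary_comp (u g) η).symm

theorem IsStrongSum.opTensor {Γ : Type*} {u : Γ → unitary (F →L[ℂ] F)}
    {x s : F →L[ℂ] F} (h : IsStrongSum u x s) (ξ η : H) :
    IsStrongSum (fun g => ampUnitary H (u g)) (opTensor x (rankOne ℂ ξ η))
      (opTensor s (rankOne ℂ ξ η)) := by
  rw [opTensor_rankOne, opTensor_rankOne]
  exact h.comp _ _ (fun g => tensorRight_comp_eq_ampUnitary_comp _ _)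
      (fun g => comp_adjoint_tensorRight _ _)

/-- The diagonal slices of an element that is special for `M ⊗ 𝒦` are special for `M`. -/
theorem IsSpecialFor.slice {Γ : ℕ → Type*} {u : ∀ n, Γ n → unitary (F →L[ℂ] F)}
    {M : ℕ → NonUnitalStarSubalgebra ℂ (F →L[ℂ] F)} (hM : ∀ n, IsClosed (M n : Set (F →L[ℂ] F)))
    {X : HTensor F H →L[ℂ] HTensor F H}
    (hX : IsSpecialFor (fun n g => ampUnitary H (u n g)) (fun n => stabAlg H (M n)) X)
    {e : H} (he : ‖e‖ = 1) : IsSpecialFor u M (slice e e X) := by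
  have hpos : 0 ≤ NCCov.slice e e X := by
    rw [slice_apply, ContinuousLinearMap.nonneg_iff_isPositive]
    exact ((ContinuousLinearMap.nonneg_iff_isPositive _).1 hX.positive).adjoint_conj _
  -- conjugation by `z ⊗ |e⟩⟨e|` reduces to conjugation by `z`
  have hconj : ∀ z : F →L[ℂ] F,
      NCCov.opTensor z (rankOne ℂ e e) * X * star (NCCov.opTensor z (rankOne ℂ e e)) =
      NCCov.opTensor (z * NCCov.slice e e X * star z) (rankOne ℂ e e) := fun z => by
    rw [star_opTensor_rankOne, rankOne_mul_mul_rankOne]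
  have hsa : ∀ z : F →L[ℂ] F, IsSelfAdjoint (z * NCCov.slice e e X * star z) := fun z =>
    (star_right_conjugate_nonneg hpos z).isSelfAdjoint
  have hsa' : ∀ y : F →L[ℂ] F, IsSelfAdjoint y → IsSelfAdjoint (NCCov.opTensor y (rankOne ℂ e e)) :=
    fun y hy => by rw [IsSelfAdjoint, star_opTensor_rankOne, hy.star_eq]
  have key : ∀ {f : ℝ → ℝ}, Continuous f → ∀ n, (∀ z ∈ stabAlg H (M 0), ∃ s ∈ stabAlg H (M n),
      IsStrongSum (fun g => ampUnitary H (u n g)) (cfc f (z * X * star z)) s) →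
      ∀ z ∈ M 0, ∃ s ∈ M n, IsStrongSum (u n) (cfc f (z * NCCov.slice e e X * star z)) s := by
    intro f hf n hsum z hz
    obtain ⟨S, hS, hS'⟩ := hsum _ (opTensor_rankOne_mem_stabAlg hz e e)
    refine ⟨_, slice_mem_of_mem_stabAlg (hM n) hS e e, ?_⟩
    have h1 := hS'.slice e e
    rw [hconj, slice_apply, ← comp_cfc_of_intertwines (tensorRight F e) (hsa z) (hsa' _ (hsa z))
      (opTensor_rankOne_comp_tensorRight he _).symm hf, ← ContinuousLinearMap.comp_assoc,
      adjoint_tensorRight_comp_self he] at h1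
    exact h1
  refine ⟨hpos, fun n => ?_, fun n z hz => ?_, fun n z hz => ?_, fun n z hz ε hε => ?_,
    fun z hz ε hε => ?_⟩
  · obtain ⟨S, hS, hS'⟩ := hX.sum n
    exact ⟨_, slice_mem_of_mem_stabAlg (hM n) hS e e, hS'.slice e e⟩
  · have := key (f := fun s => s) continuous_id n (fun z hz => by
        rw [cfc_id' ℝ _ (star_right_conjugate_nonneg hX.positive z).isSelfAdjoint]
        exact hX.sum_conj n z hz) z hz
    rwa [cfc_id' ℝ _ (hsa z)] at this
  · have := key (f := fun s => s ^ 2) (continuous_pow 2) n (fun z hz => by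
        rw [cfc_pow_id _ 2 (star_right_conjugate_nonneg hX.positive z).isSelfAdjoint]
        exact hX.sum_sq n z hz) z hz
    rwa [cfc_pow_id _ 2 (hsa z)] at this
  · exact key (by fun_prop) n (fun z hz => hX.sum_cut n z hz ε hε) z hz
  · obtain ⟨N, hN⟩ := hX.norm_lt _ (opTensor_rankOne_mem_stabAlg hz e e) ε hε
    refine ⟨N, fun n hn b c hb hc => ?_⟩
    have hsq : ∀ y : F →L[ℂ] F,
        NCCov.opTensor y (rankOne ℂ e e) ^ 2 = NCCov.opTensor (y ^ 2) (rankOne ℂ e e) := by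
      intro y
      rw [sq, ← opTensor_mul, rankOne_mul_rankOne_of_norm_eq_one he, sq]
    rw [hconj, hsq] at hN
    have h3 := hN n hn _ _ (hb.opTensor e e) (hc.opTensor e e)
    rw [hsq] at h3
    refine lt_of_le_of_lt ?_ h3
    have h4 := norm_slice_self_le he
      (NCCov.opTensor (b ^ 2) (rankOne ℂ e e) - NCCov.opTensor c (rankOne ℂ e e))
    rwa [map_sub, slice_opTensor_rankOne_self he, slice_opTensor_rankOne_self he] at h4

/-- The C*-algebra generated by the operators `x a y` with `x`, `y` in `N` and `a` in `s`. -/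
noncomputable def genAlg (N : NonUnitalStarSubalgebra ℂ (F →L[ℂ] F)) (s : Set (F →L[ℂ] F)) :
    NonUnitalStarSubalgebra ℂ (F →L[ℂ] F) :=
  (NonUnitalStarAlgebra.adjoin ℂ
    {t | ∃ x ∈ N, ∃ y ∈ N, ∃ a ∈ s, t = x * a * y}).topologicalClosure

theorem mul_mul_mem_genAlg {N : NonUnitalStarSubalgebra ℂ (F →L[ℂ] F)} {s : Set (F →L[ℂ] F)}
    {x y a : F →L[ℂ] F} (hx : x ∈ N) (hy : y ∈ N) (ha : a ∈ s) : x * a * y ∈ genAlg N s :=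
  NonUnitalStarSubalgebra.le_topologicalClosure _
    (NonUnitalStarAlgebra.subset_adjoin ℂ _ ⟨x, hx, y, hy, a, ha, rfl⟩)

theorem isClosed_genAlg (N : NonUnitalStarSubalgebra ℂ (F →L[ℂ] F)) (s : Set (F →L[ℂ] F)) :
    IsClosed (genAlg N s : Set (F →L[ℂ] F)) :=
  NonUnitalStarSubalgebra.isClosed_topologicalClosure _

theorem genAlg_le {N M : NonUnitalStarSubalgebra ℂ (F →L[ℂ] F)} {s : Set (F →L[ℂ] F)}
    (hM : IsClosed (M : Set (F →L[ℂ] F)))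
    (h : ∀ x ∈ N, ∀ y ∈ N, ∀ a ∈ s, x * a * y ∈ M) : genAlg N s ≤ M := by
  refine NonUnitalStarSubalgebra.topologicalClosure_minimal _ (NonUnitalStarAlgebra.adjoin_le ?_) hM
  rintro _ ⟨x, hx, y, hy, a, ha, rfl⟩
  exact h x hx y hy a ha

theorem slice_add_left (ξ ξ' η : H) (T : HTensor F H →L[ℂ] HTensor F H) :
    slice (ξ + ξ') η T = slice ξ η T + slice ξ' η T := by
  rw [slice_apply, tensorRight_add, map_add, ContinuousLinearMap.add_comp]
  rfl

theorem slice_add_right (ξ η η' : H) (T : HTensor F H →L[ℂ] HTensor F H) :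
    slice ξ (η + η') T = slice ξ η T + slice ξ η' T := by
  rw [slice_apply, tensorRight_add, ContinuousLinearMap.comp_add, ContinuousLinearMap.comp_add]
  rfl

theorem slice_smul_left (c : ℂ) (ξ η : H) (T : HTensor F H →L[ℂ] HTensor F H) :
    slice (c • ξ) η T = star c • slice ξ η T := by
  rw [slice_apply, tensorRight_smul, map_smulₛₗ, ContinuousLinearMap.smul_comp]
  rfl

theorem slice_smul_right (c : ℂ) (ξ η : H) (T : HTensor F H →L[ℂ] HTensor F H) :
    slice ξ (c • η) T = c • slice ξ η T := by
  rw [slice_apply, tensorRight_smul, ContinuousLinearMap.comp_smul, ContinuousLinearMap.comp_smul]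
  rfl

/-- Slices are determined by diagonal ones. -/
theorem slice_polarization (ξ η : H) (T : HTensor F H →L[ℂ] HTensor F H) :
    (4 : ℂ) • slice ξ η T = slice (ξ + η) (ξ + η) T
      + (-1 : ℂ) • slice (ξ + (-1 : ℂ) • η) (ξ + (-1 : ℂ) • η) T
      + (-Complex.I) • slice (ξ + Complex.I • η) (ξ + Complex.I • η) T
      + Complex.I • slice (ξ + (-Complex.I) • η) (ξ + (-Complex.I) • η) T := by
  simp only [slice_add_left, slice_add_right, slice_smul_left, slice_smul_right, smul_add,
    smul_smul,
    star_neg, Complex.star_def, Complex.conj_I, star_one]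
  match_scalars <;> ring_nf <;> simp <;> norm_num

/-- Passing to `N ⊗ 𝒦` commutes with generating C*-algebras by the operators `x a y`, when the
diagonal slices of the operators in `s'` and the operators `a ⊗ |e⟩⟨e|` with `a ∈ s` correspond. -/
theorem genAlg_stabAlg [Nontrivial H] {N : NonUnitalStarSubalgebra ℂ (F →L[ℂ] F)}
    {s : Set (F →L[ℂ] F)} {s' : Set (HTensor F H →L[ℂ] HTensor F H)}
    (hslice : ∀ X ∈ s', ∀ e : H, ‖e‖ = 1 → slice e e X ∈ s)
    (htensor : ∀ a ∈ s, ∀ e : H, ‖e‖ = 1 → opTensor a (rankOne ℂ e e) ∈ s') :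
    genAlg (stabAlg H N) s' = stabAlg H (genAlg N s) := by
  apply le_antisymm
  · refine genAlg_le (stabAlg_isClosed _) fun P hP Q hQ X hX => ?_
    have hself : ∀ x ∈ N, ∀ y ∈ N, ∀ η : H, x * slice η η X * y ∈ genAlg N s := by
      intro x hx y hy η
      rcases eq_or_ne η 0 with rfl | hη
      · have : slice (0 : H) 0 X = 0 := by simpa using slice_smul_right 0 (0 : H) (0 : H) X
        rw [this, mul_zero, zero_mul]
        exact zero_mem _
      · have h1 : η = (‖η‖ : ℂ) • ((‖η‖⁻¹ : ℂ) • η) := by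
          rw [smul_smul, mul_inv_cancel₀ (by simpa using hη), one_smul]
        have h2 : ‖(‖η‖⁻¹ : ℂ) • η‖ = 1 := by
          rw [norm_smul, norm_inv, Complex.norm_real, norm_norm,
            inv_mul_cancel₀ (norm_ne_zero_iff.2 hη)]
        rw [h1, slice_smul_left, slice_smul_right, mul_smul_comm, mul_smul_comm, smul_mul_assoc,
          smul_mul_assoc]
        exact SMulMemClass.smul_mem _ (SMulMemClass.smul_mem _
          (mul_mul_mem_genAlg hx hy (hslice X hX _ h2)))
    have hall : ∀ x ∈ N, ∀ y ∈ N, ∀ ξ η : H, x * slice ξ η X * y ∈ genAlg N s := by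
      intro x hx y hy ξ η
      have h4 : x * slice ξ η X * y = (4⁻¹ : ℂ) • (x * ((4 : ℂ) • slice ξ η X) * y) := by
        rw [mul_smul_comm, smul_mul_assoc, smul_smul]
        norm_num
      rw [h4, slice_polarization]
      simp only [mul_add, add_mul, mul_smul_comm, smul_mul_assoc]
      refine SMulMemClass.smul_mem _ (add_mem (add_mem (add_mem ?_ ?_) ?_) ?_)
      · exact hself x hx y hy _
      all_goals exact SMulMemClass.smul_mem _ (hself x hx y hy _)
    refine stabAlg_induction (p := fun P => P * X * Q ∈ stabAlg H (genAlg N s)) ?_ ?_ ?_ ?_ hP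
    · exact (stabAlg_isClosed _).preimage
        ((continuous_mul_const Q).comp (continuous_mul_const X))
    · rw [zero_mul, zero_mul]; exact zero_mem _
    · intro S T hS hT
      rw [add_mul, add_mul]; exact add_mem hS hT
    · intro x hx ξ η
      refine stabAlg_induction (p := fun Q => opTensor x (rankOne ℂ ξ η) * X * Q ∈
        stabAlg H (genAlg N s)) ?_ ?_ ?_ ?_ hQ
      · exact (stabAlg_isClosed _).preimage (continuous_const_mul _)
      · rw [mul_zero]; exact zero_mem _
      · intro S T hS hT
        rw [mul_add]; exact add_mem hS hT
      · intro y hy ξ' η'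
        rw [rankOne_mul_mul_rankOne]
        exact opTensor_rankOne_mem_stabAlg (hall x hx y hy η ξ') ξ η'
  · obtain ⟨e, he⟩ := exists_norm_eq_one (H := H)
    have hmul : ∀ (x y : F →L[ℂ] F) (ξ η : H), opTensor (x * y) (rankOne ℂ ξ η) =
        opTensor x (rankOne ℂ ξ e) * opTensor y (rankOne ℂ e η) := by
      intro x y ξ η
      rw [← opTensor_mul, rankOne_mul_rankOne_of_norm_eq_one he]
    let W : NonUnitalStarSubalgebra ℂ (F →L[ℂ] F) :=
      { carrier := {x | ∀ ξ η : H, opTensor x (rankOne ℂ ξ η) ∈ genAlg (stabAlg H N) s'}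
        zero_mem' := fun ξ η => by rw [opTensor_zero_left]; exact zero_mem _
        add_mem' := fun hx hy ξ η => by rw [opTensor_add_left]; exact add_mem (hx ξ η) (hy ξ η)
        mul_mem' := fun hx hy ξ η => by rw [hmul]; exact mul_mem (hx ξ e) (hy e η)
        smul_mem' := fun c x hx ξ η => by
          rw [opTensor_smul_left]; exact SMulMemClass.smul_mem c (hx ξ η)
        star_mem' := fun {x} hx ξ η => by
          have := star_mem (hx η ξ)
          rwa [star_opTensor_rankOne] at this }
    have hW : IsClosed (W : Set (F →L[ℂ] F)) := by
      have : (W : Set (F →L[ℂ] F)) = ⋂ (ξ : H) (η : H), (fun x => opTensor x (rankOne ℂ ξ η)) ⁻¹'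
          (genAlg (stabAlg H N) s' : Set (HTensor F H →L[ℂ] HTensor F H)) := by
        ext x; simp only [Set.mem_iInter]; rfl
      rw [this]
      exact isClosed_iInter fun ξ => isClosed_iInter fun η =>
        (isClosed_genAlg _ _).preimage (continuous_opTensor_left _)
    have hle : genAlg N s ≤ W := by
      refine genAlg_le hW fun x hx y hy a ha ξ η => ?_
      have : opTensor (x * a * y) (rankOne ℂ ξ η) = opTensor x (rankOne ℂ ξ e) *
          opTensor a (rankOne ℂ e e) * opTensor y (rankOne ℂ e η) := by
        rw [hmul, hmul]
      rw [this]
      exact mul_mul_mem_genAlg (opTensor_rankOne_mem_stabAlg hx _ _)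
        (opTensor_rankOne_mem_stabAlg hy _ _) (htensor a ha e he)
    intro T hT
    exact stabAlg_induction (p := fun T => T ∈ genAlg (stabAlg H N) s') (isClosed_genAlg _ _)
      (zero_mem _) (fun _ _ => add_mem) (fun x hx ξ η => hle hx ξ η) hT

end Special

/-! ### The disconnected limit of the stabilized sequence -/

section Special

variable {F : Type*} [NormedAddCommGroup F] [InnerProductSpace ℂ F] [CompleteSpace F]
  {H : Type*} [NormedAddCommGroup H] [InnerProductSpace ℂ H] [CompleteSpace H]

theorem IsSpecialFor.congr {Γ Γ' : ℕ → Type*} {u : ∀ n, Γ n → unitary (F →L[ℂ] F)}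
    {u' : ∀ n, Γ' n → unitary (F →L[ℂ] F)} {M : ℕ → NonUnitalStarSubalgebra ℂ (F →L[ℂ] F)}
    (h : ∀ n x s, IsStrongSum (u n) x s ↔ IsStrongSum (u' n) x s) {x : F →L[ℂ] F}
    (hx : IsSpecialFor u M x) : IsSpecialFor u' M x := by
  obtain ⟨h1, h2, h3, h4, h5, h6⟩ := hx
  simp only [h] at h2 h3 h4 h5 h6
  exact ⟨h1, h2, h3, h4, h5, h6⟩

theorem isStrongSum_equiv {Γ Γ' : Type*} (e : Γ' ≃ Γ) {u : Γ → unitary (F →L[ℂ] F)}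
    {u' : Γ' → unitary (F →L[ℂ] F)} (h : ∀ g, u' g = u (e g)) (x s : F →L[ℂ] F) :
    IsStrongSum u' x s ↔ IsStrongSum u x s := by
  obtain rfl : u' = fun g => u (e g) := funext h
  exact forall_congr' fun ξ =>
    e.hasSum_iff (f := fun g => ((u g : F →L[ℂ] F) * x * star (u g : F →L[ℂ] F)) ξ)

namespace CovSeq

variable (S : CovSeq) {L : Type*} [NonUnitalCStarAlgebra L] (ι : ∀ n, S.A n →⋆ₙₐ[ℂ] L)
  (π : L →⋆ₙₐ[ℂ] (F →L[ℂ] F)) (U : S.LimGal →* unitary (F →L[ℂ] F))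

/-- The image of `A_n` in `B(𝓗)`. -/
noncomputable def opAlg (n : ℕ) : NonUnitalStarSubalgebra ℂ (F →L[ℂ] F) :=
  NonUnitalStarAlgHom.range (π.comp (ι n))

/-- The restriction of `U` to the kernel of `Ĝ → G(A_n | A)`. -/
noncomputable def kerRep (n : ℕ) (g : (S.proj n).ker) : unitary (F →L[ℂ] F) := U g

theorem sumsInto_iff (n : ℕ) (x : F →L[ℂ] F) :
    S.SumsInto ι π U n x ↔ ∃ s ∈ S.opAlg ι π n, IsStrongSum (S.kerRep U n) x s := by
  constructor
  · rintro ⟨a, ha⟩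
    exact ⟨_, ⟨a, rfl⟩, ha⟩
  · rintro ⟨_, ⟨a, rfl⟩, ha⟩
    exact ⟨a, ha⟩

theorem isSpecial_iff (x : F →L[ℂ] F) :
    S.IsSpecial ι π U x ↔ IsSpecialFor (S.kerRep U) (S.opAlg ι π) x := by
  constructor
  · rintro ⟨h1, h2, h3, h4, h5, h6⟩
    simp only [sumsInto_iff] at h2 h3 h4 h5
    refine ⟨(ContinuousLinearMap.nonneg_iff_isPositive _).2 h1, h2, ?_, ?_, ?_, ?_⟩
    · rintro n _ ⟨z, rfl⟩; exact h3 n z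
    · rintro n _ ⟨z, rfl⟩; exact h4 n z
    · rintro n _ ⟨z, rfl⟩ ε hε; exact h5 n z ε hε
    · rintro _ ⟨z, rfl⟩ ε hε; exact h6 z ε hε
  · rintro ⟨h1, h2, h3, h4, h5, h6⟩
    refine ⟨(ContinuousLinearMap.nonneg_iff_isPositive _).1 h1, fun n => (sumsInto_iff ..).2 (h2 n),
      fun n z => (sumsInto_iff ..).2 (h3 n _ ⟨z, rfl⟩),
        fun n z => (sumsInto_iff ..).2 (h4 n _ ⟨z, rfl⟩),
      fun n z ε hε => (sumsInto_iff ..).2 (h5 n _ ⟨z, rfl⟩ ε hε), fun z ε hε => h6 _ ⟨z, rfl⟩ ε hε⟩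

theorem disconnLim_eq_genAlg :
    S.disconnLim ι π U = genAlg (NonUnitalStarAlgHom.range π) {x | S.IsSpecial ι π U x} := by
  rw [disconnLim, genAlg]
  congr 2
  ext t
  constructor
  · rintro ⟨x, y, a, ha, rfl⟩
    exact ⟨_, ⟨x, rfl⟩, _, ⟨y, rfl⟩, a, ha, rfl⟩
  · rintro ⟨_, ⟨x, rfl⟩, _, ⟨y, rfl⟩, a, ha, rfl⟩
    exact ⟨x, y, a, ha, rfl⟩

variable {S ι π U}

theorem isClosed_opAlg (hι : S.IsInductiveLimit ι) (hπ : Function.Injective π) (n : ℕ) :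
    IsClosed (S.opAlg ι π n : Set (F →L[ℂ] F)) :=
  (NonUnitalStarAlgHom.isometry (π.comp (ι n))
    (hπ.comp (hι.injective n))).isClosedEmbedding.isClosed_range

theorem opAlg_zero_le (hι : S.IsInductiveLimit ι) (n : ℕ) : S.opAlg ι π 0 ≤ S.opAlg ι π n := by
  rintro _ ⟨a, rfl⟩
  exact ⟨S.map (Nat.zero_le n) a, congrArg π (hι.compat _ a)⟩

theorem commute_of_mem_opAlg_zero (hgal : S.gal 0 0 = ⊥) (hU : S.IsEquivariantRep ι π U)
    (g : S.LimGal) {z : F →L[ℂ] F} (hz : z ∈ S.opAlg ι π 0) : Commute z (U g : F →L[ℂ] F) := by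
  obtain ⟨a, rfl⟩ := hz
  have h1 : (S.proj 0 g : S.A 0 ≃⋆ₐ[ℂ] S.A 0) = 1 :=
    Subgroup.mem_bot.1 (hgal.le (S.proj 0 g).2)
  have h2 := hU.equivariant g 0 a
  rw [h1] at h2
  have h3 : π (ι 0 a) = (U g : F →L[ℂ] F) * π (ι 0 a) * star (U g : F →L[ℂ] F) := h2
  change π (ι 0 a) * _ = _ * π (ι 0 a)
  nth_rw 1 [h3]
  rw [mul_assoc, Unitary.star_mul_self_of_mem (U g).2, mul_one]

end CovSeq

section Stab

variable {E : Type*} [NormedAddCommGroup E] [InnerProductSpace ℂ E] [CompleteSpace E]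

theorem Stab.lift_incl {A A' : Type*} [NonUnitalCStarAlgebra A] [NonUnitalCStarAlgebra A']
    {ρ : A →⋆ₙₐ[ℂ] (E →L[ℂ] E)} {ρ' : A' →⋆ₙₐ[ℂ] (E →L[ℂ] E)} (hρ : Function.Injective ρ)
    (hρ' : Function.Injective ρ') (f : A →⋆ₙₐ[ℂ] A') (h : ∀ a, ρ' (f a) = ρ a)
    (φ : A' →⋆ₙₐ[ℂ] (F →L[ℂ] F)) :
    (Stab.lift (H := H) ρ' hρ' φ).comp (Stab.incl H ρ ρ' f h) = Stab.lift ρ hρ (φ.comp f) := by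
  refine Stab.hom_ext fun a ξ η => ?_
  rw [NonUnitalStarAlgHom.comp_apply, Stab.incl_unit, Stab.lift_unit, Stab.lift_unit]
  rfl

namespace CovSeq

variable {S : CovSeq} {L : Type*} [NonUnitalCStarAlgebra L] {ι : ∀ n, S.A n →⋆ₙₐ[ℂ] L}
  (hι : S.IsInductiveLimit ι) {σ : L →⋆ₙₐ[ℂ] (E →L[ℂ] E)} (hσ : Function.Injective σ)
  {π : L →⋆ₙₐ[ℂ] (F →L[ℂ] F)}

theorem range_lift_eq (hπ : Function.Injective π) :
    NonUnitalStarAlgHom.range (Stab.lift (H := H) σ hσ π) =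
      stabAlg H (NonUnitalStarAlgHom.range π) :=
  SetLike.coe_injective (Stab.range_lift σ hσ π hπ)

theorem opAlg_stab (hπ : Function.Injective π) (n : ℕ) :
    (S.stab H ι hι σ).opAlg (S.stabι H ι hι σ) (Stab.lift σ hσ π) n =
      stabAlg H (S.opAlg ι π n) := by
  have h := Stab.lift_incl (H := H) (S.comp_injective hι hσ n) hσ (ι n)
    (fun _ => (NonUnitalStarAlgHom.comp_apply _ _ _).symm) π
  refine SetLike.coe_injective (Eq.trans ?_ (Stab.range_lift _ (S.comp_injective hι hσ n)
    (π.comp (ι n)) (hπ.comp (hι.injective n))))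
  rw [← h]
  rfl

theorem proj_stabLimGal_eq_one [Nontrivial H] (g : S.LimGal) (n : ℕ) :
    (S.stab H ι hι σ).proj n (S.stabLimGal H ι hι σ hσ g) = 1 ↔ S.proj n g = 1 :=
  (S.stabGalEquiv H ι hι σ hσ n).map_eq_one_iff

variable (H) in
/-- The unitary representation `U ⊗ 1` of the limit group of the stabilized sequence. -/
noncomputable def stabRep [Nontrivial H] (U : S.LimGal →* unitary (F →L[ℂ] F)) :
    (S.stab H ι hι σ).LimGal →* unitary (HTensor F H →L[ℂ] HTensor F H) :=
  (ampUnitary H).comp (U.comp (S.stabLimGal H ι hι σ hσ).symm.toMonoidHom)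

theorem stabRep_stabLimGal [Nontrivial H] (U : S.LimGal →* unitary (F →L[ℂ] F)) (g : S.LimGal) :
    stabRep H hι hσ U (S.stabLimGal H ι hι σ hσ g) = ampUnitary H (U g) := by
  change ampUnitary H (U ((S.stabLimGal H ι hι σ hσ).symm _)) = _
  rw [MulEquiv.symm_apply_apply]

theorem isStrongSum_stabRep [Nontrivial H] (U : S.LimGal →* unitary (F →L[ℂ] F)) (n : ℕ)
    (X T : HTensor F H →L[ℂ] HTensor F H) :
    IsStrongSum ((S.stab H ι hι σ).kerRep (stabRep H hι hσ U) n) X T ↔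
      IsStrongSum (fun g => ampUnitary H (S.kerRep U n g)) X T := by
  let e : (S.proj n).ker ≃ ((S.stab H ι hι σ).proj n).ker :=
    (S.stabLimGal H ι hι σ hσ).toEquiv.subtypeEquiv fun g =>
      (proj_stabLimGal_eq_one hι hσ g n).symm
  exact (isStrongSum_equiv e (fun g => (stabRep_stabLimGal hι hσ U g).symm) X T).symm

/-- The disconnected limit of the stabilized sequence is the stabilization of the disconnected
limit. -/
theorem disconnLim_stab [Nontrivial H] (hgal : S.gal 0 0 = ⊥)
    {U : S.LimGal →* unitary (F →L[ℂ] F)} (hU : S.IsEquivariantRep ι π U) :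
    (S.stab H ι hι σ).disconnLim (S.stabι H ι hι σ) (Stab.lift σ hσ π) (stabRep H hι hσ U) =
      stabAlg H (S.disconnLim ι π U) := by
  have hπ := hU.injective
  have hspec : ∀ X, (S.stab H ι hι σ).IsSpecial (S.stabι H ι hι σ) (Stab.lift σ hσ π)
      (stabRep H hι hσ U) X ↔ IsSpecialFor (fun n g => ampUnitary H (S.kerRep U n g))
        (fun n => stabAlg H (S.opAlg ι π n)) X := by
    intro X
    rw [isSpecial_iff, funext (opAlg_stab (H := H) hι hσ hπ)]
    exact ⟨fun h => h.congr (isStrongSum_stabRep hι hσ U),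
      fun h => h.congr fun n x s => (isStrongSum_stabRep hι hσ U n x s).symm⟩
  rw [disconnLim_eq_genAlg, disconnLim_eq_genAlg, range_lift_eq hσ hπ]
  refine genAlg_stabAlg (fun X hX e he => ?_) fun a ha e he => ?_
  · exact (isSpecial_iff ..).2 (((hspec X).1 hX).slice (isClosed_opAlg hι hπ) he)
  · exact (hspec _).2 (((S.isSpecial_iff ι π U a).1 ha).opTensor (u := S.kerRep U)
      (isClosed_opAlg hι hπ)
      (opAlg_zero_le hι)
      (fun n g z hz => commute_of_mem_opAlg_zero (U := U) hgal hU (g : S.LimGal) hz) e)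

end CovSeq

end Stab

end Special

/-! ### Algebras of operators that are direct sums of translates -/

section Translates

variable {F : Type*} [NormedAddCommGroup F] [InnerProductSpace ℂ F] [CompleteSpace F]

/-- An element `x` of a C*-algebra `C` is a limit of elements `z x` with `z` in `C`. -/
theorem exists_norm_sub_mul_mul_self_lt {C : NonUnitalStarSubalgebra ℂ (F →L[ℂ] F)}
    (hC : IsClosed (C : Set (F →L[ℂ] F))) {x : F →L[ℂ] F} (hx : x ∈ C) {ε : ℝ} (hε : 0 < ε) :
    ∃ z ∈ C, ‖x - z * x‖ < ε := by
  let _ := CStarAlgebra.spectralOrder C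
  have := CStarAlgebra.spectralOrderedRing C
  have h := (CStarAlgebra.increasingApproximateUnit C)
  have := h.neBot
  have h1 := h.tendsto_mul_right ⟨x, hx⟩
  obtain ⟨z, hz⟩ := (Metric.tendsto_nhds.1 h1 ε hε).exists
  refine ⟨z, z.2, ?_⟩
  rw [dist_comm, dist_eq_norm] at hz
  exact hz

variable {Γ : Type*} [Group Γ] (U : Γ →* unitary (F →L[ℂ] F))

theorem conjAct_mul (g : Γ) (x y : F →L[ℂ] F) :
    conjAct U g (x * y) = conjAct U g x * conjAct U g y :=
  (Unitary.conjStarAlgAut ℂ (F →L[ℂ] F) (U g)).map_mul' x y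

theorem conjAct_add (g : Γ) (x y : F →L[ℂ] F) :
    conjAct U g (x + y) = conjAct U g x + conjAct U g y :=
  (Unitary.conjStarAlgAut ℂ (F →L[ℂ] F) (U g)).map_add' x y

theorem conjAct_smul (g : Γ) (c : ℂ) (x : F →L[ℂ] F) :
    conjAct U g (c • x) = c • conjAct U g x :=
  (Unitary.conjStarAlgAut ℂ (F →L[ℂ] F) (U g)).map_smul' c x

theorem conjAct_star (g : Γ) (x : F →L[ℂ] F) :
    conjAct U g (star x) = star (conjAct U g x) :=
  (Unitary.conjStarAlgAut ℂ (F →L[ℂ] F) (U g)).map_star' x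

theorem conjAct_zero (g : Γ) : conjAct U g 0 = 0 := by
  simpa using conjAct_smul U g 0 0

theorem conjAct_conjAct (g h : Γ) (x : F →L[ℂ] F) :
    conjAct U g (conjAct U h x) = conjAct U (g * h) x := by
  simp only [conjAct, map_mul, Submonoid.coe_mul, star_mul, mul_assoc]

theorem conjAct_one (x : F →L[ℂ] F) : conjAct U 1 x = x := by
  simp [conjAct]

theorem conjAct_inv_conjAct (g : Γ) (x : F →L[ℂ] F) : conjAct U g⁻¹ (conjAct U g x) = x := by
  rw [conjAct_conjAct, inv_mul_cancel, conjAct_one]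

theorem conjAct_conjAct_inv (g : Γ) (x : F →L[ℂ] F) : conjAct U g (conjAct U g⁻¹ x) = x := by
  rw [conjAct_conjAct, mul_inv_cancel, conjAct_one]

theorem conjAct_eq_zero {g : Γ} {x : F →L[ℂ] F} (h : conjAct U g x = 0) : x = 0 := by
  rw [← conjAct_inv_conjAct U g x, h, conjAct_zero]

theorem continuous_conjAct (g : Γ) : Continuous (conjAct U g) :=
  (continuous_mul_const _).comp (continuous_const_mul _)

/-- The translate `g C` of an algebra of operators. -/
noncomputable def translate (g : Γ) (C : NonUnitalStarSubalgebra ℂ (F →L[ℂ] F)) :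
    NonUnitalStarSubalgebra ℂ (F →L[ℂ] F) where
  carrier := conjAct U g '' C
  zero_mem' := ⟨0, C.zero_mem, conjAct_zero U g⟩
  add_mem' := by
    rintro _ _ ⟨x, hx, rfl⟩ ⟨y, hy, rfl⟩
    exact ⟨x + y, add_mem hx hy, conjAct_add U g x y⟩
  mul_mem' := by
    rintro _ _ ⟨x, hx, rfl⟩ ⟨y, hy, rfl⟩
    exact ⟨x * y, mul_mem hx hy, conjAct_mul U g x y⟩
  smul_mem' := by
    rintro c _ ⟨x, hx, rfl⟩
    exact ⟨c • x, SMulMemClass.smul_mem c hx, conjAct_smul U g c x⟩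
  star_mem' := by
    rintro _ ⟨x, hx, rfl⟩
    exact ⟨star x, star_mem hx, conjAct_star U g x⟩

theorem eq_bot_iff_forall {C : NonUnitalStarSubalgebra ℂ (F →L[ℂ] F)} :
    C = ⊥ ↔ ∀ x ∈ C, x = 0 := by
  constructor
  · rintro rfl x hx
    exact NonUnitalStarAlgebra.mem_bot.1 hx
  · intro h
    refine SetLike.ext fun x => ⟨fun hx => NonUnitalStarAlgebra.mem_bot.2 (h x hx), fun hx => ?_⟩
    rw [NonUnitalStarAlgebra.mem_bot.1 hx]
    exact zero_mem C

variable {U}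

theorem conjAct_mem_translate (g : Γ) {C : NonUnitalStarSubalgebra ℂ (F →L[ℂ] F)} {x : F →L[ℂ] F}
    (hx : x ∈ C) : conjAct U g x ∈ translate U g C := ⟨x, hx, rfl⟩

theorem coe_translate (g : Γ) (C : NonUnitalStarSubalgebra ℂ (F →L[ℂ] F)) :
    (translate U g C : Set (F →L[ℂ] F)) = conjAct U g '' C := rfl

theorem translate_translate (g h : Γ) (C : NonUnitalStarSubalgebra ℂ (F →L[ℂ] F)) :
    translate U g (translate U h C) = translate U (g * h) C := by
  apply SetLike.coe_injective
  rw [coe_translate, coe_translate, coe_translate, Set.image_image]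
  exact Set.image_congr fun x _ => conjAct_conjAct U g h x

theorem translate_one (C : NonUnitalStarSubalgebra ℂ (F →L[ℂ] F)) : translate U 1 C = C := by
  apply SetLike.coe_injective
  rw [coe_translate]
  exact (Set.image_congr fun x _ => conjAct_one U x).trans (Set.image_id _)

theorem translate_mono (g : Γ) {C D : NonUnitalStarSubalgebra ℂ (F →L[ℂ] F)} (h : C ≤ D) :
    translate U g C ≤ translate U g D :=
  Set.image_mono h

theorem mem_translate_iff {g : Γ} {C : NonUnitalStarSubalgebra ℂ (F →L[ℂ] F)} {x : F →L[ℂ] F} :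
    x ∈ translate U g C ↔ conjAct U g⁻¹ x ∈ C := by
  constructor
  · rintro ⟨y, hy, rfl⟩
    rwa [conjAct_inv_conjAct]
  · intro h
    exact ⟨_, h, conjAct_conjAct_inv U g x⟩

theorem isClosed_translate (g : Γ) {C : NonUnitalStarSubalgebra ℂ (F →L[ℂ] F)}
    (hC : IsClosed (C : Set (F →L[ℂ] F))) : IsClosed (translate U g C : Set (F →L[ℂ] F)) := by
  have : (translate U g C : Set (F →L[ℂ] F)) = conjAct U g⁻¹ ⁻¹' C := by
    ext x; exact mem_translate_iff
  rw [this]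
  exact hC.preimage (continuous_conjAct U _)

theorem translate_eq_bot {g : Γ} {C : NonUnitalStarSubalgebra ℂ (F →L[ℂ] F)}
    (h : translate U g C = ⊥) : C = ⊥ := by
  rw [eq_bot_iff_forall] at h ⊢
  exact fun x hx => conjAct_eq_zero U (h _ (conjAct_mem_translate g hx))

theorem IsIrred.translate {C : NonUnitalStarSubalgebra ℂ (F →L[ℂ] F)} (hC : IsIrred C) (g : Γ) :
    IsIrred (translate U g C) := by
  intro I J hI hJ hIC hJC hIJ hsum
  have hle : ∀ {I}, I ≤ NCCov.translate U g C → NCCov.translate U g⁻¹ I ≤ C := fun {I} h => by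
    have := translate_mono (U := U) g⁻¹ h
    rwa [translate_translate, inv_mul_cancel, translate_one] at this
  refine (hC (NCCov.translate U g⁻¹ I) (NCCov.translate U g⁻¹ J) (isClosed_translate _ hI)
    (isClosed_translate _ hJ) (hle hIC) (hle hJC) ?_ ?_).imp translate_eq_bot translate_eq_bot
  · rintro _ ⟨x, hx, rfl⟩ _ ⟨y, hy, rfl⟩
    rw [← conjAct_mul, hIJ x hx y hy, conjAct_zero]
  · intro c hc
    obtain ⟨x, hx, y, hy, h⟩ := hsum _ (conjAct_mem_translate g hc)
    refine ⟨_, conjAct_mem_translate g⁻¹ hx, _, conjAct_mem_translate g⁻¹ hy, ?_⟩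
    have h1 := congrArg (conjAct U g⁻¹) h
    rwa [conjAct_inv_conjAct, conjAct_add] at h1

/-- The two-sided annihilator of an algebra of operators. -/
def annihilator (C : NonUnitalStarSubalgebra ℂ (F →L[ℂ] F)) :
    NonUnitalStarSubalgebra ℂ (F →L[ℂ] F) where
  carrier := {y | ∀ x ∈ C, x * y = 0 ∧ y * x = 0}
  zero_mem' := fun x _ => ⟨mul_zero x, zero_mul x⟩
  add_mem' := fun hy hz x hx => ⟨by rw [mul_add, (hy x hx).1, (hz x hx).1, add_zero],
    by rw [add_mul, (hy x hx).2, (hz x hx).2, add_zero]⟩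
  mul_mem' := fun hy hz x hx => ⟨by rw [← mul_assoc, (hy x hx).1, zero_mul],
    by rw [mul_assoc, (hz x hx).2, mul_zero]⟩
  smul_mem' := fun c y hy x hx => ⟨by rw [mul_smul_comm, (hy x hx).1, smul_zero],
    by rw [smul_mul_assoc, (hy x hx).2, smul_zero]⟩
  star_mem' := fun {y} hy x hx => by
    obtain ⟨h1, h2⟩ := hy _ (star_mem hx)
    constructor
    · have := congrArg star h2; rwa [star_mul, star_star, star_zero] at this
    · have := congrArg star h1; rwa [star_mul, star_star, star_zero] at this

theorem isClosed_annihilator (C : NonUnitalStarSubalgebra ℂ (F →L[ℂ] F)) :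
    IsClosed (annihilator C : Set (F →L[ℂ] F)) := by
  have : (annihilator C : Set (F →L[ℂ] F)) =
      ⋂ x ∈ C, ({y | x * y = 0} ∩ {y | y * x = 0}) := by
    ext y; simp only [Set.mem_iInter]; rfl
  rw [this]
  exact isClosed_biInter fun x _ =>
    (isClosed_eq (continuous_const_mul x) continuous_const).inter
      (isClosed_eq (continuous_mul_const x) continuous_const)

theorem norm_le_norm_add_of_mem_annihilator {C : NonUnitalStarSubalgebra ℂ (F →L[ℂ] F)}
    {x y : F →L[ℂ] F} (hx : x ∈ C) (hy : y ∈ annihilator C) : ‖x‖ ≤ ‖x + y‖ := by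
  rcases eq_or_ne x 0 with rfl | h0
  · simp
  have h1 : ‖x‖ * ‖x‖ ≤ ‖x‖ * ‖x + y‖ := by
    rw [← CStarRing.norm_star_mul_self (x := x)]
    have : star x * x = star x * (x + y) := by rw [mul_add, (hy _ (star_mem hx)).1, add_zero]
    rw [this, ← norm_star x]
    exact norm_mul_le _ _
  exact le_of_mul_le_mul_left h1 (norm_pos_iff.2 h0)

/-- The sum of a C*-algebra of operators and its annihilator is closed. -/
theorem isClosed_add_annihilator {C : NonUnitalStarSubalgebra ℂ (F →L[ℂ] F)}
    (hC : IsClosed (C : Set (F →L[ℂ] F))) :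
    IsClosed {a : F →L[ℂ] F | ∃ x ∈ C, a - x ∈ annihilator C} := by
  rw [← isSeqClosed_iff_isClosed]
  intro a b ha hab
  choose x hx hax using ha
  have hcau : CauchySeq x := by
    rw [Metric.cauchySeq_iff]
    intro ε hε
    obtain ⟨N, hN⟩ := Metric.cauchySeq_iff.1 hab.cauchySeq ε hε
    refine ⟨N, fun m hm n hn => lt_of_le_of_lt ?_ (hN m hm n hn)⟩
    rw [dist_eq_norm, dist_eq_norm]
    have := norm_le_norm_add_of_mem_annihilator (sub_mem (hx m) (hx n))
      (sub_mem (hax m) (hax n))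
    rwa [show x m - x n + (a m - x m - (a n - x n)) = a m - a n by abel] at this
  obtain ⟨y, hy⟩ := cauchySeq_tendsto_of_complete hcau
  exact ⟨y, hC.mem_of_tendsto hy (Eventually.of_forall hx),
    (isClosed_annihilator C).mem_of_tendsto (hab.sub hy) (Eventually.of_forall hax)⟩

variable (U) in
/-- The translates `g C` span a dense subspace of `A`, and they are pairwise equal or
orthogonal. -/
structure IsSumOfTranslates (C A : NonUnitalStarSubalgebra ℂ (F →L[ℂ] F)) : Prop where
  isClosed : IsClosed (C : Set (F →L[ℂ] F))
  orthogonal : ∀ g, translate U g C ≠ C → ∀ x ∈ C, ∀ y ∈ translate U g C, x * y = 0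
  dense : closure (Submodule.span ℂ {t | ∃ g, t ∈ translate U g C} : Set (F →L[ℂ] F)) = A

namespace IsSumOfTranslates

variable {C A : NonUnitalStarSubalgebra ℂ (F →L[ℂ] F)}

theorem translate_le (h : IsSumOfTranslates U C A) (g : Γ) : translate U g C ≤ A := fun x hx => by
  rw [← SetLike.mem_coe, ← h.dense]
  exact subset_closure (Submodule.subset_span ⟨g, hx⟩)

theorem le (h : IsSumOfTranslates U C A) : C ≤ A := by
  have := h.translate_le 1
  rwa [translate_one] at this

theorem translate_eq_of_not_orthogonal (h : IsSumOfTranslates U C A) {g k : Γ}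
    {x y : F →L[ℂ] F} (hx : x ∈ translate U g C) (hy : y ∈ translate U k C) (hxy : x * y ≠ 0) :
    translate U g C = translate U k C := by
  have h1 : translate U (g⁻¹ * k) C = C := by
    by_contra hne
    apply hxy
    have h2 := h.orthogonal _ hne _ (mem_translate_iff.1 hx) (conjAct U g⁻¹ y) (by
      rw [← translate_translate]; exact conjAct_mem_translate _ hy)
    rw [← conjAct_mul] at h2
    exact conjAct_eq_zero U h2
  have h2 := congrArg (translate U g) h1
  rw [translate_translate, mul_inv_cancel_left] at h2
  exact h2.symm

/-- Every translate is a direct summand. -/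
theorem exists_sub_mem_annihilator (h : IsSumOfTranslates U C A) (g : Γ) {a : F →L[ℂ] F}
    (ha : a ∈ A) : ∃ x ∈ translate U g C, a - x ∈ annihilator (translate U g C) := by
  have hcl := isClosed_add_annihilator (isClosed_translate (U := U) g h.isClosed)
  rw [← SetLike.mem_coe, ← h.dense] at ha
  refine closure_minimal (fun b hb => ?_) hcl ha
  refine Submodule.span_induction (p := fun b _ => ∃ x ∈ translate U g C,
    b - x ∈ annihilator (translate U g C)) ?_ ?_ ?_ ?_ hb
  · rintro b ⟨k, hk⟩
    by_cases hgk : translate U g C = translate U k C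
    · exact ⟨b, hgk ▸ hk, by rw [sub_self]; exact zero_mem _⟩
    · refine ⟨0, zero_mem _, fun x hx => ?_⟩
      rw [sub_zero]
      constructor
      · by_contra h0
        exact hgk (h.translate_eq_of_not_orthogonal hx hk h0)
      · by_contra h0
        exact hgk (h.translate_eq_of_not_orthogonal hk hx h0).symm
  · exact ⟨0, zero_mem _, by rw [sub_self]; exact zero_mem _⟩
  · rintro b c - - ⟨x, hx, hbx⟩ ⟨y, hy, hcy⟩
    refine ⟨x + y, add_mem hx hy, ?_⟩
    rw [add_sub_add_comm]; exact add_mem hbx hcy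
  · rintro r b - ⟨x, hx, hbx⟩
    refine ⟨r • x, SMulMemClass.smul_mem r hx, ?_⟩
    rw [← smul_sub]; exact SMulMemClass.smul_mem r hbx

theorem eq_bot (h : IsSumOfTranslates U C A) (hC : C = ⊥) : A = ⊥ := by
  rw [eq_bot_iff_forall] at hC ⊢
  intro a ha
  rw [← SetLike.mem_coe, ← h.dense] at ha
  have h1 : a ∈ ({0} : Set (F →L[ℂ] F)) := by
    refine closure_minimal (fun b hb => ?_) isClosed_singleton ha
    refine (Submodule.span_le (p := (⊥ : Submodule ℂ (F →L[ℂ] F)))).2 ?_ hb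
    rintro _ ⟨g, c, hc, rfl⟩
    rw [hC c hc, conjAct_zero]
    exact zero_mem _
  exact h1

/-- An irreducible `C` is a maximal irreducible C*-subalgebra of the closed sum of its
translates. -/
theorem maximal (h : IsSumOfTranslates U C A) (hC : IsIrred C) :
    Maximal (fun D : NonUnitalStarSubalgebra ℂ (F →L[ℂ] F) =>
      IsClosed (D : Set (F →L[ℂ] F)) ∧ D ≤ A ∧ IsIrred D) C := by
  refine ⟨⟨h.isClosed, h.le, hC⟩, fun D ⟨hDc, hDA, hD⟩ hCD => ?_⟩
  have hdec : ∀ a ∈ A, ∃ x ∈ C, a - x ∈ annihilator C := fun a ha => by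
    have := h.exists_sub_mem_annihilator 1 ha
    rwa [translate_one] at this
  rcases hD C (D ⊓ annihilator C) h.isClosed (hDc.inter (isClosed_annihilator C)) hCD inf_le_left
    (fun x hx y hy => (hy.2 x hx).1) (fun d hd => by
      obtain ⟨x, hx, hy⟩ := hdec d (hDA hd)
      exact ⟨x, hx, d - x, ⟨sub_mem hd (hCD hx), hy⟩, by abel⟩) with h0 | h0
  · have := h.eq_bot h0
    exact hDA.trans (this.trans h0.symm).le
  · intro d hd
    obtain ⟨x, hx, hy⟩ := hdec d (hDA hd)
    have h1 : d - x ∈ D ⊓ annihilator C := ⟨sub_mem hd (hCD hx), hy⟩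
    have h2 : d = x := sub_eq_zero.1 (eq_bot_iff_forall.1 h0 _ h1)
    rwa [h2]

theorem mul_mem_component (h : IsSumOfTranslates U C A) {a c : F →L[ℂ] F} (ha : a ∈ A)
    (hc : c ∈ C) :
    a * c ∈ C := by
  obtain ⟨x, hx, hy⟩ := h.exists_sub_mem_annihilator 1 ha
  rw [translate_one] at hx hy
  have := (hy c hc).2
  rw [sub_mul, sub_eq_zero] at this
  rw [this]
  exact mul_mem hx hc

/-- Two maximal irreducible C*-subalgebras, each of whose translates sum up to `A`, are
translates of each other. -/
theorem exists_eq_translate {D : NonUnitalStarSubalgebra ℂ (F →L[ℂ] F)}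
    (hCA : IsSumOfTranslates U C A) (hC : IsIrred C) (hDA : IsSumOfTranslates U D A)
    (hD : IsIrred D) : ∃ g, D = translate U g C := by
  rcases eq_or_ne D ⊥ with hD0 | hD0
  · refine ⟨1, ?_⟩
    have hA := hDA.eq_bot hD0
    have := hCA.le
    rw [hA] at this
    rw [translate_one, hD0]
    exact (eq_bot_iff_forall.2 fun x hx => NonUnitalStarAlgebra.mem_bot.1 (this hx)).symm
  -- some translate of `C` is not orthogonal to `D`
  obtain ⟨g, d, hd, c, hc, hdc⟩ : ∃ g, ∃ d ∈ D, ∃ c ∈ translate U g C, d * c ≠ 0 := by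
    by_contra hcon
    push Not at hcon
    refine hD0 (eq_bot_iff_forall.2 fun d hd => ?_)
    have h1 : ∀ a ∈ A, star d * a = 0 := by
      intro a ha
      rw [← SetLike.mem_coe, ← hCA.dense] at ha
      have hcl : IsClosed {a : F →L[ℂ] F | star d * a = 0} :=
        isClosed_eq (continuous_const_mul _) continuous_const
      refine closure_minimal (fun b hb => ?_) hcl ha
      refine Submodule.span_induction (p := fun b _ => star d * b = 0) ?_ (mul_zero _) ?_ ?_ hb
      · rintro b ⟨g, hg⟩
        exact hcon g _ (star_mem hd) b hg
      · intro b b' _ _ hb hb'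
        rw [mul_add, hb, hb', add_zero]
      · intro r b _ hb
        rw [mul_smul_comm, hb, smul_zero]
    exact (CStarRing.star_mul_self_eq_zero_iff d).1 (h1 d (hDA.le hd))
  refine ⟨g, ?_⟩
  have hgC := isClosed_translate (U := U) g hCA.isClosed
  -- `D` is the direct sum of `D ∩ g C` and `D ∩ (g C)^⊥`
  have hdec : ∀ d ∈ D, ∃ x ∈ D ⊓ translate U g C, ∃ y ∈ D ⊓ annihilator (translate U g C),
      d = x + y := by
    intro d hd
    obtain ⟨x, hx, hy⟩ := hCA.exists_sub_mem_annihilator g (hDA.le hd)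
    have hxD : x ∈ D := by
      rw [← SetLike.mem_coe, ← hDA.isClosed.closure_eq, Metric.mem_closure_iff]
      intro ε hε
      obtain ⟨z, hz, hzx⟩ := exists_norm_sub_mul_mul_self_lt hgC hx hε
      refine ⟨z * x, ?_, by rwa [dist_eq_norm]⟩
      have h1 := (hy z hz).1
      rw [mul_sub, sub_eq_zero] at h1
      rw [SetLike.mem_coe, ← h1]
      exact hDA.mul_mem_component (hCA.translate_le g hz) hd
    exact ⟨x, ⟨hxD, hx⟩, d - x, ⟨sub_mem hd hxD, hy⟩, by abel⟩
  have hle : D ≤ translate U g C := by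
    rcases hD (D ⊓ translate U g C) (D ⊓ annihilator (translate U g C))
      (hDA.isClosed.inter hgC) (hDA.isClosed.inter (isClosed_annihilator _)) inf_le_left inf_le_left
      (fun x hx y hy => (hy.2 x hx.2).1) hdec with h0 | h0
    · exfalso
      obtain ⟨x, hx, y, hy, rfl⟩ := hdec d hd
      have hx0 : x = 0 := eq_bot_iff_forall.1 h0 x hx
      rw [hx0, zero_add, (hy.2 c hc).2] at hdc
      exact hdc rfl
    · intro d hd
      obtain ⟨x, hx, y, hy, rfl⟩ := hdec d hd
      have hy0 : y = 0 := eq_bot_iff_forall.1 h0 y hy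
      rw [hy0, add_zero]
      exact hx.2
  exact le_antisymm hle ((hDA.maximal hD).2 ⟨hgC, hCA.translate_le g, hC.translate g⟩ hle)

end IsSumOfTranslates

end Translates

/-! ### Components and stabilization -/

section StabComponent

variable {F : Type*} [NormedAddCommGroup F] [InnerProductSpace ℂ F] [CompleteSpace F]
  {H : Type*} [NormedAddCommGroup H] [InnerProductSpace ℂ H] [CompleteSpace H]

/-- The elements `x` of an algebra with `x ⊗ |e⟩⟨e|` in a given algebra `I`. -/
noncomputable def corner {e : H} (he : ‖e‖ = 1) (C : NonUnitalStarSubalgebra ℂ (F →L[ℂ] F))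
    (I : NonUnitalStarSubalgebra ℂ (HTensor F H →L[ℂ] HTensor F H)) :
    NonUnitalStarSubalgebra ℂ (F →L[ℂ] F) where
  carrier := {x | x ∈ C ∧ opTensor x (rankOne ℂ e e) ∈ I}
  zero_mem' := ⟨zero_mem C, by rw [opTensor_zero_left]; exact zero_mem I⟩
  add_mem' := fun hx hy => ⟨add_mem hx.1 hy.1, by
    rw [opTensor_add_left]; exact add_mem hx.2 hy.2⟩
  mul_mem' := fun {x y} hx hy => ⟨mul_mem hx.1 hy.1, by
    rw [← rankOne_mul_rankOne_of_norm_eq_one he, opTensor_mul]; exact mul_mem hx.2 hy.2⟩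
  smul_mem' := fun c x hx => ⟨SMulMemClass.smul_mem c hx.1, by
    rw [opTensor_smul_left]; exact SMulMemClass.smul_mem c hx.2⟩
  star_mem' := fun {x} hx => ⟨star_mem hx.1, by
    rw [← star_opTensor_rankOne]; exact star_mem hx.2⟩

theorem isClosed_corner {e : H} (he : ‖e‖ = 1) {C : NonUnitalStarSubalgebra ℂ (F →L[ℂ] F)}
    {I : NonUnitalStarSubalgebra ℂ (HTensor F H →L[ℂ] HTensor F H)}
    (hC : IsClosed (C : Set (F →L[ℂ] F)))
    (hI : IsClosed (I : Set (HTensor F H →L[ℂ] HTensor F H))) :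
    IsClosed (corner he C I : Set (F →L[ℂ] F)) :=
  hC.inter (hI.preimage (continuous_opTensor_left _))

/-- The slices of the elements of an ideal of `C ⊗ 𝒦` lie in its corner. -/
theorem slice_mem_corner {e : H} (he : ‖e‖ = 1) {C : NonUnitalStarSubalgebra ℂ (F →L[ℂ] F)}
    {I : NonUnitalStarSubalgebra ℂ (HTensor F H →L[ℂ] HTensor F H)}
    (hC : IsClosed (C : Set (F →L[ℂ] F)))
    (hI : IsClosed (I : Set (HTensor F H →L[ℂ] HTensor F H))) (hIC : I ≤ stabAlg H C)
    (hideal : ∀ P ∈ stabAlg H C, ∀ X ∈ I, ∀ Q ∈ stabAlg H C, P * X * Q ∈ I)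
    {X : HTensor F H →L[ℂ] HTensor F H} (hX : X ∈ I) (ξ η : H) :
    slice ξ η X ∈ corner he C I := by
  have hx : slice ξ η X ∈ C := slice_mem_of_mem_stabAlg hC (hIC hX) ξ η
  -- `z x z'` lies in the corner for all `z`, `z'` in `C`
  have h1 : ∀ z ∈ C, ∀ z' ∈ C, z * slice ξ η X * z' ∈ corner he C I := fun z hz z' hz' =>
    ⟨mul_mem (mul_mem hz hx) hz', by
      rw [← rankOne_mul_mul_rankOne]
      exact hideal _ (opTensor_rankOne_mem_stabAlg hz _ _) _ hX _
        (opTensor_rankOne_mem_stabAlg hz' _ _)⟩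
  have hcl := isClosed_corner he hC hI
  have h2 : ∀ z' ∈ C, slice ξ η X * z' ∈ corner he C I := fun z' hz' => by
    rw [← SetLike.mem_coe, ← hcl.closure_eq, Metric.mem_closure_iff]
    intro ε hε
    obtain ⟨z, hz, hzx⟩ := exists_norm_sub_mul_mul_self_lt hC (mul_mem hx hz') hε
    exact ⟨_, h1 z hz z' hz', by rwa [dist_eq_norm, mul_assoc]⟩
  rw [← SetLike.mem_coe, ← hcl.closure_eq, Metric.mem_closure_iff]
  intro ε hε
  obtain ⟨z, hz, hzx⟩ := exists_norm_sub_mul_mul_self_lt hC (star_mem hx) hε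
  refine ⟨_, h2 (star z) (star_mem hz), ?_⟩
  rw [dist_eq_norm, ← norm_star, star_sub, star_mul, star_star]
  exact hzx

/-- A direct summand of `C ⊗ 𝒦` is an ideal, and so it is determined by its corner, which is a
direct summand of `C`. -/
theorem IsIrred.stabAlg [Nontrivial H] {C : NonUnitalStarSubalgebra ℂ (F →L[ℂ] F)}
    (hC : IsClosed (C : Set (F →L[ℂ] F))) (hirr : IsIrred C) : IsIrred (stabAlg H C) := by
  obtain ⟨e, he⟩ := exists_norm_eq_one (H := H)
  intro I J hI hJ hIC hJC hIJ hsum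
  have hJI : ∀ y ∈ J, ∀ x ∈ I, y * x = 0 := fun y hy x hx => by
    have := congrArg star (hIJ _ (star_mem hx) _ (star_mem hy))
    rwa [star_mul, star_star, star_star, star_zero] at this
  -- direct summands are ideals
  have hidI : ∀ P ∈ NCCov.stabAlg H C, ∀ X ∈ I, ∀ Q ∈ NCCov.stabAlg H C, P * X * Q ∈ I := by
    intro P hP X hX Q hQ
    obtain ⟨P₁, hP₁, P₂, hP₂, rfl⟩ := hsum P hP
    obtain ⟨Q₁, hQ₁, Q₂, hQ₂, rfl⟩ := hsum Q hQ
    rw [add_mul, hJI _ hP₂ _ hX, add_zero, mul_add, hIJ _ (mul_mem hP₁ hX) _ hQ₂, add_zero]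
    exact mul_mem (mul_mem hP₁ hX) hQ₁
  have hidJ : ∀ P ∈ NCCov.stabAlg H C, ∀ X ∈ J, ∀ Q ∈ NCCov.stabAlg H C, P * X * Q ∈ J := by
    intro P hP X hX Q hQ
    obtain ⟨P₁, hP₁, P₂, hP₂, rfl⟩ := hsum P hP
    obtain ⟨Q₁, hQ₁, Q₂, hQ₂, rfl⟩ := hsum Q hQ
    rw [add_mul, hIJ _ hP₁ _ hX, zero_add, mul_add, hJI _ (mul_mem hP₂ hX) _ hQ₁, zero_add]
    exact mul_mem (mul_mem hP₂ hX) hQ₂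
  have hsI : ∀ {X}, X ∈ I → ∀ ξ η, NCCov.slice ξ η X ∈ corner he C I := fun hX ξ η =>
    slice_mem_corner he hC hI hIC hidI hX ξ η
  have hsJ : ∀ {X}, X ∈ J → ∀ ξ η, NCCov.slice ξ η X ∈ corner he C J := fun hX ξ η =>
    slice_mem_corner he hC hJ hJC hidJ hX ξ η
  refine (hirr (corner he C I) (corner he C J) (isClosed_corner he hC hI) (isClosed_corner he hC hJ)
    (fun x hx => hx.1) (fun x hx => hx.1) ?_ ?_).imp ?_ ?_
  · intro x hx y hy
    have h1 := hIJ _ hx.2 _ hy.2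
    rw [← opTensor_mul, rankOne_mul_rankOne_of_norm_eq_one he] at h1
    rw [← slice_opTensor_rankOne_self he (x * y), h1, map_zero]
  · intro c hc
    obtain ⟨X, hX, Y, hY, h⟩ := hsum _ (opTensor_rankOne_mem_stabAlg hc e e)
    refine ⟨_, hsI hX e e, _, hsJ hY e e, ?_⟩
    rw [← map_add, ← h, slice_opTensor_rankOne_self he]
  · intro h
    rw [eq_bot_iff_forall] at h ⊢
    exact fun X hX => ext_slice fun ξ η => by rw [h _ (hsI hX ξ η), map_zero]
  · intro h
    rw [eq_bot_iff_forall] at h ⊢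
    exact fun X hX => ext_slice fun ξ η => by rw [h _ (hsJ hX ξ η), map_zero]

/-- A closed algebra `C` of operators is determined by `C ⊗ 𝒦`. -/
theorem stabAlg_le_iff [Nontrivial H] {C D : NonUnitalStarSubalgebra ℂ (F →L[ℂ] F)}
    (hD : IsClosed (D : Set (F →L[ℂ] F))) : stabAlg H C ≤ stabAlg H D ↔ C ≤ D := by
  obtain ⟨e, he⟩ := exists_norm_eq_one (H := H)
  refine ⟨fun h x hx => ?_, stabAlg_mono⟩
  have := slice_mem_of_mem_stabAlg hD (h (opTensor_rankOne_mem_stabAlg hx e e)) e e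
  rwa [slice_opTensor_rankOne_self he] at this

variable {Γ : Type*} [Group Γ] {U : Γ →* unitary (F →L[ℂ] F)}
  {Γ' : Type*} [Group Γ'] {U' : Γ' →* unitary (HTensor F H →L[ℂ] HTensor F H)}

theorem conjAct_opTensor {γ : Γ'} {g : Γ} (h : U' γ = ampUnitary H (U g)) (x : F →L[ℂ] F)
    (k : H →L[ℂ] H) : conjAct U' γ (opTensor x k) = opTensor (conjAct U g x) k := by
  rw [conjAct, h, ampUnitary_coe, opTensor_star, star_one, ← opTensor_mul, ← opTensor_mul, one_mul,
    mul_one]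
  rfl

theorem translate_stabAlg_le {γ : Γ'} {g : Γ} (h : U' γ = ampUnitary H (U g))
    (C : NonUnitalStarSubalgebra ℂ (F →L[ℂ] F)) :
    translate U' γ (stabAlg H C) ≤ stabAlg H (translate U g C) := by
  rintro _ ⟨X, hX, rfl⟩
  refine stabAlg_induction (p := fun X => conjAct U' γ X ∈ stabAlg H (translate U g C))
    ((stabAlg_isClosed _).preimage (continuous_conjAct U' γ)) ?_ ?_ ?_ hX
  · rw [conjAct_zero]; exact zero_mem _
  · intro S T hS hT
    rw [conjAct_add]; exact add_mem hS hT
  · intro x hx ξ η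
    rw [conjAct_opTensor h]
    exact opTensor_rankOne_mem_stabAlg (conjAct_mem_translate g hx) ξ η

theorem translate_stabAlg {γ : Γ'} {g : Γ} (h : U' γ = ampUnitary H (U g))
    (C : NonUnitalStarSubalgebra ℂ (F →L[ℂ] F)) :
    translate U' γ (stabAlg H C) = stabAlg H (translate U g C) := by
  refine le_antisymm (translate_stabAlg_le h C) ?_
  have hinv : U' γ⁻¹ = ampUnitary H (U g⁻¹) := by rw [map_inv, map_inv, map_inv, h]
  have h1 := translate_mono (U := U') γ (translate_stabAlg_le hinv (translate U g C))
  rwa [translate_translate, translate_translate, mul_inv_cancel, inv_mul_cancel, translate_one,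
    translate_one] at h1

theorem translate_stabAlg_eq_iff [Nontrivial H] {γ : Γ'} {g : Γ} (h : U' γ = ampUnitary H (U g))
    {C : NonUnitalStarSubalgebra ℂ (F →L[ℂ] F)} (hC : IsClosed (C : Set (F →L[ℂ] F))) :
    translate U' γ (stabAlg H C) = stabAlg H C ↔ translate U g C = C := by
  rw [translate_stabAlg h, le_antisymm_iff, le_antisymm_iff, stabAlg_le_iff hC,
    stabAlg_le_iff (isClosed_translate g hC)]

theorem mul_eq_zero_of_mem_stabAlg {C D : NonUnitalStarSubalgebra ℂ (F →L[ℂ] F)}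
    (h : ∀ x ∈ C, ∀ y ∈ D, x * y = 0) {X Y : HTensor F H →L[ℂ] HTensor F H}
    (hX : X ∈ stabAlg H C) (hY : Y ∈ stabAlg H D) : X * Y = 0 := by
  refine stabAlg_induction (p := fun X => X * Y = 0)
    (isClosed_eq (continuous_mul_const Y) continuous_const) (zero_mul _)
    (fun S T hS hT => by rw [add_mul, hS, hT, add_zero]) (fun x hx ξ η => ?_) hX
  refine stabAlg_induction (p := fun Y => opTensor x (rankOne ℂ ξ η) * Y = 0)
    (isClosed_eq (continuous_const_mul _) continuous_const) (mul_zero _)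
    (fun S T hS hT => by rw [mul_add, hS, hT, add_zero]) (fun y hy ξ' η' => ?_) hY
  rw [← opTensor_mul, h x hx y hy, opTensor_zero_left]

theorem IsSumOfTranslates.stabAlg [Nontrivial H] {C A : NonUnitalStarSubalgebra ℂ (F →L[ℂ] F)}
    (h : IsSumOfTranslates U C A) (e : Γ ≃* Γ') (hU : ∀ g, U' (e g) = ampUnitary H (U g)) :
    IsSumOfTranslates U' (stabAlg H C) (stabAlg H A) := by
  refine ⟨stabAlg_isClosed C, fun γ hγ X hX Y hY => ?_, Set.Subset.antisymm ?_ fun T hT => ?_⟩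
  · obtain ⟨g, rfl⟩ := e.surjective γ
    rw [ne_eq, translate_stabAlg_eq_iff (hU g) h.isClosed] at hγ
    rw [translate_stabAlg (hU g)] at hY
    exact mul_eq_zero_of_mem_stabAlg (h.orthogonal g hγ) hX hY
  · refine closure_minimal (fun X hX => ?_) (stabAlg_isClosed A)
    refine Submodule.span_induction (p := fun X _ => X ∈ NCCov.stabAlg H A) ?_ (zero_mem _)
      (fun _ _ _ _ => add_mem) (fun c _ _ hx => SMulMemClass.smul_mem c hx) hX
    rintro X ⟨γ, hγ⟩
    obtain ⟨g, rfl⟩ := e.surjective γ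
    rw [translate_stabAlg (hU g)] at hγ
    exact stabAlg_mono (h.translate_le g) hγ
  · set V := Submodule.span ℂ {t | ∃ γ, t ∈ translate U' γ (NCCov.stabAlg H C)}
    change T ∈ closure (V : Set (HTensor F H →L[ℂ] HTensor F H))
    rw [← Submodule.topologicalClosure_coe]
    refine stabAlg_induction (p := fun T => T ∈ (V.topologicalClosure :
      Set (HTensor F H →L[ℂ] HTensor F H))) V.isClosed_topologicalClosure (zero_mem _)
      (fun _ _ => V.topologicalClosure.add_mem) (fun a ha ξ η => ?_) hT
    rw [← SetLike.mem_coe, ← h.dense] at ha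
    refine closure_minimal (t := (fun a => opTensor a (rankOne ℂ ξ η)) ⁻¹'
      (V.topologicalClosure : Set (HTensor F H →L[ℂ] HTensor F H))) (fun b hb => ?_)
      (V.isClosed_topologicalClosure.preimage (continuous_opTensor_left _)) ha
    refine Submodule.span_induction (p := fun b _ => opTensor b (rankOne ℂ ξ η) ∈
      V.topologicalClosure) ?_ ?_ ?_ ?_ hb
    · rintro b ⟨g, hg⟩
      refine V.le_topologicalClosure (Submodule.subset_span ⟨e g, ?_⟩)
      rw [translate_stabAlg (hU g)]
      exact opTensor_rankOne_mem_stabAlg hg ξ η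
    · rw [opTensor_zero_left]; exact zero_mem _
    · intro b c _ _ hb hc
      rw [opTensor_add_left]; exact add_mem hb hc
    · intro r b _ hb
      rw [opTensor_smul_left]; exact SMulMemClass.smul_mem r hb

end StabComponent

/-! ### Good representations -/

section Good

variable {F : Type*} [NormedAddCommGroup F] [InnerProductSpace ℂ F] [CompleteSpace F]

/-- Operators that multiply an algebra `C` of operators into itself are multipliers of `C`. -/
theorem exists_multiplierHom {B : Type*} [NonUnitalCStarAlgebra B] (φ : B →⋆ₙₐ[ℂ] (F →L[ℂ] F))
    (C : NonUnitalStarSubalgebra ℂ (F →L[ℂ] F)) (hl : ∀ b, ∀ c ∈ C, φ b * c ∈ C)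
    (hr : ∀ b, ∀ c ∈ C, c * φ b ∈ C) :
    ∃ Φ : B →⋆ₙₐ[ℂ] 𝓜(ℂ, C), ∀ (b : B) (c : C),
      ((Φ b).fst c : F →L[ℂ] F) = φ b * c ∧ ((Φ b).snd c : F →L[ℂ] F) = c * φ b := by
  let Lm : B → (C →L[ℂ] C) := fun b => LinearMap.mkContinuous
    { toFun := fun c : C => (⟨φ b * c, hl b c c.2⟩ : C)
      map_add' := fun x y => Subtype.ext (mul_add _ _ _)
      map_smul' := fun r x => Subtype.ext (mul_smul_comm _ _ _) } ‖φ b‖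
    fun c => norm_mul_le (φ b) (c : F →L[ℂ] F)
  let Rm : B → (C →L[ℂ] C) := fun b => LinearMap.mkContinuous
    { toFun := fun c : C => (⟨c * φ b, hr b c c.2⟩ : C)
      map_add' := fun x y => Subtype.ext (add_mul _ _ _)
      map_smul' := fun r x => Subtype.ext (smul_mul_assoc _ _ _) } ‖φ b‖
    fun c => (norm_mul_le (c : F →L[ℂ] F) (φ b)).trans_eq (mul_comm _ _)
  have hext : ∀ {m m' : 𝓜(ℂ, C)}, (∀ c : C, (m.fst c : F →L[ℂ] F) = m'.fst c) →
      (∀ c : C, (m.snd c : F →L[ℂ] F) = m'.snd c) → m = m' := fun {m m'} h h' =>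
    DoubleCentralizer.ext ℂ C m m' (Prod.ext (ContinuousLinearMap.ext fun c => Subtype.ext (h c))
      (ContinuousLinearMap.ext fun c => Subtype.ext (h' c)))
  let f : B → 𝓜(ℂ, C) := fun b => ⟨(Lm b, Rm b), fun x y => Subtype.ext (mul_assoc _ _ _)⟩
  refine ⟨{ toFun := f, map_smul' := ?_, map_zero' := ?_, map_add' := ?_, map_mul' := ?_,
            map_star' := ?_ }, fun b c => ⟨rfl, rfl⟩⟩
  · intro r b
    refine hext (fun c => ?_) fun c => ?_
    · change φ (r • b) * (c : F →L[ℂ] F) = r • (φ b * (c : F →L[ℂ] F))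
      rw [map_smul, smul_mul_assoc]
    · change (c : F →L[ℂ] F) * φ (r • b) = r • ((c : F →L[ℂ] F) * φ b)
      rw [map_smul, mul_smul_comm]
  · refine hext (fun c => ?_) fun c => ?_
    · change φ 0 * (c : F →L[ℂ] F) = 0
      rw [map_zero, zero_mul]
    · change (c : F →L[ℂ] F) * φ 0 = 0
      rw [map_zero, mul_zero]
  · intro a b
    refine hext (fun c => ?_) fun c => ?_
    · change φ (a + b) * (c : F →L[ℂ] F) = φ a * c + φ b * c
      rw [map_add, add_mul]
    · change (c : F →L[ℂ] F) * φ (a + b) = c * φ a + c * φ b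
      rw [map_add, mul_add]
  · intro a b
    refine hext (fun c => ?_) fun c => ?_
    · change φ (a * b) * (c : F →L[ℂ] F) = φ a * (φ b * c)
      rw [map_mul, mul_assoc]
    · change (c : F →L[ℂ] F) * φ (a * b) = c * φ a * φ b
      rw [map_mul, mul_assoc]
  · intro a
    refine hext (fun c => ?_) fun c => ?_
    · change φ (star a) * (c : F →L[ℂ] F) = star (star (c : F →L[ℂ] F) * φ a)
      rw [star_mul, star_star, map_star]
    · change (c : F →L[ℂ] F) * φ (star a) = star (φ a * star (c : F →L[ℂ] F))
      rw [star_mul, star_star, map_star]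

section Group

variable {Γ : Type*} [Group Γ]

/-- The group of all `g` with `g C = C`. -/
def stabGroup (U : Γ →* unitary (F →L[ℂ] F)) (C : NonUnitalStarSubalgebra ℂ (F →L[ℂ] F)) :
    Subgroup Γ where
  carrier := {g | translate U g C = C}
  one_mem' := translate_one C
  mul_mem' := fun {g h} hg hh => by
    change translate U (g * h) C = C
    rw [← translate_translate, show translate U h C = C from hh, show translate U g C = C from hg]
  inv_mem' := fun {g} hg => by
    change translate U g⁻¹ C = C
    nth_rw 1 [← show translate U g C = C from hg]
    rw [translate_translate, inv_mul_cancel, translate_one]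

variable {U : Γ →* unitary (F →L[ℂ] F)} {C A : NonUnitalStarSubalgebra ℂ (F →L[ℂ] F)}

theorem mem_stabGroup {g : Γ} : g ∈ stabGroup U C ↔ translate U g C = C := Iff.rfl

theorem setOf_mem_translate_eq {J : Set Γ}
    (hJ : Subgroup.IsComplement J (stabGroup U C : Set Γ)) :
    {t | ∃ g ∈ J, ∃ x ∈ C, t = conjAct U g x} = {t | ∃ g, t ∈ translate U g C} := by
  ext t
  constructor
  · rintro ⟨g, -, x, hx, rfl⟩
    exact ⟨g, conjAct_mem_translate g hx⟩
  · rintro ⟨g, hg⟩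
    obtain ⟨⟨⟨j, hj⟩, ⟨h, hh⟩⟩, rfl⟩ := hJ.2 g
    rw [← translate_translate, mem_stabGroup.1 hh] at hg
    obtain ⟨x, hx, rfl⟩ := hg
    exact ⟨j, hj, x, hx, rfl⟩

/-- The condition on all sets of representatives can be expressed without representatives. -/
theorem isSumOfTranslates_of_isComplement (hC : IsClosed (C : Set (F →L[ℂ] F)))
    (h : ∀ J : Set Γ, Subgroup.IsComplement J (stabGroup U C : Set Γ) →
      (∀ g ∈ J, ∀ h ∈ J, g ≠ h → ∀ x ∈ C, ∀ y ∈ C, conjAct U g x * conjAct U h y = 0) ∧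
      closure (Submodule.span ℂ {t | ∃ g ∈ J, ∃ x ∈ C, t = conjAct U g x} : Set (F →L[ℂ] F)) = A) :
    IsSumOfTranslates U C A := by
  obtain ⟨J, hJ, h1⟩ := Subgroup.exists_isComplement_left (stabGroup U C) 1
  obtain ⟨h2, h3⟩ := h J hJ
  refine ⟨hC, fun g hg x hx y hy => ?_, by rw [← h3, setOf_mem_translate_eq hJ]⟩
  obtain ⟨⟨⟨j, hj⟩, ⟨k, hk⟩⟩, rfl⟩ := hJ.2 g
  have hk' : translate U k C = C := hk
  change y ∈ translate U (j * k) C at hy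
  change translate U (j * k) C ≠ C at hg
  rw [← translate_translate, hk'] at hy hg
  obtain ⟨y, hy, rfl⟩ := hy
  have hj1 : 1 ≠ j := by
    rintro rfl
    exact hg (translate_one C)
  have := h2 1 h1 j hj hj1 x hx y hy
  rwa [conjAct_one] at this

theorem IsSumOfTranslates.of_isComplement (h : IsSumOfTranslates U C A) {J : Set Γ}
    (hJ : Subgroup.IsComplement J (stabGroup U C : Set Γ)) :
    (∀ g ∈ J, ∀ h ∈ J, g ≠ h → ∀ x ∈ C, ∀ y ∈ C, conjAct U g x * conjAct U h y = 0) ∧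
      closure (Submodule.span ℂ {t | ∃ g ∈ J, ∃ x ∈ C, t = conjAct U g x} : Set (F →L[ℂ] F)) =
        A := by
  refine ⟨fun g hg k hk hgk x hx y hy => ?_, by rw [setOf_mem_translate_eq hJ, h.dense]⟩
  have hne : translate U (g⁻¹ * k) C ≠ C := fun hst => hgk <| by
    have := @hJ.1 (⟨g, hg⟩, ⟨g⁻¹ * k, hst⟩) (⟨k, hk⟩, ⟨1, one_mem (stabGroup U C)⟩) (by simp)
    exact congrArg (fun p => (p.1 : Γ)) this
  have h1 := h.orthogonal _ hne x hx _ (conjAct_mem_translate _ hy)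
  have h2 := congrArg (conjAct U g) h1
  rwa [conjAct_mul, conjAct_conjAct, mul_inv_cancel_left, conjAct_zero] at h2

/-- Conjugation by a unitary identifies an algebra with its translate. -/
theorem nonempty_translate_equiv (g : Γ) (C : NonUnitalStarSubalgebra ℂ (F →L[ℂ] F)) :
    Nonempty (translate U g C ≃⋆ₐ[ℂ] C) := by
  refine ⟨{ toFun := fun x => ⟨conjAct U g⁻¹ x, mem_translate_iff.1 x.2⟩
            invFun := fun x => ⟨conjAct U g x, conjAct_mem_translate g x.2⟩
            left_inv := fun x => Subtype.ext (conjAct_conjAct_inv U g x)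
            right_inv := fun x => Subtype.ext (conjAct_inv_conjAct U g x)
            map_mul' := fun x y => Subtype.ext (conjAct_mul U _ _ _)
            map_add' := fun x y => Subtype.ext (conjAct_add U _ _ _)
            map_star' := fun x => Subtype.ext (conjAct_star U _ _)
            map_smul' := fun r x => Subtype.ext (conjAct_smul U _ _ _) }⟩

theorem stabGroup_translate (g : Γ) :
    stabGroup U (translate U g C) = (stabGroup U C).map (MulAut.conj g).toMonoidHom := by
  ext k
  rw [Subgroup.mem_map_equiv, mem_stabGroup, mem_stabGroup, translate_translate]
  have : (MulAut.conj g).symm k = g⁻¹ * (k * g) := by simp [mul_assoc]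
  rw [this]
  constructor
  · intro h
    rw [← translate_translate, h, translate_translate, inv_mul_cancel, translate_one]
  · intro h
    have h1 := congrArg (translate U g) h
    rwa [translate_translate, mul_inv_cancel_left] at h1

theorem nonempty_stabGroup_translate_equiv (g : Γ) (C : NonUnitalStarSubalgebra ℂ (F →L[ℂ] F)) :
    Nonempty (stabGroup U (translate U g C) ≃* stabGroup U C) := by
  rw [stabGroup_translate]
  exact ⟨((stabGroup U C).equivMapOfInjective _ (MulAut.conj g).injective).symm⟩

end Group

namespace CovSeq

variable {S : CovSeq} {L : Type*} [NonUnitalCStarAlgebra L] {ι : ∀ n, S.A n →⋆ₙₐ[ℂ] L}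
  {π : L →⋆ₙₐ[ℂ] (F →L[ℂ] F)} {U : S.LimGal →* unitary (F →L[ℂ] F)}
  {C : NonUnitalStarSubalgebra ℂ (F →L[ℂ] F)}

theorem invGroup_eq_stabGroup (U : S.LimGal →* unitary (F →L[ℂ] F))
    (C : NonUnitalStarSubalgebra ℂ (F →L[ℂ] F)) : S.invGroup U C = stabGroup U C := by
  refine le_antisymm (sSup_le fun G hG g hg => SetLike.coe_injective (hG g hg))
    (le_sSup fun g hg => ?_)
  rw [← coe_translate, mem_stabGroup.1 hg]

theorem IsGoodWith.isSumOfTranslates (h : S.IsGoodWith ι π U C) :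
    IsSumOfTranslates U C (S.disconnLim ι π U) :=
  isSumOfTranslates_of_isComplement h.component.1.1 fun J hJ =>
    h.directSum J (by rwa [invGroup_eq_stabGroup])

theorem IsGoodWith.isIrred (h : S.IsGoodWith ι π U C) : IsIrred C := h.component.1.2.2

theorem IsGoodWith.mul_mem (h : S.IsGoodWith ι π U C) (a : L) {c : F →L[ℂ] F} (hc : c ∈ C) :
    π a * c ∈ C := by
  obtain ⟨Φ, -, hΦ⟩ := h.multiplier
  rw [← (hΦ a ⟨c, hc⟩).1]
  exact SetLike.coe_mem _

theorem IsGoodWith.mul_mem' (h : S.IsGoodWith ι π U C) (a : L) {c : F →L[ℂ] F} (hc : c ∈ C) :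
    c * π a ∈ C := by
  obtain ⟨Φ, -, hΦ⟩ := h.multiplier
  rw [← (hΦ a ⟨c, hc⟩).2]
  exact SetLike.coe_mem _

theorem IsGoodWith.eq_zero_of_mul (h : S.IsGoodWith ι π U C) {a : L}
    (ha : ∀ c ∈ C, π a * c = 0) : a = 0 := by
  obtain ⟨Φ, hinj, hΦ⟩ := h.multiplier
  have ha' : ∀ c ∈ C, c * π a = 0 := fun c hc => by
    have h1 := ha _ (star_mem (h.mul_mem' a hc))
    refine CStarRing.mul_star_self_eq_zero_iff _ |>.1 ?_
    rw [mul_assoc, h1, mul_zero]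
  refine hinj ?_
  rw [map_zero]
  refine DoubleCentralizer.ext ℂ C _ _ (Prod.ext (ContinuousLinearMap.ext fun c => Subtype.ext ?_)
    (ContinuousLinearMap.ext fun c => Subtype.ext ?_))
  · exact (hΦ a c).1.trans (ha c c.2)
  · exact (hΦ a c).2.trans (ha' c c.2)

/-- A criterion for a representation to be good. -/
theorem isGoodWith_of (hrep : S.IsEquivariantRep ι π U)
    (hC : IsSumOfTranslates U C (S.disconnLim ι π U)) (hirr : IsIrred C)
    (hl : ∀ a, ∀ c ∈ C, π a * c ∈ C) (hinj : ∀ a, (∀ c ∈ C, π a * c = 0) → a = 0)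
    (hsurj : ∀ n (δ : S.gal 0 n), ∃ g, translate U g C = C ∧ S.proj n g = δ) :
    S.IsGoodWith ι π U C := by
  have hr : ∀ a, ∀ c ∈ C, c * π a ∈ C := fun a c hc => by
    have := star_mem (hl (star a) (star c) (star_mem hc))
    rwa [star_mul, star_star, map_star, star_star] at this
  refine ⟨hrep, hC.maximal hirr, ?_, fun J hJ => ?_, fun n => ?_⟩
  · obtain ⟨Φ, hΦ⟩ := exists_multiplierHom π C hl hr
    refine ⟨Φ, (injective_iff_map_eq_zero _).2 fun a ha => hinj a fun c hc => ?_, hΦ⟩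
    rw [← (hΦ a ⟨c, hc⟩).1, ha]
    rfl
  · rw [invGroup_eq_stabGroup] at hJ
    exact hC.of_isComplement hJ
  · rw [invGroup_eq_stabGroup, eq_top_iff]
    rintro δ -
    obtain ⟨g, hg, rfl⟩ := hsurj n δ
    exact ⟨g, hg, rfl⟩

theorem IsGoodWith.exists_proj_eq (h : S.IsGoodWith ι π U C) (n : ℕ) (δ : S.gal 0 n) :
    ∃ g, translate U g C = C ∧ S.proj n g = δ := by
  have h1 : δ ∈ (S.invGroup U C).map (S.proj n) := h.surjective n ▸ Subgroup.mem_top δ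
  rw [invGroup_eq_stabGroup] at h1
  obtain ⟨g, hg, rfl⟩ := h1
  exact ⟨g, hg, rfl⟩

end CovSeq

end Good

/-! ### Independence of the unitary representation -/

section Unique

/-- If a series is summable over each member of a decreasing sequence of sets with intersection
`{o}`, then its partial sums over these sets converge to the term at `o`. -/
theorem tendsto_of_hasSum_subtype {F : Type*} [NormedAddCommGroup F] [CompleteSpace F] {Γ : Type*}
    {o : Γ} {f : Γ → F} {K : ℕ → Set Γ} (hK : Antitone K) (ho : ∀ n, o ∈ K n)
    (hinter : ∀ g, (∀ n, g ∈ K n) → g = o) {s : ℕ → F}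
    (hs : ∀ n, HasSum (fun g : K n => f g) (s n)) : Tendsto s atTop (𝓝 (f o)) := by
  classical
  have hs' : ∀ n, HasSum ((K n).indicator f) (s n) := fun n => hasSum_subtype_iff_indicator.1 (hs n)
  rw [Metric.tendsto_atTop]
  intro ε hε
  obtain ⟨T, hT⟩ := summable_iff_vanishing_norm.1 (hs' 0).summable (ε / 2) (by positivity)
  have hev : ∀ᶠ n in atTop, ∀ g ∈ T, g ≠ o → g ∉ K n := by
    refine (Finset.eventually_all T).2 fun g _ => ?_
    by_cases hg : g = o
    · exact Eventually.of_forall fun n h => absurd hg h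
    · have : ∃ n, g ∉ K n := by
        by_contra h
        push Not at h
        exact hg (hinter g h)
      obtain ⟨N, hN⟩ := this
      exact eventually_atTop.2 ⟨N, fun n hn _ h => hN (hK hn h)⟩
  obtain ⟨N, hN⟩ := eventually_atTop.1 hev
  refine ⟨N, fun n hn => ?_⟩
  have h1 : HasSum (fun g => (K n).indicator f g - if g = o then f o else 0) (s n - f o) :=
    (hs' n).sub (hasSum_ite_eq o (f o))
  have h2 : ∀ g, ((K n).indicator f g - if g = o then f o else 0) =
      if g ∈ K n ∧ g ≠ o then (K 0).indicator f g else 0 := by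
    intro g
    by_cases hg : g = o
    · subst hg; simp [ho]
    · by_cases hgn : g ∈ K n
      · simp [hg, hgn, hK (Nat.zero_le n) hgn]
      · simp [hg, hgn]
  rw [dist_eq_norm]
  refine lt_of_le_of_lt (le_of_tendsto h1.norm (Eventually.of_forall fun t => ?_)) (half_lt_self hε)
  simp only [h2]
  rw [← Finset.sum_filter]
  refine (hT _ ?_).le
  rw [Finset.disjoint_left]
  intro g hg hgT
  have := (Finset.mem_filter.1 hg).2
  exact hN n hn g hgT this.2 this.1

variable {F : Type*} [NormedAddCommGroup F] [InnerProductSpace ℂ F] [CompleteSpace F]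

namespace CovSeq

variable {S : CovSeq} {L : Type*} [NonUnitalCStarAlgebra L] {ι : ∀ n, S.A n →⋆ₙₐ[ℂ] L}
  {π : L →⋆ₙₐ[ℂ] (F →L[ℂ] F)} {U V : S.LimGal →* unitary (F →L[ℂ] F)}
  {C D : NonUnitalStarSubalgebra ℂ (F →L[ℂ] F)}

theorem map_injective (hι : S.IsInductiveLimit ι) {k m : ℕ} (h : k ≤ m) :
    Function.Injective (S.map h) := fun a b hab => hι.injective k (by
  rw [← hι.compat h, ← hι.compat h, hab])

theorem proj_eq_one_of_le (hι : S.IsInductiveLimit ι) {k m : ℕ} (h : k ≤ m) {g : S.LimGal}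
    (hg : S.proj m g = 1) : S.proj k g = 1 := by
  refine Subtype.ext (StarAlgEquiv.ext fun a => map_injective hι h ?_)
  have h1 := g.2 k m h a
  have h2 : (g.1 m : S.A m ≃⋆ₐ[ℂ] S.A m) = 1 := congrArg Subtype.val hg
  rw [h2] at h1
  exact h1.symm

theorem eq_one_of_forall_proj {g : S.LimGal} (h : ∀ n, S.proj n g = 1) : g = 1 :=
  Subtype.ext (funext h)

/-- An operator is the strong limit of its sums over the kernels of `Ĝ → G(A_n | A)`. -/
theorem tendsto_of_hasStrongSum (hι : S.IsInductiveLimit ι) {x : F →L[ℂ] F}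
    {s : ℕ → F →L[ℂ] F} (hs : ∀ n, S.HasStrongSum U n x (s n)) (ξ : F) :
    Tendsto (fun n => s n ξ) atTop (𝓝 (x ξ)) := by
  have := tendsto_of_hasSum_subtype (o := (1 : S.LimGal)) (f := fun g => conjAct U g x ξ)
    (K := fun n => ((S.proj n).ker : Set S.LimGal)) (fun k m h g hg => proj_eq_one_of_le hι h hg)
    (fun n => one_mem (S.proj n).ker) (fun g hg => eq_one_of_forall_proj hg) (fun n => hs n ξ)
  simpa only [conjAct_one] using this

/-- The action of `Ĝ` on the operators whose series converge to elements of the algebras `A_n` does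
not depend on the unitary representation, since these operators are strong limits of
elements of `Â`. -/
theorem conjAct_eq_of_sumsInto (hι : S.IsInductiveLimit ι) (hU : S.IsEquivariantRep ι π U)
    (hV : S.IsEquivariantRep ι π V) {x : F →L[ℂ] F} (hx : ∀ n, S.SumsInto ι π U n x)
    (g : S.LimGal) : conjAct U g x = conjAct V g x := by
  choose a ha using hx
  have hlim := tendsto_of_hasStrongSum hι ha
  have key : ∀ W : S.LimGal →* unitary (F →L[ℂ] F), S.IsEquivariantRep ι π W → ∀ ξ,
      Tendsto (fun n => π (ι n ((S.proj n g : S.A n ≃⋆ₐ[ℂ] S.A n) (a n))) ξ) atTop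
        (𝓝 (conjAct W g x ξ)) := by
    intro W hW ξ
    have h1 := ((W g : F →L[ℂ] F).continuous.tendsto _).comp (hlim (star (W g : F →L[ℂ] F) ξ))
    refine h1.congr fun n => ?_
    rw [hW.equivariant]
    rfl
  exact ContinuousLinearMap.ext fun ξ => tendsto_nhds_unique (key U hU ξ) (key V hV ξ)

theorem HasStrongSum.congr {x s : F →L[ℂ] F} (h : ∀ g, conjAct U g x = conjAct V g x) {n : ℕ} :
    S.HasStrongSum U n x s ↔ S.HasStrongSum V n x s := by
  simp only [HasStrongSum, h]

theorem SumsInto.congr (hι : S.IsInductiveLimit ι) (hU : S.IsEquivariantRep ι π U)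
    (hV : S.IsEquivariantRep ι π V) {x : F →L[ℂ] F} (hx : ∀ n, S.SumsInto ι π U n x) (n : ℕ) :
    S.SumsInto ι π V n x := by
  obtain ⟨a, ha⟩ := hx n
  exact ⟨a, (HasStrongSum.congr (conjAct_eq_of_sumsInto hι hU hV hx)).1 ha⟩

theorem IsSpecial.congr (hι : S.IsInductiveLimit ι) (hU : S.IsEquivariantRep ι π U)
    (hV : S.IsEquivariantRep ι π V) {x : F →L[ℂ] F} (hx : S.IsSpecial ι π U x) :
    S.IsSpecial ι π V x := by
  refine ⟨hx.positive, SumsInto.congr hι hU hV hx.sum,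
    fun n z => SumsInto.congr hι hU hV (fun n => hx.sum_conj n z) n,
    fun n z => SumsInto.congr hι hU hV (fun n => hx.sum_sq n z) n,
    fun n z ε hε => SumsInto.congr hι hU hV (fun n => hx.sum_cut n z ε hε) n, fun z ε hε => ?_⟩
  obtain ⟨N, hN⟩ := hx.norm_lt z ε hε
  refine ⟨N, fun n hn b c hb hc => hN n hn b c ?_ ?_⟩
  · exact (HasStrongSum.congr
      (conjAct_eq_of_sumsInto hι hU hV fun n => hx.sum_conj n z)).2 hb
  · exact (HasStrongSum.congr
      (conjAct_eq_of_sumsInto hι hU hV fun n => hx.sum_sq n z)).2 hc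

theorem disconnLim_congr (hι : S.IsInductiveLimit ι) (hU : S.IsEquivariantRep ι π U)
    (hV : S.IsEquivariantRep ι π V) : S.disconnLim ι π U = S.disconnLim ι π V := by
  rw [disconnLim_eq_genAlg, disconnLim_eq_genAlg]
  congr 1
  ext x
  exact ⟨IsSpecial.congr hι hU hV, IsSpecial.congr hι hV hU⟩

theorem conjAct_rep_congr (hι : S.IsInductiveLimit ι) (hU : S.IsEquivariantRep ι π U)
    (hV : S.IsEquivariantRep ι π V) (g : S.LimGal) (x : L) :
    conjAct U g (π x) = conjAct V g (π x) := by
  have hcl : IsClosed {x : L | conjAct U g (π x) = conjAct V g (π x)} :=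
    isClosed_eq ((continuous_conjAct U g).comp (map_continuous π))
      ((continuous_conjAct V g).comp (map_continuous π))
  refine closure_minimal (fun y hy => ?_) hcl (hι.dense x)
  obtain ⟨n, a, rfl⟩ := Set.mem_iUnion.1 hy
  exact (hU.equivariant g n a).symm.trans (hV.equivariant g n a)

theorem conjAct_congr (hι : S.IsInductiveLimit ι) (hU : S.IsEquivariantRep ι π U)
    (hV : S.IsEquivariantRep ι π V) (g : S.LimGal) {x : F →L[ℂ] F}
    (hx : x ∈ S.disconnLim ι π U) : conjAct U g x = conjAct V g x := by
  let M : NonUnitalStarSubalgebra ℂ (F →L[ℂ] F) :=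
    { carrier := {x | conjAct U g x = conjAct V g x}
      zero_mem' := (conjAct_zero U g).trans (conjAct_zero V g).symm
      add_mem' := fun {x y} (hx : _ = _) (hy : _ = _) => by
        change _ = _
        rw [conjAct_add, conjAct_add, hx, hy]
      mul_mem' := fun {x y} (hx : _ = _) (hy : _ = _) => by
        change _ = _
        rw [conjAct_mul, conjAct_mul, hx, hy]
      smul_mem' := fun c x (hx : _ = _) => by
        change _ = _
        rw [conjAct_smul, conjAct_smul, hx]
      star_mem' := fun {x} (hx : _ = _) => by
        change _ = _
        rw [conjAct_star, conjAct_star, hx] }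
  have hM : IsClosed (M : Set (F →L[ℂ] F)) :=
    isClosed_eq (continuous_conjAct U g) (continuous_conjAct V g)
  rw [disconnLim_eq_genAlg] at hx
  refine genAlg_le hM ?_ hx
  rintro _ ⟨x, rfl⟩ _ ⟨y, rfl⟩ a ha
  refine mul_mem (mul_mem ?_ ?_) ?_
  · exact conjAct_rep_congr hι hU hV g x
  · exact conjAct_eq_of_sumsInto hι hU hV ha.sum g
  · exact conjAct_rep_congr hι hU hV g y

theorem translate_congr (hι : S.IsInductiveLimit ι) (hU : S.IsEquivariantRep ι π U)
    (hV : S.IsEquivariantRep ι π V) (g : S.LimGal) (hC : C ≤ S.disconnLim ι π U) :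
    translate U g C = translate V g C :=
  SetLike.coe_injective (Set.image_congr fun _ hx => conjAct_congr hι hU hV g (hC hx))

/-- Whether a component is an inverse noncommutative limit does not depend on the unitary
representation, and neither does its invariant group. -/
theorem IsGoodWith.stabGroup_congr (hι : S.IsInductiveLimit ι) (hC : S.IsGoodWith ι π U C)
    (hV : S.IsEquivariantRep ι π V) : stabGroup U C = stabGroup V C := by
  ext g
  rw [mem_stabGroup, mem_stabGroup,
    translate_congr hι hC.rep hV g hC.isSumOfTranslates.le]

theorem IsGoodWith.isSumOfTranslates_congr (hι : S.IsInductiveLimit ι)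
    (hC : S.IsGoodWith ι π U C) (hV : S.IsEquivariantRep ι π V) :
    IsSumOfTranslates V C (S.disconnLim ι π V) := by
  have hT := fun g => translate_congr hι hC.rep hV g hC.isSumOfTranslates.le
  obtain ⟨h1, h2, h3⟩ := hC.isSumOfTranslates
  simp only [hT] at h2 h3
  rw [disconnLim_congr hι hC.rep hV] at h3
  exact ⟨h1, h2, h3⟩

/-- The inverse noncommutative limit and its covering group are unique up to isomorphism. -/
theorem IsGoodWith.nonempty_equiv (hι : S.IsInductiveLimit ι) (hC : S.IsGoodWith ι π U C)
    (hD : S.IsGoodWith ι π V D) :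
    Nonempty (D ≃⋆ₐ[ℂ] C) ∧ Nonempty (S.invGroup V D ≃* S.invGroup U C) := by
  obtain ⟨g, hg⟩ := hC.isSumOfTranslates.exists_eq_translate hC.isIrred
    (hD.isSumOfTranslates_congr hι hC.rep) hD.isIrred
  rw [invGroup_eq_stabGroup, invGroup_eq_stabGroup, hD.stabGroup_congr hι hC.rep, hg]
  exact ⟨nonempty_translate_equiv g C, nonempty_stabGroup_translate_equiv g C⟩

end CovSeq

end Unique

/-! ### Good representations of the stabilized sequence -/

section StabGood

variable {F : Type*} [NormedAddCommGroup F] [InnerProductSpace ℂ F] [CompleteSpace F]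
  {H : Type*} [NormedAddCommGroup H] [InnerProductSpace ℂ H] [CompleteSpace H]
  {E : Type*} [NormedAddCommGroup E] [InnerProductSpace ℂ E] [CompleteSpace E]

namespace CovSeq

variable {S : CovSeq} {L : Type*} [NonUnitalCStarAlgebra L] {ι : ∀ n, S.A n →⋆ₙₐ[ℂ] L}
  (hι : S.IsInductiveLimit ι) {σ : L →⋆ₙₐ[ℂ] (E →L[ℂ] E)} (hσ : Function.Injective σ)
  {π : L →⋆ₙₐ[ℂ] (F →L[ℂ] F)} {U : S.LimGal →* unitary (F →L[ℂ] F)}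
  {C : NonUnitalStarSubalgebra ℂ (F →L[ℂ] F)}

theorem dense_span_lift (hπ : Dense (Submodule.span ℂ {ξ : F | ∃ a η, ξ = π a η} : Set F)) :
    Dense (Submodule.span ℂ {ξ : HTensor F H | ∃ x η, ξ = Stab.lift σ hσ π x η} :
      Set (HTensor F H)) := by
  set V := Submodule.span ℂ {ξ : HTensor F H | ∃ x η, ξ = Stab.lift σ hσ π x η}
  have h1 : ∀ (ξ : F) (η : H), tensorRight F η ξ ∈ V.topologicalClosure := by
    intro ξ η
    rcases eq_or_ne η 0 with rfl | hη
    · have : tensorRight F (0 : H) = 0 := by simpa using tensorRight_smul (E := F) 0 (0 : H)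
      rw [this]
      exact zero_mem _
    refine closure_minimal (t := tensorRight F η ⁻¹' (V.topologicalClosure : Set (HTensor F H)))
      (fun ζ hζ => ?_) (V.isClosed_topologicalClosure.preimage (tensorRight F η).continuous) (hπ ξ)
    refine Submodule.span_induction (p := fun ζ _ => tensorRight F η ζ ∈ V.topologicalClosure)
      ?_ ?_ ?_ ?_ hζ
    · rintro _ ⟨a, ζ, rfl⟩
      refine V.le_topologicalClosure ?_
      have h2 := congrArg (fun f : F →L[ℂ] HTensor F H => f ζ)
        (opTensor_comp_tensorRight (π a) (rankOne ℂ η η) η)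
      simp only [ContinuousLinearMap.comp_apply] at h2
      rw [InnerProductSpace.rankOne_apply, tensorRight_smul, smul_apply,
        ← Stab.lift_unit σ hσ] at h2
      rw [← inv_smul_smul₀ (inner_self_ne_zero (𝕜 := ℂ).2 hη) (tensorRight F η (π a ζ)), ← h2]
      exact V.smul_mem _ (Submodule.subset_span ⟨_, _, rfl⟩)
    · rw [map_zero]; exact zero_mem _
    · intro x y _ _ hx hy
      rw [map_add]; exact add_mem hx hy
    · intro c x _ hx
      rw [map_smul]; exact Submodule.smul_mem _ c hx
  intro ζ
  refine HTensor.denseRange_of.induction_on (p := fun ζ => ζ ∈ closure (V : Set (HTensor F H))) ζ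
    isClosed_closure fun z => ?_
  change HTensor.of F H z ∈ V.topologicalClosure
  induction z using TensorProduct.induction_on with
  | zero => rw [map_zero]; exact zero_mem _
  | tmul ξ η => exact h1 ξ η
  | add x y hx hy => rw [map_add]; exact add_mem hx hy

variable [Nontrivial H]

theorem IsEquivariantRep.stab (h : S.IsEquivariantRep ι π U) :
    (S.stab H ι hι σ).IsEquivariantRep (S.stabι H ι hι σ) (Stab.lift σ hσ π)
      (stabRep H hι hσ U) := by
  refine ⟨Stab.lift_injective σ hσ π h.injective, dense_span_lift hσ h.nondegenerate,
    fun γ n x => ?_⟩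
  obtain ⟨g, rfl⟩ := (S.stabLimGal H ι hι σ hσ).surjective γ
  rw [proj_stabLimGal]
  have hinj := S.comp_injective hι hσ n
  have key : ∀ x : Stab H (σ.comp (ι n)),
      Stab.lift (σ.comp (ι n)) hinj (π.comp (ι n)) (Stab.aut H _ hinj (S.proj n g) x) =
        conjAct (stabRep H hι hσ U) (S.stabLimGal H ι hι σ hσ g)
          (Stab.lift (σ.comp (ι n)) hinj (π.comp (ι n)) x) := by
    refine Stab.induction ?_ ?_ ?_ ?_
    · exact isClosed_eq ((map_continuous (Stab.lift (σ.comp (ι n)) hinj (π.comp (ι n)))).comp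
        (StarAlgEquiv.isometry _).continuous) ((continuous_conjAct _ _).comp
          (map_continuous (Stab.lift (σ.comp (ι n)) hinj (π.comp (ι n)))))
    · rw [map_zero, map_zero, conjAct_zero]
    · intro x y hx hy
      rw [map_add, map_add, hx, hy, map_add, conjAct_add]
    · intro a ξ η
      rw [Stab.aut_unit, Stab.lift_unit, Stab.lift_unit,
        conjAct_opTensor (stabRep_stabLimGal hι hσ U g), NonUnitalStarAlgHom.comp_apply,
        NonUnitalStarAlgHom.comp_apply, h.equivariant]
  rw [← Stab.lift_incl (H := H) hinj hσ (ι n)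
    (fun _ => (NonUnitalStarAlgHom.comp_apply _ _ _).symm) π] at key
  exact key x

/-- If `C` is an inverse noncommutative limit of a sequence, then `C ⊗ 𝒦` is one of the stabilized
sequence. -/
theorem IsGoodWith.stab (hgal : S.gal 0 0 = ⊥) (h : S.IsGoodWith ι π U C) :
    (S.stab H ι hι σ).IsGoodWith (S.stabι H ι hι σ) (Stab.lift σ hσ π) (stabRep H hι hσ U)
      (stabAlg H C) := by
  have hU := stabRep_stabLimGal (H := H) hι hσ U
  have hC := h.isSumOfTranslates
  refine isGoodWith_of (h.rep.stab hι hσ) ?_ (h.isIrred.stabAlg hC.isClosed) ?_ ?_ ?_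
  · rw [disconnLim_stab hι hσ hgal h.rep]
    exact hC.stabAlg (S.stabLimGal H ι hι σ hσ) hU
  · intro x X hX
    have hx := Stab.lift_mem σ hσ π x
    refine stabAlg_induction (p := fun P => P * X ∈ stabAlg H C)
      ((stabAlg_isClosed C).preimage (continuous_mul_const X)) ?_ ?_ ?_ hx
    · rw [zero_mul]; exact zero_mem _
    · intro P Q hP hQ
      rw [add_mul]; exact add_mem hP hQ
    · rintro _ ⟨a, rfl⟩ ξ η
      refine stabAlg_induction (p := fun X => opTensor (π a) (rankOne ℂ ξ η) * X ∈ stabAlg H C)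
        ((stabAlg_isClosed C).preimage (continuous_const_mul _)) ?_ ?_ ?_ hX
      · rw [mul_zero]; exact zero_mem _
      · intro P Q hP hQ
        rw [mul_add]; exact add_mem hP hQ
      · intro c hc ξ' η'
        rw [← opTensor_mul]
        exact opTensor_mem_stabAlg (h.mul_mem a hc)
          ((isCompactOperator_rankOne ξ η).comp_clm (rankOne ℂ ξ' η'))
  · intro x hx
    obtain ⟨e, he⟩ := exists_norm_eq_one (H := H)
    refine Stab.toOp_injective σ (ext_slice fun ξ η => ?_)
    obtain ⟨a, ha, ha'⟩ := Stab.slice_lift σ hσ π x ξ η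
    have ha0 : a = 0 := h.eq_zero_of_mul fun c hc => by
      have h1 := congrArg (slice ξ e) (hx _ (opTensor_rankOne_mem_stabAlg hc η e))
      rw [slice_mul_opTensor, map_zero, InnerProductSpace.rankOne_apply,
        inner_self_eq_norm_sq_to_K, he] at h1
      rw [← ha']
      simpa using h1
    rw [ha, ha0, map_zero, map_zero (Stab.toOp σ), map_zero]
  · intro n δ
    obtain ⟨d, rfl⟩ := (S.stabGalEquiv H ι hι σ hσ n).surjective δ
    obtain ⟨g, hg, rfl⟩ := h.exists_proj_eq n d
    exact ⟨S.stabLimGal H ι hι σ hσ g, (translate_stabAlg_eq_iff (hU g) hC.isClosed).2 hg, rfl⟩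

theorem invGroup_stab (h : S.IsGoodWith ι π U C) :
    (S.stab H ι hι σ).invGroup (stabRep H hι hσ U) (stabAlg H C) =
      (S.invGroup U C).comap (S.stabLimGal H ι hι σ hσ).symm.toMonoidHom := by
  ext γ
  obtain ⟨g, rfl⟩ := (S.stabLimGal H ι hι σ hσ).surjective γ
  rw [invGroup_eq_stabGroup, invGroup_eq_stabGroup, mem_stabGroup,
    translate_stabAlg_eq_iff (stabRep_stabLimGal hι hσ U g) h.isSumOfTranslates.isClosed,
    Subgroup.mem_comap]
  change _ ↔ (S.stabLimGal H ι hι σ hσ).symm _ ∈ _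
  rw [MulEquiv.symm_apply_apply, mem_stabGroup]

end CovSeq

end StabGood

end NCCov

theorem mainTheorem4
    {𝓗 : Type*} [NormedAddCommGroup 𝓗] [InnerProductSpace ℂ 𝓗] [CompleteSpace 𝓗]
    {H : Type*} [NormedAddCommGroup H] [InnerProductSpace ℂ H] [CompleteSpace H]
    [TopologicalSpace.SeparableSpace H] (hH : ¬ FiniteDimensional ℂ H)
    {E : Type*} [NormedAddCommGroup E] [InnerProductSpace ℂ E] [CompleteSpace E]
    (S : NCCov.CovSeq) (hS : S.IsFiniteCoveringSeq)
    {L : Type*} [NonUnitalCStarAlgebra L] (ι : ∀ n, S.A n →⋆ₙₐ[ℂ] L) (hι : S.IsInductiveLimit ι)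
    (σ : L →⋆ₙₐ[ℂ] (E →L[ℂ] E)) (hσ : Function.Injective σ)
    (π : L →⋆ₙₐ[ℂ] (𝓗 →L[ℂ] 𝓗)) (hπ : S.IsGood ι π) :
    (S.stab H ι hι σ).IsFiniteCoveringSeq ∧
    (S.stab H ι hι σ).IsInductiveLimit (S.stabι H ι hι σ) ∧
    ∃ (e : (S.stab H ι hι σ).LimGal ≃* S.LimGal)
      (πK : NCCov.Stab H σ →⋆ₙₐ[ℂ] (NCCov.HTensor 𝓗 H →L[ℂ] NCCov.HTensor 𝓗 H)),
      (∀ (γ : (S.stab H ι hι σ).LimGal) (n : ℕ) (a : S.A n)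
          (k : {k : H →L[ℂ] H // IsCompactOperator k}),
        ((S.stab H ι hι σ).proj n γ : (S.stab H ι hι σ).A n ≃⋆ₐ[ℂ] (S.stab H ι hι σ).A n)
          (S.stabTmul ι hι σ n a k) =
        S.stabTmul ι hι σ n ((S.proj n (e γ) : S.A n ≃⋆ₐ[ℂ] S.A n) a) k) ∧
      (∀ (a : L) (k : {k : H →L[ℂ] H // IsCompactOperator k}),
        πK (NCCov.Stab.tmul σ a k) = NCCov.opTensor (π a) (k : H →L[ℂ] H)) ∧
      (S.stab H ι hι σ).IsGood (S.stabι H ι hι σ) πK ∧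
      ∀ (U : S.LimGal →* unitary (𝓗 →L[ℂ] 𝓗)) (C : NonUnitalStarSubalgebra ℂ (𝓗 →L[ℂ] 𝓗)),
        S.IsGoodWith ι π U C →
        ((S.stab H ι hι σ).disconnLim (S.stabι H ι hι σ) πK
            ((NCCov.ampUnitary H).comp (U.comp e.toMonoidHom)) =
          NCCov.stabAlg H (S.disconnLim ι π U)) ∧
        (S.stab H ι hι σ).IsGoodWith (S.stabι H ι hι σ) πK
          ((NCCov.ampUnitary H).comp (U.comp e.toMonoidHom)) (NCCov.stabAlg H C) ∧
        (S.stab H ι hι σ).invGroup ((NCCov.ampUnitary H).comp (U.comp e.toMonoidHom))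
          (NCCov.stabAlg H C) = (S.invGroup U C).comap e.toMonoidHom ∧
        ∀ (U' : (S.stab H ι hι σ).LimGal →*
              unitary (NCCov.HTensor 𝓗 H →L[ℂ] NCCov.HTensor 𝓗 H))
            (D : NonUnitalStarSubalgebra ℂ (NCCov.HTensor 𝓗 H →L[ℂ] NCCov.HTensor 𝓗 H)),
          (S.stab H ι hι σ).IsGoodWith (S.stabι H ι hι σ) πK U' D →
          Nonempty (D ≃⋆ₐ[ℂ] NCCov.stabAlg H C) ∧
          Nonempty ((S.stab H ι hι σ).invGroup U' D ≃* S.invGroup U C) := by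
  have : Nontrivial H := by
    by_contra h
    rw [not_nontrivial_iff_subsingleton] at h
    exact hH inferInstance
  obtain ⟨U₀, C₀, h₀⟩ := hπ
  have hrep := h₀.rep
  refine ⟨S.stab_isFiniteCoveringSeq ι hι σ hσ hS, S.stab_isInductiveLimit ι hι σ,
    (S.stabLimGal H ι hι σ hσ).symm, NCCov.Stab.lift σ hσ π, fun γ n a k => ?_,
    fun a k => NCCov.Stab.lift_tmul σ hσ π a k, ⟨_, _, h₀.stab hι hσ (hS.gal_self 0)⟩,
    fun U C hC => ⟨NCCov.CovSeq.disconnLim_stab hι hσ (hS.gal_self 0) hC.rep,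
      hC.stab hι hσ (hS.gal_self 0), NCCov.CovSeq.invGroup_stab hι hσ hC, fun U' D hD => ?_⟩⟩
  · obtain ⟨g, rfl⟩ := (S.stabLimGal H ι hι σ hσ).surjective γ
    rw [MulEquiv.symm_apply_apply, NCCov.CovSeq.proj_stabLimGal]
    exact NCCov.Stab.aut_tmul _ _ _ _ _
  · obtain ⟨h1, ⟨e⟩⟩ := (hC.stab (H := H) hι hσ (hS.gal_self 0)).nonempty_equiv
      (S.stab_isInductiveLimit ι hι σ) hD
    have h2 := NCCov.CovSeq.invGroup_stab (H := H) hι hσ hC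
    refine ⟨h1, ⟨e.trans ((MulEquiv.subgroupCongr h2).trans ?_)⟩⟩
    exact MulEquiv.ofBijective ((S.stabLimGal H ι hι σ hσ).symm.toMonoidHom.subgroupComap _)
      ⟨fun x y hxy => Subtype.ext ((S.stabLimGal H ι hι σ hσ).symm.injective
        (congrArg Subtype.val hxy)), MonoidHom.subgroupComap_surjective_of_surjective _ _
          (S.stabLimGal H ι hι σ hσ).symm.surjective⟩
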